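/- Let $\mathfrak g$ be a real $2$-step nilpotent Lie algebra of dimension $7$, that is, $0\neq\mathfrak g'\subset\mathfrak z$ where $\mathfrak g'=[\mathfrak g,\mathfrak g]$ and $\mathfrak z$ is the center, and assume $\dim\mathfrak g'\ge 2$. Let $\varphi\in\Lambda^3\mathfrak g^*$ be a $\mathrm G_2$-structure on $\mathfrak g$: in some basis $e_1,\dots,e_7$ with dual basis $e^1,\dots,e^7$, $$\varphi=e^{127}+e^{347}+e^{567}+e^{135}-e^{146}-e^{236}-e^{245}.\tag{$*$}$$ Let $g$ and $\mathrm{vol}$ be the inner product and the volume form determined by $(x\lrcorner\varphi)\wedge(y\lrcorner\varphi)\wedge\varphi=6\,g(x,y)\,\mathrm{vol}$, let $\star$ be the Hodge star, $\psi=\star\varphi$, and let $d$ be the Chevalley–Eilenberg differential. Assume that $\varphi$ is coclosed, $d\psi=0$, and put $$T=\tfrac16\star(d\varphi\wedge\varphi)\,\varphi-\star d\varphi .$$ For $\lambda\in\mathbb R$ let $\nabla^\lambda$ be the left-invariant connection with $g(\nabla^\lambda_xy,z)=g(\nabla^g_xy,z)+\frac\lambda2T(x,y,z)$, where $\nabla^g$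 is the Levi-Civita connection of $g$, and let $R^\lambda_{x,y}=\nabla^\lambda_x\nabla^\lambda_y-\nabla^\lambda_y\nabla^\lambda_x-\nabla^\lambda_{[x,y]}$ be its curvature. Call $\nabla^\lambda$ a $\mathrm G_2$-instanton if $R^\lambda\wedge\psi=0$. Let $\mathfrak r=(\mathfrak g')^\perp$. Define $j:\mathfrak g'\to\mathfrak{so}(\mathfrak r)$ by $g(j(z)x,y)=g(z,[x,y])$ for $x,y\in\mathfrak r$, and $\tau(z)\in\mathfrak{so}(\mathfrak g')$ by $g(\tau(z)z',z'')=\varphi(z,z',z'')$ for $z,z',z''\in\mathfrak g'$. Then $\nabla^\lambda$ is a $\mathrm G_2$-instanton if and only if $\dim\mathfrak g'=3$ and the following conditions hold: 1. $\lambda=1$; 2. there is a $g$-orthonormal basis $e_1,\dots,e_7$ of $\mathfrak g$ such that $\mathfrak g'=\langle e_5,e_6,e_7\rangle$, $\varphi$ is given by $(*)$, and, for some $\mu\neq0$, $$(de^{i+4})^+=\tfrac\mu3\,\sigma_i^+,\qquad i=1,2,3,$$ where $\sigma_1^+=e^{13}-e^{24}$, $\sigma_2^+=-e^{14}-e^{23}$,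 $\sigma_3^+=e^{12}+e^{34}$, and $(\cdot)^+$ denotes the self-dual part of a two-form on $\langle e_1,\dots,e_4\rangle$ with respect to $g$ and the orientation $e^{1234}$; 3. for this $\mu$, $[j(z),j(z')]=\tfrac23\,\mu\,j(\tau(z)z')$ for all $z,z'\in\mathfrak g'$. -/

import Mathlib

open Module

/-! ## Exterior forms on a real vector space -/

namespace Ext

variable {V : Type*} [AddCommGroup V] [Module ℝ V]

/-- Real exterior `k`-forms on `V`. -/
abbrev Form (V : Type*) [AddCommGroup V] [Module ℝ V] (k : ℕ) : Type _ :=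
  V [⋀^Fin k]→ₗ[ℝ] ℝ

/-- The exterior product, normalised as the signed sum over `(k, l)`-shuffles, so that
`(α ∧ β)(x, y) = α x * β y - α y * β x` for one-forms. -/
noncomputable def wedge {k l : ℕ} (α : Form V k) (β : Form V l) : Form V (k + l) :=
  ((LinearMap.mul' ℝ ℝ).compAlternatingMap (α.domCoprod β)).domDomCongr finSumFinEquiv

/-- The interior product `x ⌟ α`. -/
noncomputable def interior {k : ℕ} (x : V) (α : Form V (k + 1)) : Form V k :=
  α.curryLeft x

/-- For a basis `e` with dual basis `e^i`, the form `e^{I 0} ∧ ⋯ ∧ e^{I (k-1)}`, that is,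
`v ↦ det (e^{I a} (v b))`. -/
noncomputable def coframe {n k : ℕ} (e : Basis (Fin n) ℝ V) (I : Fin k → Fin n) : Form V k :=
  (Matrix.detRowAlternating : (Fin k → ℝ) [⋀^Fin k]→ₗ[ℝ] ℝ).compLinearMap
    (LinearMap.pi fun a => e.coord (I a))

theorem append_update_right {X : Type*} {k m : ℕ} (u : Fin k → X) (v : Fin m → X)
    (i : Fin m) (z : X) :
    Fin.append u (Function.update v i z) =
      Function.update (Fin.append u v) (Fin.natAdd k i) z := by
  ext j
  refine Fin.addCases (fun a => ?_) (fun a => ?_) j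
  · have : Fin.castAdd m a ≠ Fin.natAdd k i := by
      intro h
      have := congrArg Fin.val h
      simp at this
      omega
    simp [Function.update_of_ne this]
  · by_cases ha : a = i
    · subst ha; simp
    · have : Fin.natAdd k a ≠ Fin.natAdd k i := by
        intro h; exact ha (by simpa using h)
      simp [Function.update_of_ne this, Function.update_of_ne ha]

/-- Fill the first `k` slots of a `(k + m)`-form with the vectors `u 0, …, u (k-1)`. -/
def contract {k m : ℕ} (u : Fin k → V) (ν : Form V (k + m)) : Form V m where
  toFun v := ν (Fin.append u v)
  map_update_add' := by
    intro _ v i x y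
    have hd := Subsingleton.elim ‹DecidableEq (Fin m)› (instDecidableEqFin m)
    subst hd
    simp [append_update_right]
  map_update_smul' := by
    intro _ v i c x
    have hd := Subsingleton.elim ‹DecidableEq (Fin m)› (instDecidableEqFin m)
    subst hd
    simp [append_update_right]
  map_eq_zero_of_eq' := by
    intro v i j hv hij
    refine ν.map_eq_zero_of_eq (i := Fin.natAdd k i) (j := Fin.natAdd k j) _ ?_ ?_
    · simpa using hv
    · intro h; exact hij (by simpa using h)

/-- The Hodge star `Λ^k → Λ^m` computed in an orthonormal frame `f_0, …, f_{k+m-1}` with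
volume form `ν`:
`(⋆β)(v) = (1 / k!) ∑_I β(f_{I 0}, …, f_{I (k-1)}) ν(f_{I 0}, …, f_{I (k-1)}, v)`,
so that `α ∧ ⋆β = ⟨α, β⟩ ν`. It depends on the frame only through the inner product that makes
the frame orthonormal. -/
noncomputable def hodgeStar {k m : ℕ} (f : Fin (k + m) → V) (ν : Form V (k + m))
    (β : Form V k) : Form V m :=
  (1 / (k.factorial : ℝ)) •
    ∑ I : Fin k → Fin (k + m), β (fun a => f (I a)) • contract (fun a => f (I a)) ν

/-- The linear form `z ↦ T(x, y, z)` of a three-form `T`. -/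
def thirdSlot (T : Form V 3) (x y : V) : V →ₗ[ℝ] ℝ where
  toFun z := T ![x, y, z]
  map_add' z w := by
    have h := T.map_update_add ![x, y, 0] 2 z w
    have e : ∀ u : V, Function.update ![x, y, 0] 2 u = ![x, y, u] := by
      intro u; ext i; fin_cases i <;> rfl
    simpa [e] using h
  map_smul' c z := by
    have h := T.map_update_smul ![x, y, 0] 2 c z
    have e : ∀ u : V, Function.update ![x, y, 0] 2 u = ![x, y, u] := by
      intro u; ext i; fin_cases i <;> rfl
    simpa [e] using h

theorem thirdSlot_apply (T : Form V 3) (x y z : V) : thirdSlot T x y z = T ![x, y, z] := rfl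

theorem thirdSlot_add_left (T : Form V 3) (x x' y : V) :
    thirdSlot T (x + x') y = thirdSlot T x y + thirdSlot T x' y := by
  ext z
  have h := T.map_update_add ![0, y, z] 0 x x'
  have e : ∀ u : V, Function.update ![0, y, z] 0 u = ![u, y, z] := by
    intro u; ext i; fin_cases i <;> rfl
  simpa [thirdSlot_apply, e] using h

theorem thirdSlot_smul_left (T : Form V 3) (c : ℝ) (x y : V) :
    thirdSlot T (c • x) y = c • thirdSlot T x y := by
  ext z
  have h := T.map_update_smul ![0, y, z] 0 c x
  have e : ∀ u : V, Function.update ![0, y, z] 0 u = ![u, y, z] := by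
    intro u; ext i; fin_cases i <;> rfl
  simpa [thirdSlot_apply, e] using h

theorem thirdSlot_add_right (T : Form V 3) (x y y' : V) :
    thirdSlot T x (y + y') = thirdSlot T x y + thirdSlot T x y' := by
  ext z
  have h := T.map_update_add ![x, 0, z] 1 y y'
  have e : ∀ u : V, Function.update ![x, 0, z] 1 u = ![x, u, z] := by
    intro u; ext i; fin_cases i <;> rfl
  simpa [thirdSlot_apply, e] using h

theorem thirdSlot_smul_right (T : Form V 3) (c : ℝ) (x y : V) :
    thirdSlot T x (c • y) = c • thirdSlot T x y := by
  ext z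
  have h := T.map_update_smul ![x, 0, z] 1 c y
  have e : ∀ u : V, Function.update ![x, 0, z] 1 u = ![x, u, z] := by
    intro u; ext i; fin_cases i <;> rfl
  simpa [thirdSlot_apply, e] using h

end Ext

/-! ## Lie algebras -/

section LieAlg

variable (L : Type*) [LieRing L] [LieAlgebra ℝ L]

/-- The commutator ideal, the span of all brackets. -/
def commutatorIdeal : LieIdeal ℝ L := ⁅(⊤ : LieIdeal ℝ L), (⊤ : LieIdeal ℝ L)⁆

/-- The Lie algebra is not abelian and its commutator is central. -/
def IsTwoStepNilpotent : Prop :=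
  commutatorIdeal L ≠ ⊥ ∧ commutatorIdeal L ≤ LieAlgebra.center ℝ L

variable {L}

/-- The Chevalley-Eilenberg differential (trivial coefficients) on forms of positive degree:
`(dω)(x_0, …, x_k) = ∑_{i < j} (-1)^{i + j} ω([x_i, x_j], x_0, …, x̂_i, …, x̂_j, …, x_k)`.
It is written here as minus one half of the corresponding sum over all ordered pairs of
distinct indices, see `ceDiff_apply`; on one-forms, `(dα)(x, y) = - α [x, y]`. -/
noncomputable def ceDiff {k : ℕ} (ω : Ext.Form L (k + 1)) : Ext.Form L (k + 2) :=
  (-(1 / 2 : ℝ)) • AlternatingMap.alternatizeUncurryFin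
    (AlternatingMap.alternatizeUncurryFinLM ∘ₗ
      (LieModule.toEnd ℝ L L : L →ₗ[ℝ] L →ₗ[ℝ] L).compr₂ ω.curryLeft)

theorem ceDiff_apply {k : ℕ} (ω : Ext.Form L (k + 1)) (v : Fin (k + 2) → L) :
    ceDiff ω v = -(1 / 2) * ∑ i : Fin (k + 2), ∑ j : Fin (k + 1), (-1 : ℝ) ^ ((i : ℕ) + (j : ℕ)) *
      ω (Matrix.vecCons ⁅v i, i.removeNth v j⁆ (j.removeNth (i.removeNth v))) := by
  simp [ceDiff, AlternatingMap.alternatizeUncurryFin_apply, Finset.mul_sum, pow_add, mul_assoc]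

theorem ceDiff_one (α : Ext.Form L 1) (x y : L) : ceDiff α ![x, y] = - α ![⁅x, y⁆] := by
  have h : α ![⁅y, x⁆] = - α ![⁅x, y⁆] := by
    rw [← lie_skew]
    have := (α.curryLeft).map_neg ⁅x, y⁆
    simpa using congrArg (fun f => f ![]) this
  have e (p q : L) (w : Fin 0 → L) : α (Matrix.vecCons ⁅p, q⁆ w) = α ![⁅p, q⁆] := by
    congr 1; ext i; fin_cases i; rfl
  rw [ceDiff_apply]
  simp only [e]
  simp [Fin.removeNth, h]
  ring

end LieAlg

/-! ## `G₂`-structures -/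

open Ext

/-- The model three-form
`e^{127} + e^{347} + e^{567} + e^{135} - e^{146} - e^{236} - e^{245}` in the basis `e`
(indices are shifted by one: `e i` stands for `e_{i+1}`). -/
noncomputable def phiModel {V : Type*} [AddCommGroup V] [Module ℝ V]
    (e : Basis (Fin 7) ℝ V) : Form V 3 :=
  coframe e ![0, 1, 6] + coframe e ![2, 3, 6] + coframe e ![4, 5, 6] + coframe e ![0, 2, 4]
    - coframe e ![0, 3, 5] - coframe e ![1, 2, 5] - coframe e ![1, 3, 4]

/-- A `G₂`-structure on a real vector space: a three-form `φ` isomorphic to the model form,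
together with the metric `g` and the volume form `vol` that `φ` determines through
`(x ⌟ φ) ∧ (y ⌟ φ) ∧ φ = 6 g(x, y) vol`; adapted frames are orthonormal for `g`. -/
structure G2Structure (V : Type*) [AddCommGroup V] [Module ℝ V] where
  φ : Form V 3
  g : LinearMap.BilinForm ℝ V
  vol : Form V 7
  exists_frame : ∃ e : Basis (Fin 7) ℝ V,
    (∀ i j, g (e i) (e j) = if i = j then 1 else 0) ∧ φ = phiModel e
  metric_vol : ∀ x y : V,
    wedge (wedge (interior x φ) (interior y φ)) φ = (6 * g x y) • vol

namespace G2Structure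

section Vector

variable {V : Type*} [AddCommGroup V] [Module ℝ V] (S : G2Structure V)

/-- Orthonormality of a basis with respect to the metric of the `G₂`-structure. -/
def IsOrthonormal (e : Basis (Fin 7) ℝ V) : Prop :=
  ∀ i j, S.g (e i) (e j) = if i = j then 1 else 0

/-- Some orthonormal frame in which `φ` is the model form. -/
noncomputable def frame : Basis (Fin 7) ℝ V := S.exists_frame.choose

theorem frame_orthonormal : S.IsOrthonormal S.frame := S.exists_frame.choose_spec.1

theorem frame_phi : S.φ = phiModel S.frame := S.exists_frame.choose_spec.2

theorem g_eq_sum (x y : V) : S.g x y = ∑ i, S.frame.repr x i * S.frame.repr y i := by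
  have h := S.frame_orthonormal
  simp only [IsOrthonormal] at h
  calc S.g x y = S.g (∑ i, S.frame.repr x i • S.frame i) (∑ i, S.frame.repr y i • S.frame i) := by
        rw [S.frame.sum_repr x, S.frame.sum_repr y]
    _ = _ := by
        simp only [map_sum, map_smul, LinearMap.sum_apply, LinearMap.smul_apply, h, smul_eq_mul]
        simp [mul_comm]

theorem g_symm (x y : V) : S.g x y = S.g y x := by
  simp only [g_eq_sum, mul_comm]

theorem g_self_eq_zero {x : V} (h : S.g x x = 0) : x = 0 := by
  rw [g_eq_sum, Finset.sum_eq_zero_iff_of_nonneg (fun i _ => mul_self_nonneg _)] at h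
  refine S.frame.ext_elem fun i => ?_
  simpa using h i (Finset.mem_univ i)

/-- The metric restricted to a subspace is nondegenerate. -/
theorem restrict_nondegenerate (W : Submodule ℝ V) : (S.g.restrict W).Nondegenerate := by
  constructor
  · intro x hx
    exact Subtype.ext (S.g_self_eq_zero (by simpa using hx x))
  · intro x hx
    exact Subtype.ext (S.g_self_eq_zero (by simpa using hx x))

theorem nondegenerate : S.g.Nondegenerate :=
  ⟨fun x hx => S.g_self_eq_zero (hx x), fun x hx => S.g_self_eq_zero (hx x)⟩

theorem finiteDimensional (S : G2Structure V) : FiniteDimensional ℝ V :=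
  S.frame.finiteDimensional_of_finite

/-- The vector of the subspace `W` that represents a linear form on `W` via the metric. -/
noncomputable def sharpOn (W : Submodule ℝ V) (f : W →ₗ[ℝ] ℝ) : W :=
  haveI := S.finiteDimensional
  ((S.g.restrict W).toDual (S.restrict_nondegenerate W)).symm f

theorem g_sharpOn (W : Submodule ℝ V) (f : W →ₗ[ℝ] ℝ) (w : W) :
    S.g (S.sharpOn W f : V) (w : V) = f w := by
  have := S.finiteDimensional
  exact LinearMap.BilinForm.apply_toDual_symm_apply (B := S.g.restrict W)
    (hB := S.restrict_nondegenerate W) f w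

/-- The linear isomorphism `V* → V` given by the metric. -/
noncomputable def sharp : (V →ₗ[ℝ] ℝ) →ₗ[ℝ] V :=
  haveI := S.finiteDimensional
  ((S.g.toDual S.nondegenerate).symm : Dual ℝ V →ₗ[ℝ] V)

theorem g_sharp (f : V →ₗ[ℝ] ℝ) (w : V) : S.g (S.sharp f) w = f w := by
  have := S.finiteDimensional
  exact LinearMap.BilinForm.apply_toDual_symm_apply (B := S.g) (hB := S.nondegenerate) f w

/-- The Hodge star of `g` and `vol`, on `k`-forms with `k + m = 7`. -/
noncomputable def star (k m : ℕ) (h : k + m = 7) (β : Form V k) : Form V m :=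
  hodgeStar (fun i => S.frame (Fin.cast h i)) (S.vol.domDomCongr (finCongr h.symm)) β

/-- The four-form `ψ = ⋆φ`. -/
noncomputable def psi : Form V 4 := S.star 3 4 rfl S.φ

end Vector

section Lie

variable {L : Type*} [LieRing L] [LieAlgebra ℝ L] (S : G2Structure L)

/-- The `G₂`-structure is coclosed: `d⋆φ = 0`. -/
def IsCoclosed : Prop := ceDiff S.psi = 0

/-- The torsion three-form `T = (1/6) ⋆(dφ ∧ φ) φ - ⋆dφ` of the characteristic connection of a
coclosed `G₂`-structure; the zero-form `⋆(dφ ∧ φ)` is evaluated to a number. -/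
noncomputable def torsion : Form L 3 :=
  ((1 / 6 : ℝ) * S.star 7 0 rfl (wedge (ceDiff S.φ) S.φ) ![]) • S.φ
    - S.star 4 3 rfl (ceDiff S.φ)

/-- The linear form `z ↦ g(∇^λ_x y, z)`: the Koszul formula of the Levi-Civita connection on
left-invariant fields, plus `(λ/2) T(x, y, z)`. -/
noncomputable def connForm (lam : ℝ) (x y : L) : L →ₗ[ℝ] ℝ where
  toFun z := (1 / 2) * (S.g ⁅x, y⁆ z + S.g ⁅z, x⁆ y + S.g ⁅z, y⁆ x)
    + lam / 2 * thirdSlot S.torsion x y z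
  map_add' z w := by
    simp only [map_add, add_lie, LinearMap.add_apply]
    ring
  map_smul' c z := by
    simp only [map_smul, smul_lie, LinearMap.smul_apply, smul_eq_mul, RingHom.id_apply]
    ring

/-- The connection `∇^λ`, with
`g(∇^λ_x y, z) = g(∇^g_x y, z) + (λ/2) T(x, y, z)`, as a map `x ↦ ∇^λ_x`. -/
noncomputable def connection (lam : ℝ) : L →ₗ[ℝ] Module.End ℝ L :=
  LinearMap.mk₂ ℝ (fun x y => S.sharp (S.connForm lam x y))
    (by
      intro x x' y
      rw [← map_add]
      congr 1
      ext z
      simp only [connForm, LinearMap.add_apply, LinearMap.coe_mk, AddHom.coe_mk,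
        thirdSlot_add_left, map_add, add_lie, lie_add]
      ring)
    (by
      intro c x y
      rw [← map_smul]
      congr 1
      ext z
      simp only [connForm, LinearMap.smul_apply, LinearMap.coe_mk, AddHom.coe_mk,
        thirdSlot_smul_left, map_smul, smul_lie, lie_smul, smul_eq_mul]
      ring)
    (by
      intro x y y'
      rw [← map_add]
      congr 1
      ext z
      simp only [connForm, LinearMap.add_apply, LinearMap.coe_mk, AddHom.coe_mk,
        thirdSlot_add_right, map_add, lie_add]
      ring)
    (by
      intro c x y
      rw [← map_smul]
      congr 1
      ext z
      simp only [connForm, LinearMap.smul_apply, LinearMap.coe_mk, AddHom.coe_mk,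
        thirdSlot_smul_right, map_smul, lie_smul, smul_eq_mul]
      ring)

theorem g_connection (lam : ℝ) (x y z : L) :
    S.g (S.connection lam x y) z =
      (1 / 2) * (S.g ⁅x, y⁆ z + S.g ⁅z, x⁆ y + S.g ⁅z, y⁆ x)
        + lam / 2 * S.torsion ![x, y, z] :=
  S.g_sharp _ _

/-- The curvature endomorphism `R_{x,y} = ∇_x ∇_y - ∇_y ∇_x - ∇_{[x,y]}` of `∇^λ`. -/
noncomputable def curvature (lam : ℝ) (x y : L) : Module.End ℝ L :=
  S.connection lam x * S.connection lam y - S.connection lam y * S.connection lam x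
    - S.connection lam ⁅x, y⁆

/-- The curvature component `(x, y) ↦ g(R_{x,y} w, z)` of `∇^λ`, as a two-form. -/
noncomputable def curvatureForm (lam : ℝ) (w z : L) : Form L 2 where
  toFun v := S.g (S.curvature lam (v 0) (v 1) w) z
  map_update_add' := by
    intro _ v i x y
    have hd := Subsingleton.elim ‹DecidableEq (Fin 2)› (instDecidableEqFin 2)
    subst hd
    fin_cases i <;> simp [curvature] <;> ring
  map_update_smul' := by
    intro _ v i c x
    have hd := Subsingleton.elim ‹DecidableEq (Fin 2)› (instDecidableEqFin 2)
    subst hd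
    fin_cases i <;> simp [curvature] <;> ring
  map_eq_zero_of_eq' := by
    intro v i j hv hij
    have h : v 0 = v 1 := by
      fin_cases i <;> fin_cases j <;> simp_all
    simp [curvature, h]

/-- `∇^λ` is a `G₂`-instanton: `R^λ ∧ ψ = 0`, that is, every component of the
endomorphism-valued curvature two-form has zero wedge product with `ψ`. -/
def IsInstanton (lam : ℝ) : Prop :=
  ∀ w z : L, wedge (S.curvatureForm lam w z) S.psi = 0

/-- The linear form `y ↦ g(z, [x, y])`. -/
noncomputable def jForm (z x : L) : L →ₗ[ℝ] ℝ :=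
  S.g z ∘ₗ (LieModule.toEnd ℝ L L x : L →ₗ[ℝ] L)

/-- The map `j`, with `g(j(z) x, y) = g(z, [x, y])`. When `z` lies in the (central) commutator
`𝔤'`, `j(z)` vanishes on `𝔤'` and takes values in the orthogonal `𝔯` of `𝔤'`, so that it is
the skew endomorphism `j(z)` of `𝔯` extended by zero to `𝔤'`. -/
noncomputable def j (z : L) : Module.End ℝ L where
  toFun x := S.sharp (S.jForm z x)
  map_add' x y := by
    rw [← map_add]; congr 1; ext w; simp [jForm]
  map_smul' c x := by
    rw [RingHom.id_apply, ← map_smul]; congr 1; ext w; simp [jForm]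

theorem g_j (z x y : L) : S.g (S.j z x) y = S.g z ⁅x, y⁆ := S.g_sharp _ _

/-- For `z, z'` in a subspace `W`, the vector `τ(z) z'` of `W` with
`g(τ(z) z', z'') = φ(z, z', z'')` for all `z''` in `W`. -/
noncomputable def tau (W : Submodule ℝ L) (z z' : W) : W :=
  S.sharpOn W (thirdSlot S.φ (z : L) (z' : L) ∘ₗ W.subtype)

theorem g_tau (W : Submodule ℝ L) (z z' z'' : W) :
    S.g (S.tau W z z' : L) (z'' : L) = S.φ ![(z : L), (z' : L), (z'' : L)] :=
  S.g_sharpOn W _ z''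

end Lie

end G2Structure

/-! ## Self-dual forms -/

section SelfDual

variable {V : Type*} [AddCommGroup V] [Module ℝ V]

/-- The self-dual two-forms `σ₁⁺ = e^{13} - e^{24}`, `σ₂⁺ = -e^{14} - e^{23}`,
`σ₃⁺ = e^{12} + e^{34}`. -/
noncomputable def sigmaPlus (e : Basis (Fin 7) ℝ V) : Fin 3 → Form V 2 :=
  ![coframe e ![0, 2] - coframe e ![1, 3],
    - coframe e ![0, 3] - coframe e ![1, 2],
    coframe e ![0, 1] + coframe e ![2, 3]]

/-- The self-dual component `α⁺ = (α + ⋆α) / 2` of a two-form `α` on the span of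
`e_1, …, e_4`, for the Hodge star of the inner product with orthonormal basis `e_1, …, e_4` and
the orientation `e^{1234}`. Forms on that span are viewed as forms on `V` that vanish on
`e_5, e_6, e_7`. -/
noncomputable def selfDualPart (e : Basis (Fin 7) ℝ V) (α : Form V 2) : Form V 2 :=
  (1 / 2 : ℝ) • (α + hodgeStar (k := 2) (m := 2) ![e 0, e 1, e 2, e 3]
    (coframe e ![0, 1, 2, 3]) α)

end SelfDual

/-!
# `G₂`-instantons on two-step nilpotent Lie algebras

In an orthonormal basis, `R ∧ ψ = 0` says that every component `g(R w, z)` of the curvature has zero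
contraction with `φ` (`wedge_psi_eq_zero_iff`), so the instanton condition is a system of equations
in the structure constants. The point is to choose bases in which these constants are few.

*Position of the commutator.* As `𝔤'` is central, it has dimension two or three
(`finrank_commutatorIdeal_le`). Let `u, v` be orthonormal in `𝔤'`, with cross product `u × v`.

* If `𝔤'` lies in the span of `u`, `v` and `u × v`, there is an adapted basis whose last three
  vectors are these. When `dim 𝔤' = 2`, the vector `u × v` is central because `φ` is coclosed
  (`IsAdapted.lie_ver_of_mem_span`), so that in either dimension the last three vectors are central
  and their span contains all brackets: this is a central frame (`IsCentralFrame`).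
* Otherwise `𝔤'` is spanned by `u`, `v` and a unit vector `c (u × v) + r w` with `r ≠ 0` and `w`
  orthogonal to `u`, `v`, `u × v`. Rotating an adapted basis gives a tilted frame
  (`IsTiltedFrame`), and coclosedness leaves only the brackets `[F_4, F_{j+4}] = ∑_k P_{kj} F_k`
  with `P` symmetric. Three traces of the instanton equations are scalar equations in the squared
  norm and the second elementary symmetric function of `P`. Together they force `P = 0`
  (`IsTiltedFrame.eq_zero_of_isInstanton`), so this case does not occur.

*Central frames.* Write `de^{k+4} = ∑_j (s_{kj} σ_j⁺ + a_{kj} σ_j⁻)` with self-dual forms `σ_j⁺` and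
anti-self-dual forms `σ_j⁻`. Coclosedness means that `s` is symmetric. Put `t = tr s`, `p = |s|²`,
`q = |a|²`. Three traces of the instanton equations, `trace_ver`, `trace_selfDual` and
`trace_mixed`, involve only `λ, t, p, q`, and force `λ = 1` unless `s = a = 0`
(`eq_one_of_scalar_equations`). At `λ = 1` the first of them is `t² = 3 p`, the equality case of the
Cauchy-Schwarz inequality, whence `s = c · id`. Here `c ≠ 0`, since otherwise `a` has rank at most
one and `dim 𝔤' ≤ 1`. What remains of the instanton equations is that the cofactor matrix of `a` is
`-c a` (`cofactor_eq`). With `μ = 3 c`, the equation `s = c · id` is the condition on the self-dual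
parts (`selfDualPart_eq_iff`), and the cofactor equation is the condition on the brackets of `j`
(`commutator_j_iff`).

Conversely, if `λ = 1` and `s = c · id`, the operators `∇_x` vanish for `x` orthogonal to `𝔤'`
(`conn_one_hor`), and the instanton equations reduce to the cofactor equation (`isInstanton_one`).

Basis vectors are numbered from one in the text, as in `e_1, …, e_7`, and from zero in the code.
-/

/-! ### Coframes, exterior products and the Hodge star in a basis -/

namespace Ext

variable {V : Type*} [AddCommGroup V] [Module ℝ V]

/-- For a tuple `K` of distinct indices, the sign of the permutation that sorts it; zero if an
index is repeated. It is written as a product over pairs so that it can be evaluated by `decide`. -/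
def tupleSign {n k : ℕ} (K : Fin k → Fin n) : ℤ :=
  ∏ i, ∏ j ∈ Finset.Ioi i, if K i < K j then 1 else if K i = K j then 0 else -1

theorem form_sum_apply {k : ℕ} {ι : Type*} (s : Finset ι) (f : ι → Form V k) (v : Fin k → V) :
    (∑ i ∈ s, f i) v = ∑ i ∈ s, f i v := by
  classical
  induction s using Finset.induction_on with
  | empty => simp
  | insert i s hi ih => rw [Finset.sum_insert hi, Finset.sum_insert hi, AlternatingMap.add_apply, ih]

theorem coframe_apply {n k : ℕ} (e : Basis (Fin n) ℝ V) (I : Fin k → Fin n) (v : Fin k → V) :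
    coframe e I v = (Matrix.of fun a b => e.repr (v a) (I b)).det := rfl

theorem coframe_apply_basis {n k : ℕ} (e : Basis (Fin n) ℝ V) (I K : Fin k → Fin n) :
    coframe e I (fun a => e (K a)) =
      (Matrix.of fun a b => if K a = I b then (1 : ℝ) else 0).det := by
  rw [coframe_apply]
  congr 1
  ext a b
  simp [Finsupp.single_apply]

theorem coframe_apply_comm {n k : ℕ} (e : Basis (Fin n) ℝ V) (I K : Fin k → Fin n) :
    coframe e I (fun a => e (K a)) = coframe e K (fun a => e (I a)) := by
  rw [coframe_apply_basis, coframe_apply_basis, ← Matrix.det_transpose]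
  congr 1
  ext a b
  simp [eq_comm]

theorem injective_of_tupleSign_ne_zero {n k : ℕ} {K : Fin k → Fin n} (h : tupleSign K ≠ 0) :
    Function.Injective K := by
  intro i j hij
  by_contra hne
  wlog hlt : i < j generalizing i j
  · exact this hij.symm (Ne.symm hne) (lt_of_le_of_ne (not_lt.1 hlt) (Ne.symm hne))
  refine h (Finset.prod_eq_zero (Finset.mem_univ i) ?_)
  exact Finset.prod_eq_zero (Finset.mem_Ioi.2 hlt) (by simp [hij])

theorem tupleSign_comp_perm {n k : ℕ} {L : Fin k → Fin n} (hL : StrictMono L)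
    (σ : Equiv.Perm (Fin k)) : tupleSign (L ∘ σ) = Equiv.Perm.sign σ := by
  rw [Equiv.Perm.sign_eq_prod_prod_Ioi, tupleSign]
  push_cast
  refine Finset.prod_congr rfl fun i _ => Finset.prod_congr rfl fun j hj => ?_
  have hij : σ i ≠ σ j := fun h => (Finset.mem_Ioi.1 hj).ne (σ.injective h)
  simp only [Function.comp, hL.lt_iff_lt, hL.injective.eq_iff, hij, if_false]
  split_ifs <;> rfl

/-- Sorting the arguments of an alternating form. -/
theorem apply_eq_tupleSign_mul {n k : ℕ} (e : Fin n → V) (β : Form V k)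
    (K : Fin k → Fin n) {L : Fin k → Fin n} (hL : StrictMono L) (hK : Function.Injective K)
    (hr : ∀ i, ∃ j, L j = K i) :
    β (fun a => e (K a)) = tupleSign K * β (fun a => e (L a)) := by
  choose f hf using hr
  have hfi : Function.Injective f := fun i j h => hK (by rw [← hf i, ← hf j, h])
  let σ : Equiv.Perm (Fin k) := Equiv.ofBijective f (Finite.injective_iff_bijective.1 hfi)
  have hKL : K = L ∘ σ := by ext i; simp [σ, hf]
  subst hKL
  rw [tupleSign_comp_perm hL]
  have h := β.map_perm (fun a => e (L a)) σ
  have h' : β (fun a => e ((L ∘ σ) a)) = Equiv.Perm.sign σ • β (fun a => e (L a)) := h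
  rw [h', Units.smul_def, zsmul_eq_mul]

/-- Alternating forms agree if they agree on increasing tuples of basis vectors. -/
theorem form_ext {n k : ℕ} (e : Basis (Fin n) ℝ V) {β γ : Form V k}
    (h : ∀ K : Fin k → Fin n, StrictMono K → β (fun a => e (K a)) = γ (fun a => e (K a))) :
    β = γ := by
  refine Basis.ext_alternating e fun v hv => ?_
  have hm : StrictMono (v ∘ Tuple.sort v) :=
    (Tuple.monotone_sort v).strictMono_of_injective (hv.comp (Equiv.injective _))
  have hr : ∀ i, ∃ j, (v ∘ Tuple.sort v) j = v i := fun i => ⟨(Tuple.sort v).symm i, by simp⟩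
  rw [apply_eq_tupleSign_mul e β v hm hv hr, apply_eq_tupleSign_mul e γ v hm hv hr, h _ hm]

/-- Summing an alternating function of the indices against `e^I` over all tuples of basis
vectors. -/
theorem sum_mul_coframe_of_alternating {n k : ℕ} (e : Basis (Fin n) ℝ V)
    (β : (Fin k → Fin n) → ℝ) (I : Fin k → Fin n)
    (hβ : ∀ σ : Equiv.Perm (Fin k), β (I ∘ σ) = Equiv.Perm.sign σ * β I) :
    ∑ K : Fin k → Fin n, β K * coframe e I (fun a => e (K a)) = k.factorial * β I := by
  have h1 : ∀ K : Fin k → Fin n, coframe e I (fun a => e (K a)) =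
      ∑ σ : Equiv.Perm (Fin k), (Equiv.Perm.sign σ : ℝ) * if K = I ∘ σ then 1 else 0 := by
    intro K
    rw [coframe_apply_basis, ← Matrix.det_transpose, Matrix.det_apply']
    refine Finset.sum_congr rfl fun σ _ => ?_
    simp only [Matrix.transpose_apply, Matrix.of_apply, Finset.prod_boole, Finset.mem_univ,
      forall_true_left]
    congr 1
    simp [funext_iff]
  simp only [h1, Finset.mul_sum]
  rw [Finset.sum_comm]
  have h2 : ∀ σ : Equiv.Perm (Fin k), (∑ K : Fin k → Fin n, β K *
      ((Equiv.Perm.sign σ : ℝ) * if K = I ∘ σ then 1 else 0)) = β I := by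
    intro σ
    simp only [mul_ite, mul_one, mul_zero, Finset.sum_ite_eq', Finset.mem_univ, if_true]
    rw [hβ, mul_right_comm, ← Int.cast_mul, ← Units.val_mul]
    simp
  simp only [h2]
  simp [Fintype.card_perm]

theorem sum_mul_coframe {n k : ℕ} (e : Basis (Fin n) ℝ V) (β : Form V k) (I : Fin k → Fin n) :
    ∑ K : Fin k → Fin n, β (fun a => e (K a)) * coframe e I (fun a => e (K a)) =
      k.factorial * β (fun a => e (I a)) := by
  refine sum_mul_coframe_of_alternating e (fun K => β fun a => e (K a)) I fun σ => ?_
  have h := β.map_perm (fun a => e (I a)) σ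
  rw [Units.smul_def, zsmul_eq_mul] at h
  exact h

/-- Expansion of a form in a basis. -/
theorem form_eq_sum_coframe {n k : ℕ} (e : Basis (Fin n) ℝ V) (β : Form V k) :
    β = (1 / (k.factorial : ℝ)) • ∑ K : Fin k → Fin n, β (fun a => e (K a)) • coframe e K := by
  refine Basis.ext_alternating e fun v _ => ?_
  have hs := fun K : Fin k → Fin n => coframe_apply_comm e K v
  simp only [AlternatingMap.smul_apply, form_sum_apply, hs, smul_eq_mul]
  rw [sum_mul_coframe]
  field_simp

theorem wedge_coframe {n k l : ℕ} (e : Basis (Fin n) ℝ V) (I : Fin k → Fin n)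
    (J : Fin l → Fin n) : wedge (coframe e I) (coframe e J) = coframe e (Fin.append I J) := by
  let m : ∀ (p : ℕ) (I : Fin p → Fin n), MultilinearMap ℝ (fun _ : Fin p => V) ℝ := fun p I =>
    (MultilinearMap.mkPiAlgebra ℝ (Fin p) ℝ).compLinearMap fun a => e.coord (I a)
  have hm : ∀ (p : ℕ) (I : Fin p → Fin n),
      coframe e I = MultilinearMap.alternatization (m p I) := by
    intro p I
    ext v
    rw [coframe_apply, Matrix.det_apply, MultilinearMap.alternatization_apply]
    rfl
  rw [wedge, hm, hm, ← MultilinearMap.domCoprod_alternization, hm]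
  ext v
  rw [AlternatingMap.domDomCongr_apply, LinearMap.compAlternatingMap_apply,
    MultilinearMap.alternatization_apply, MultilinearMap.alternatization_apply, map_sum]
  refine Fintype.sum_equiv finSumFinEquiv.permCongr _ _ fun σ => ?_
  rw [Equiv.Perm.sign_permCongr, map_zsmul_unit]
  congr 1
  simp [m, MultilinearMap.domCoprod_apply, Fin.prod_univ_add, Equiv.permCongr_apply]

theorem wedge_add_left {k l : ℕ} (α α' : Form V k) (β : Form V l) :
    wedge (α + α') β = wedge α β + wedge α' β := by
  simp only [wedge, ← AlternatingMap.domCoprod'_apply, TensorProduct.add_tmul, map_add]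
  ext v
  simp

theorem wedge_smul_left {k l : ℕ} (c : ℝ) (α : Form V k) (β : Form V l) :
    wedge (c • α) β = c • wedge α β := by
  simp only [wedge, ← AlternatingMap.domCoprod'_apply, ← TensorProduct.smul_tmul', map_smul]
  ext v
  simp

theorem wedge_add_right {k l : ℕ} (α : Form V k) (β β' : Form V l) :
    wedge α (β + β') = wedge α β + wedge α β' := by
  simp only [wedge, ← AlternatingMap.domCoprod'_apply, TensorProduct.tmul_add, map_add]
  ext v
  simp

theorem wedge_smul_right {k l : ℕ} (c : ℝ) (α : Form V k) (β : Form V l) :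
    wedge α (c • β) = c • wedge α β := by
  simp only [wedge, ← AlternatingMap.domCoprod'_apply, TensorProduct.tmul_smul, map_smul]
  ext v
  simp

theorem wedge_sub_right {k l : ℕ} (α : Form V k) (β β' : Form V l) :
    wedge α (β - β') = wedge α β - wedge α β' := by
  rw [show β - β' = β + (-1 : ℝ) • β' by module, wedge_add_right, wedge_smul_right]
  module

theorem wedge_sum_left {k l : ℕ} {ι : Type*} (s : Finset ι) (α : ι → Form V k) (β : Form V l) :
    wedge (∑ i ∈ s, α i) β = ∑ i ∈ s, wedge (α i) β := by
  classical
  induction s using Finset.induction_on with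
  | empty => simpa using wedge_smul_left 0 (0 : Form V k) β
  | insert i s hi ih => rw [Finset.sum_insert hi, Finset.sum_insert hi, wedge_add_left, ih]

/-- The determinant whose last rows are unit vectors: contraction of `e^K ∧ e^J` with `e_J`. -/
theorem coframe_append_apply {n k l : ℕ} (e : Basis (Fin n) ℝ V) (K I : Fin k → Fin n)
    (J : Fin l → Fin n) (hIJ : Function.Injective (Fin.append I J)) :
    coframe e (Fin.append K J) (fun a => e (Fin.append I J a)) =
      coframe e K (fun a => e (I a)) := by
  rw [coframe_apply_basis, coframe_apply_basis, ← Matrix.det_reindex_self finSumFinEquiv.symm]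
  have h : Matrix.reindex finSumFinEquiv.symm finSumFinEquiv.symm
      (Matrix.of fun a b => if Fin.append I J a = Fin.append K J b then (1 : ℝ) else 0) =
      Matrix.fromBlocks (Matrix.of fun a b => if I a = K b then (1 : ℝ) else 0) 0
        (Matrix.of fun a b => if J a = K b then (1 : ℝ) else 0) 1 := by
    have hJ : Function.Injective J := fun a b h => by
      have := @hIJ (Fin.natAdd k a) (Fin.natAdd k b) (by simpa using h)
      simpa using this
    have hd : ∀ a b, I a ≠ J b := fun a b h => by
      have := @hIJ (Fin.castAdd l a) (Fin.natAdd k b) (by simpa using h)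
      have := congrArg Fin.val this
      simp at this
      omega
    ext (a | a) (b | b) <;> simp [hd, hJ.eq_iff, Matrix.one_apply]
  rw [h, Matrix.det_fromBlocks_zero₁₂]
  simp

/-- `β ∧ e^J` evaluated on a tuple that ends with `e_J`. -/
theorem wedge_coframe_apply_append {n k l : ℕ} (e : Basis (Fin n) ℝ V) (β : Form V k)
    (I : Fin k → Fin n) (J : Fin l → Fin n) (hIJ : Function.Injective (Fin.append I J)) :
    wedge β (coframe e J) (fun a => e (Fin.append I J a)) = β (fun a => e (I a)) := by
  conv_lhs => rw [form_eq_sum_coframe e β, wedge_smul_left, wedge_sum_left]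
  conv_rhs => rw [form_eq_sum_coframe e β]
  simp only [wedge_smul_left, wedge_coframe, AlternatingMap.smul_apply, form_sum_apply,
    coframe_append_apply e _ I J hIJ]

/-- `β ∧ e^J` evaluated on an increasing tuple that contains `e_J`. -/
theorem wedge_coframe_apply_of_mem {n k l : ℕ} (e : Basis (Fin n) ℝ V) (β : Form V k)
    (I : Fin k → Fin n) (J : Fin l → Fin n) {L : Fin (k + l) → Fin n} (hL : StrictMono L)
    (hIJ : Function.Injective (Fin.append I J)) (hr : ∀ i, ∃ j, L j = Fin.append I J i) :
    wedge β (coframe e J) (fun a => e (L a)) =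
      tupleSign (Fin.append I J) * β (fun a => e (I a)) := by
  have h := apply_eq_tupleSign_mul e (wedge β (coframe e J)) _ hL hIJ hr
  rw [wedge_coframe_apply_append e β I J hIJ] at h
  obtain ⟨σ, hσ⟩ : ∃ σ : Equiv.Perm (Fin (k + l)), L ∘ σ = Fin.append I J := by
    choose f hf using hr
    have hfi : Function.Injective f := fun i j h => hIJ (by rw [← hf i, ← hf j, h])
    exact ⟨Equiv.ofBijective f (Finite.injective_iff_bijective.1 hfi), by ext i; simp [hf]⟩
  rw [h, ← hσ, tupleSign_comp_perm hL, ← mul_assoc, ← Int.cast_mul, ← Units.val_mul]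
  simp

/-- `β ∧ e^J` vanishes on basis vectors that do not contain `e_J`. -/
theorem wedge_coframe_apply_of_notMem {n k l : ℕ} (e : Basis (Fin n) ℝ V) (β : Form V k)
    (J : Fin l → Fin n) (L : Fin (k + l) → Fin n) (b : Fin l) (hb : ∀ a, L a ≠ J b) :
    wedge β (coframe e J) (fun a => e (L a)) = 0 := by
  rw [form_eq_sum_coframe e β, wedge_smul_left, wedge_sum_left]
  simp only [wedge_smul_left, wedge_coframe, AlternatingMap.smul_apply, form_sum_apply]
  have h : ∀ K : Fin k → Fin n, coframe e (Fin.append K J) (fun a => e (L a)) = 0 := fun K => by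
    rw [coframe_apply_basis]
    exact Matrix.det_eq_zero_of_column_eq_zero (Fin.natAdd k b) fun a => by simp [hb a]
  simp [h]

/-- A top-degree coframe evaluated on the basis itself. -/
theorem coframe_apply_self {n : ℕ} (e : Basis (Fin n) ℝ V) (I : Fin n → Fin n) :
    coframe e I (fun a => e a) = tupleSign I := by
  by_cases hI : Function.Injective I
  · let σ : Equiv.Perm (Fin n) := Equiv.ofBijective I (Finite.injective_iff_bijective.1 hI)
    have h := tupleSign_comp_perm (L := id) strictMono_id σ
    have hσ : id ∘ σ = I := by ext; simp [σ]
    rw [hσ] at h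
    have hc := coframe_apply_basis e I id
    have hm : (Matrix.of fun a b => if id a = I b then (1 : ℝ) else 0) =
        (Equiv.Perm.permMatrix ℝ σ).transpose := by
      ext a b
      simp [σ, Equiv.Perm.permMatrix, PEquiv.toMatrix_apply, eq_comm]
    rw [hm, Matrix.det_transpose, Matrix.det_permutation] at hc
    rw [h]
    simpa using hc
  · have h0 : tupleSign I = 0 := by
      by_contra h
      exact hI (injective_of_tupleSign_ne_zero h)
    rw [Function.Injective] at hI
    push Not at hI
    obtain ⟨i, j, hij, hne⟩ := hI
    rw [h0, Int.cast_zero, coframe_apply]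
    exact Matrix.det_zero_of_column_eq hne fun a => by simp [hij]

theorem coframe_id_apply {n : ℕ} (e : Basis (Fin n) ℝ V) (L : Fin n → Fin n) :
    coframe e id (fun a => e (L a)) = tupleSign L := by
  rw [coframe_apply_comm, ← coframe_apply_self e L]
  rfl

/-- A sum over all tuples of vectors from a frame does not change under an orthogonal change of
the frame. -/
theorem sum_orthogonal_frame {n k : ℕ} (F G : MultilinearMap ℝ (fun _ : Fin k => V) ℝ)
    (e f : Fin n → V) (P : Matrix (Fin n) (Fin n) ℝ) (hP : P.transpose * P = 1)
    (hf : ∀ i, f i = ∑ j, P i j • e j) :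
    ∑ I : Fin k → Fin n, F (fun a => f (I a)) * G (fun a => f (I a)) =
      ∑ I : Fin k → Fin n, F (fun a => e (I a)) * G (fun a => e (I a)) := by
  have h1 : ∀ (F : MultilinearMap ℝ (fun _ : Fin k => V) ℝ) (I : Fin k → Fin n),
      F (fun a => f (I a)) = ∑ J : Fin k → Fin n, (∏ a, P (I a) (J a)) * F (fun a => e (J a)) := by
    intro F I
    simp only [hf]
    rw [F.map_sum]
    refine Finset.sum_congr rfl fun J _ => ?_
    rw [F.map_smul_univ, smul_eq_mul]
  have h2 : ∀ J K : Fin k → Fin n,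
      ∑ I : Fin k → Fin n, (∏ a, P (I a) (J a)) * ∏ a, P (I a) (K a) =
        if J = K then 1 else 0 := by
    intro J K
    simp only [← Finset.prod_mul_distrib]
    have := Finset.prod_univ_sum (fun _ : Fin k => (Finset.univ : Finset (Fin n)))
      (fun a i => P i (J a) * P i (K a))
    rw [Fintype.piFinset_univ] at this
    rw [← this]
    have h3 : ∀ a, ∑ i, P i (J a) * P i (K a) = if J a = K a then 1 else 0 := fun a => by
      have := congrFun (congrFun hP (J a)) (K a)
      simpa [Matrix.mul_apply, Matrix.one_apply] using this
    simp only [h3, Finset.prod_boole, Finset.mem_univ, forall_true_left]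
    simp [funext_iff]
  calc _ = ∑ I : Fin k → Fin n, ∑ J : Fin k → Fin n, ∑ K : Fin k → Fin n,
        ((∏ a, P (I a) (J a)) * ∏ a, P (I a) (K a)) *
          (F (fun a => e (J a)) * G (fun a => e (K a))) := by
        refine Finset.sum_congr rfl fun I _ => ?_
        rw [h1 F, h1 G, Finset.sum_mul_sum]
        refine Finset.sum_congr rfl fun J _ => Finset.sum_congr rfl fun K _ => by ring
    _ = ∑ J : Fin k → Fin n, ∑ K : Fin k → Fin n, (if J = K then 1 else 0) *
          (F (fun a => e (J a)) * G (fun a => e (K a))) := by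
        rw [Finset.sum_comm]
        refine Finset.sum_congr rfl fun J _ => ?_
        rw [Finset.sum_comm]
        refine Finset.sum_congr rfl fun K _ => ?_
        rw [← Finset.sum_mul, h2]
    _ = _ := by simp

/-- In an oriented frame, `⋆β` on the last vectors is `β` on the first ones. -/
theorem hodgeStar_apply_append {k m : ℕ} (e : Basis (Fin (k + m)) ℝ V) (ν : Form V (k + m))
    (β : Form V k) (I : Fin k → Fin (k + m)) (J : Fin m → Fin (k + m))
    (hIJ : Function.Injective (Fin.append I J)) (hν : ν (fun a => e (Fin.append I J a)) = 1) :
    hodgeStar e ν β (fun a => e (J a)) = β (fun a => e (I a)) := by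
  let σ : Equiv.Perm (Fin (k + m)) :=
    Equiv.ofBijective _ (Finite.injective_iff_bijective.1 hIJ)
  -- `ν` is the top coframe of the reordered basis
  have hν' : ν = coframe e (Fin.append I J) := by
    refine Basis.ext_alternating (e.reindex σ.symm) fun v hv => ?_
    let τ : Equiv.Perm (Fin (k + m)) :=
      Equiv.ofBijective v (Finite.injective_iff_bijective.1 hv)
    have key : ∀ ω : Form V (k + m), ω (fun i => e.reindex σ.symm (v i)) =
        Equiv.Perm.sign τ • ω (fun a => e (Fin.append I J a)) := fun ω => by
      rw [← ω.map_perm]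
      congr 1
      ext i
      simp [σ, τ]
    rw [key, key, hν, coframe_apply_basis]
    have h1 : (Matrix.of fun a b => if Fin.append I J a = Fin.append I J b then (1 : ℝ) else 0) =
        1 := by
      ext a b
      simp [hIJ.eq_iff, Matrix.one_apply]
    rw [h1, Matrix.det_one]
  have hc : ∀ K : Fin k → Fin (k + m), contract (fun a => e (K a)) ν (fun a => e (J a)) =
      coframe e I (fun a => e (K a)) := by
    intro K
    have h0 : contract (fun a => e (K a)) ν (fun a => e (J a)) =
        ν (fun a => e (Fin.append K J a)) := by
      change ν _ = ν _
      congr 1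
      ext a
      refine Fin.addCases (fun b => ?_) (fun b => ?_) a <;> simp
    rw [h0, hν', coframe_apply_comm, coframe_append_apply e K I J hIJ, coframe_apply_comm]
  simp only [hodgeStar, AlternatingMap.smul_apply, form_sum_apply, hc, smul_eq_mul]
  rw [sum_mul_coframe]
  field_simp

theorem append_update_left {X : Type*} {k m : ℕ} (u : Fin k → X) (v : Fin m → X)
    (i : Fin k) (z : X) :
    Fin.append (Function.update u i z) v =
      Function.update (Fin.append u v) (Fin.castAdd m i) z := by
  ext j
  refine Fin.addCases (fun a => ?_) (fun a => ?_) j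
  · by_cases ha : a = i
    · subst ha; simp
    · have : Fin.castAdd m a ≠ Fin.castAdd m i := fun h => ha (by simpa using h)
      simp [Function.update_of_ne this, Function.update_of_ne ha]
  · have : Fin.natAdd k a ≠ Fin.castAdd m i := by
      intro h
      have := congrArg Fin.val h
      simp at this
      omega
    simp [Function.update_of_ne this]

/-- The Hodge star does not depend on the orthonormal frame. -/
theorem hodgeStar_orthogonal_frame {k m : ℕ} (ν : Form V (k + m)) (β : Form V k)
    (e f : Fin (k + m) → V) (P : Matrix (Fin (k + m)) (Fin (k + m)) ℝ)
    (hP : P.transpose * P = 1) (hf : ∀ i, f i = ∑ j, P i j • e j) :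
    hodgeStar f ν β = hodgeStar e ν β := by
  ext v
  let G : MultilinearMap ℝ (fun _ : Fin k => V) ℝ :=
    { toFun := fun u => ν (Fin.append u v)
      map_update_add' := by
        intro _ u i x y
        have hd := Subsingleton.elim ‹DecidableEq (Fin k)› (instDecidableEqFin k)
        subst hd
        simp [append_update_left]
      map_update_smul' := by
        intro _ u i c x
        have hd := Subsingleton.elim ‹DecidableEq (Fin k)› (instDecidableEqFin k)
        subst hd
        simp [append_update_left] }
  have h := sum_orthogonal_frame β.toMultilinearMap G e f P hP hf
  simp only [hodgeStar, AlternatingMap.smul_apply, form_sum_apply, smul_eq_mul]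
  congr 1

end Ext

/-! ### Orthonormal, oriented and adapted bases -/

namespace Ext

variable {V : Type*} [AddCommGroup V] [Module ℝ V]

theorem wedge_wedge_coframe {n a b c : ℕ} (e : Basis (Fin n) ℝ V) (I : Fin a → Fin n)
    (J : Fin b → Fin n) (K : Fin c → Fin n) :
    wedge (wedge (coframe e I) (coframe e J)) (coframe e K) =
      coframe e (Fin.append (Fin.append I J) K) := by rw [wedge_coframe, wedge_coframe]

theorem contract_coframe_append {n k m : ℕ} (e : Basis (Fin n) ℝ V)
    (I : Fin k → Fin n) (J : Fin m → Fin n) (hIJ : Function.Injective (Fin.append I J)) :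
    contract (fun a => e (I a)) (coframe e (Fin.append I J)) = coframe e J := by
  ext v
  change coframe e (Fin.append I J) (Fin.append (fun a => e (I a)) v) = _
  rw [coframe_apply, coframe_apply, ← Matrix.det_reindex_self finSumFinEquiv.symm]
  have hI : Function.Injective I := fun a b h => by
    have := @hIJ (Fin.castAdd m a) (Fin.castAdd m b) (by simpa using h)
    simpa using this
  have hd : ∀ a b, I a ≠ J b := fun a b h => by
    have := @hIJ (Fin.castAdd m a) (Fin.natAdd k b) (by simpa using h)
    have := congrArg Fin.val this
    simp at this
    omega
  have h : Matrix.reindex finSumFinEquiv.symm finSumFinEquiv.symm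
      (Matrix.of fun a b => e.repr (Fin.append (fun a => e (I a)) v a) (Fin.append I J b)) =
      Matrix.fromBlocks 1 0 (Matrix.of fun a b => e.repr (v a) (I b))
        (Matrix.of fun a b => e.repr (v a) (J b)) := by
    ext (a | a) (b | b) <;>
      simp [hd, hI.eq_iff, Matrix.one_apply, Finsupp.single_apply]
  rw [h, Matrix.det_fromBlocks_zero₁₂]
  simp

/-- In an oriented frame, `⋆e^I = e^J` for complementary `I` and `J`. -/
theorem hodgeStar_coframe {k m : ℕ} (e : Basis (Fin (k + m)) ℝ V)
    (I : Fin k → Fin (k + m)) (J : Fin m → Fin (k + m))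
    (hIJ : Function.Injective (Fin.append I J)) :
    hodgeStar e (coframe e (Fin.append I J)) (coframe e I) = coframe e J := by
  rw [← contract_coframe_append e I J hIJ]
  ext v
  set ν := coframe e (Fin.append I J)
  simp only [hodgeStar, AlternatingMap.smul_apply, form_sum_apply, smul_eq_mul]
  have h := sum_mul_coframe_of_alternating e
    (fun K => contract (fun a => e (K a)) ν v) I (fun σ => by
      have h1 : Fin.append (fun a => e ((I ∘ σ) a)) v =
          Fin.append (fun a => e (I a)) v ∘
            finSumFinEquiv.permCongr (Equiv.Perm.sumCongr σ 1) := by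
        ext a
        refine Fin.addCases (fun b => ?_) (fun b => ?_) a <;> simp [Equiv.permCongr_apply]
      change ν _ = _ * ν _
      rw [h1, AlternatingMap.map_perm, Equiv.Perm.sign_permCongr, Equiv.Perm.sign_sumCongr,
        Units.smul_def, zsmul_eq_mul]
      simp)
  simp only [mul_comm (coframe e I _)]
  rw [h]
  field_simp

theorem hodgeStar_add {k m : ℕ} (f : Fin (k + m) → V) (ν : Form V (k + m)) (β γ : Form V k) :
    hodgeStar f ν (β + γ) = hodgeStar f ν β + hodgeStar f ν γ := by
  simp only [hodgeStar, AlternatingMap.add_apply, add_smul, Finset.sum_add_distrib, smul_add]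

theorem hodgeStar_smul {k m : ℕ} (f : Fin (k + m) → V) (ν : Form V (k + m)) (c : ℝ)
    (β : Form V k) : hodgeStar f ν (c • β) = c • hodgeStar f ν β := by
  simp only [hodgeStar, AlternatingMap.smul_apply, smul_assoc, ← Finset.smul_sum]
  rw [smul_comm]

theorem hodgeStar_sub {k m : ℕ} (f : Fin (k + m) → V) (ν : Form V (k + m)) (β γ : Form V k) :
    hodgeStar f ν (β - γ) = hodgeStar f ν β - hodgeStar f ν γ := by
  rw [show β - γ = β + (-1 : ℝ) • γ by module, hodgeStar_add, hodgeStar_smul]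
  module

theorem top_form_eq_coframe {n : ℕ} (e : Basis (Fin n) ℝ V) (ν : Form V n) :
    ν = ν (fun a => e a) • coframe e id := by
  refine Basis.ext_alternating e fun v hv => ?_
  let τ : Equiv.Perm (Fin n) := Equiv.ofBijective v (Finite.injective_iff_bijective.1 hv)
  have key : ∀ ω : Form V n, ω (fun i => e (v i)) =
      Equiv.Perm.sign τ • ω (fun a => e a) := fun ω => ω.map_perm (fun a => e a) τ
  have h1 : coframe e id (fun a => e a) = 1 := by
    rw [coframe_apply_self]
    simpa using tupleSign_comp_perm (L := (id : Fin n → Fin n)) strictMono_id 1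
  rw [key, key, AlternatingMap.smul_apply, h1]
  simp

theorem interior_apply {k : ℕ} (x : V) (α : Form V (k + 1)) (v : Fin k → V) :
    interior x α v = α (Matrix.vecCons x v) := rfl

end Ext

namespace G2Structure

variable {V : Type*} [AddCommGroup V] [Module ℝ V] (S : G2Structure V)

/-- A basis is adapted if it is orthonormal and `φ` is the model form in it. -/
def IsAdapted (e : Basis (Fin 7) ℝ V) : Prop := S.IsOrthonormal e ∧ S.φ = phiModel e

/-- An orthonormal basis on which the volume form takes the value one. -/
def IsOriented (e : Basis (Fin 7) ℝ V) : Prop :=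
  S.IsOrthonormal e ∧ S.vol (fun a => e a) = 1

variable {S}

theorem IsOrthonormal.repr_eq {e : Basis (Fin 7) ℝ V} (he : S.IsOrthonormal e) (x : V)
    (i : Fin 7) : e.repr x i = S.g x (e i) := by
  conv_rhs => rw [← e.sum_repr x]
  simp only [IsOrthonormal] at he
  simp only [map_sum, map_smul, LinearMap.sum_apply, LinearMap.smul_apply, he]
  simp

theorem IsOrthonormal.g_eq {e : Basis (Fin 7) ℝ V} (he : S.IsOrthonormal e) (x y : V) :
    S.g x y = ∑ i, S.g x (e i) * S.g y (e i) := by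
  conv_lhs => rw [← e.sum_repr y]
  simp [he.repr_eq, mul_comm]

theorem IsOrthonormal.exists_matrix {e f : Basis (Fin 7) ℝ V} (he : S.IsOrthonormal e)
    (hf : S.IsOrthonormal f) : ∃ P : Matrix (Fin 7) (Fin 7) ℝ,
      P.transpose * P = 1 ∧ ∀ i, f i = ∑ j, P i j • e j := by
  refine ⟨Matrix.of fun i j => S.g (f i) (e j), ?_, fun i => ?_⟩
  · refine mul_eq_one_comm.1 ?_
    ext i j
    rw [Matrix.mul_apply, Matrix.one_apply, ← hf i j, he.g_eq (f i) (f j)]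
    rfl
  · conv_lhs => rw [← e.sum_repr (f i)]
    simp [he.repr_eq]

theorem interior_phiModel_six (e : Basis (Fin 7) ℝ V) : interior (e 6) (phiModel e) =
    coframe e ![0, 1] + coframe e ![2, 3] + coframe e ![4, 5] := by
  ext v
  simp [interior_apply, phiModel, coframe_apply, Matrix.det_fin_three, Matrix.det_fin_two]

theorem wedge_coframe_triple_apply (e : Basis (Fin 7) ℝ V) (I J : Fin 2 → Fin 7)
    (K : Fin 3 → Fin 7) :
    wedge (wedge (coframe e I) (coframe e J)) (coframe e K) (fun a => e a) =
      tupleSign (n := 7) (k := 7) (Fin.append (Fin.append I J) K) := by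
  have h := coframe_apply_self e (Fin.append (Fin.append I J) K)
  rw [← h, wedge_wedge_coframe]

/-- The sign of the volume form on an adapted basis is read off from the equation that defines the
metric, evaluated at the last basis vector. -/
theorem IsAdapted.isOriented {e : Basis (Fin 7) ℝ V} (he : S.IsAdapted e) : S.IsOriented e := by
  refine ⟨he.1, ?_⟩
  have h : wedge (wedge (interior (e 6) S.φ) (interior (e 6) S.φ)) S.φ (fun a => e a) =
      6 * S.vol (fun a => e a) := by
    rw [S.metric_vol, he.1 6 6]
    simp
  rw [he.2, interior_phiModel_six] at h
  simp only [phiModel, wedge_add_left, wedge_add_right, wedge_sub_right,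
    AlternatingMap.add_apply, AlternatingMap.sub_apply, wedge_coframe_triple_apply] at h
  have h6 : ((6 : ℤ) : ℝ) = 6 * S.vol (fun a => e a) := by
    rw [← h]
    norm_cast
  push_cast at h6
  linarith

end G2Structure

namespace G2Structure

variable {V : Type*} [AddCommGroup V] [Module ℝ V] {S : G2Structure V}

theorem frame_isAdapted (S : G2Structure V) : S.IsAdapted S.frame :=
  ⟨S.frame_orthonormal, S.frame_phi⟩

/-- The Hodge star may be computed in any orthonormal basis. -/
theorem IsOrthonormal.star_eq {e : Basis (Fin 7) ℝ V} (he : S.IsOrthonormal e) {k m : ℕ}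
    (h : k + m = 7) (β : Form V k) :
    S.star k m h β = hodgeStar (e.reindex (finCongr h.symm))
      (S.vol.domDomCongr (finCongr h.symm)) β := by
  obtain ⟨P, hP, hf⟩ := he.exists_matrix S.frame_orthonormal
  refine hodgeStar_orthogonal_frame _ _ _ _
    (Matrix.reindex (finCongr h.symm) (finCongr h.symm) P) ?_ fun i => ?_
  · rw [Matrix.transpose_reindex, Matrix.reindex_apply, Matrix.reindex_apply,
      Matrix.submatrix_mul_equiv, hP, Matrix.submatrix_one_equiv]
  · rw [hf]
    refine Fintype.sum_equiv (finCongr h.symm) _ _ fun j => ?_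
    simp

theorem IsOriented.vol_eq {e : Basis (Fin 7) ℝ V} (he : S.IsOriented e) :
    S.vol = coframe e id := by
  have h := top_form_eq_coframe e S.vol
  have h1 : S.vol (fun a => e a) = 1 := he.2
  rwa [h1, one_smul] at h

theorem IsOriented.vol_apply {e : Basis (Fin 7) ℝ V} (he : S.IsOriented e) (L : Fin 7 → Fin 7) :
    S.vol (fun a => e (L a)) = tupleSign L := by
  rw [he.vol_eq]
  exact coframe_id_apply e L

/-- `⋆β` on basis vectors is `β` on the complementary basis vectors, in the order fixed by the
orientation. -/
theorem IsOriented.star_apply {e : Basis (Fin 7) ℝ V} (he : S.IsOriented e) {k m : ℕ}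
    (h : k + m = 7) (β : Form V k) (I : Fin k → Fin 7) (J : Fin m → Fin 7)
    (hIJ : tupleSign (fun a : Fin 7 => Fin.append I J (Fin.cast h.symm a)) = 1) :
    S.star k m h β (fun a => e (J a)) = β (fun a => e (I a)) := by
  set L : Fin 7 → Fin 7 := fun a => Fin.append I J (Fin.cast h.symm a) with hL
  have hLi : Function.Injective L := injective_of_tupleSign_ne_zero (by rw [hIJ]; decide)
  rw [he.1.star_eq h]
  have key := hodgeStar_apply_append (e.reindex (finCongr h.symm))
    (S.vol.domDomCongr (finCongr h.symm)) β (fun a => Fin.cast h.symm (I a))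
    (fun a => Fin.cast h.symm (J a))
  have hap : ∀ a, Fin.append (fun a => Fin.cast h.symm (I a)) (fun a => Fin.cast h.symm (J a)) a =
      Fin.cast h.symm (Fin.append I J a) := fun a => by
    refine Fin.addCases (fun b => ?_) (fun b => ?_) a <;> simp
  simp only [hap] at key
  simp only [Basis.reindex_apply, finCongr_symm, finCongr_apply, Fin.cast_cast,
    Fin.cast_eq_self, AlternatingMap.domDomCongr_apply] at key
  refine key ?_ ?_
  · intro a b hab
    rw [hap, hap] at hab
    have h1 : Fin.append I J a = Fin.append I J b := Fin.cast_injective _ hab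
    have h2 : L (Fin.cast h a) = L (Fin.cast h b) := by simpa [hL] using h1
    simpa using hLi h2
  · have := he.vol_apply L
    rw [hIJ, Int.cast_one] at this
    exact this

theorem IsOriented.star_coframe {e : Basis (Fin 7) ℝ V} (he : S.IsOriented e)
    (I : Fin 3 → Fin 7) (J : Fin 4 → Fin 7) (hIJ : tupleSign (Fin.append I J) = 1)
    (hi : Function.Injective (Fin.append I J)) :
    S.star 3 4 rfl (coframe e I) = coframe e J := by
  have hv : S.vol = coframe e (Fin.append I J) := by
    have h1 := coframe_apply_self e (Fin.append I J)
    have h2 := top_form_eq_coframe e (coframe e (Fin.append I J))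
    rw [h1, hIJ, Int.cast_one, one_smul] at h2
    exact he.vol_eq.trans h2.symm
  rw [he.1.star_eq rfl]
  have h2 := hodgeStar_coframe (k := 3) (m := 4) e I J hi
  rw [← hv] at h2
  refine Eq.trans ?_ h2
  congr 1
  ext i
  simp

theorem IsAdapted.psi_eq {e : Basis (Fin 7) ℝ V} (he : S.IsAdapted e) :
    S.psi = coframe e ![0, 1, 2, 3] + coframe e ![0, 1, 4, 5] + coframe e ![2, 3, 4, 5]
      - coframe e ![1, 3, 5, 6] + coframe e ![1, 2, 4, 6] + coframe e ![0, 3, 4, 6]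
      + coframe e ![0, 2, 5, 6] := by
  have ho := he.isOriented
  have hadd : ∀ β γ : Form V 3, S.star 3 4 rfl (β + γ) = S.star 3 4 rfl β + S.star 3 4 rfl γ :=
    fun β γ => hodgeStar_add _ _ _ _
  have hsub : ∀ β γ : Form V 3, S.star 3 4 rfl (β - γ) = S.star 3 4 rfl β - S.star 3 4 rfl γ :=
    fun β γ => hodgeStar_sub _ _ _ _
  have hneg : ∀ a b c d : Fin 7, coframe e ![b, a, c, d] = - coframe e ![a, b, c, d] := by
    intro a b c d
    ext v
    rw [coframe_apply, AlternatingMap.neg_apply, coframe_apply]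
    have := Matrix.det_permute' (Equiv.swap (0 : Fin 4) 1)
      (Matrix.of fun i j => e.repr (v i) (![a, b, c, d] j))
    rw [Equiv.Perm.sign_swap (by decide)] at this
    rw [show -(Matrix.of fun i j => e.repr (v i) (![a, b, c, d] j)).det = ((-1 : ℤˣ) : ℤ) *
      (Matrix.of fun i j => e.repr (v i) (![a, b, c, d] j)).det by simp, ← this]
    congr 1
    ext i j
    fin_cases j <;> rfl
  rw [psi, he.2, phiModel]
  simp only [hadd, hsub]
  rw [ho.star_coframe ![0, 1, 6] ![2, 3, 4, 5] (by decide) (by decide),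
    ho.star_coframe ![2, 3, 6] ![0, 1, 4, 5] (by decide) (by decide),
    ho.star_coframe ![4, 5, 6] ![0, 1, 2, 3] (by decide) (by decide),
    ho.star_coframe ![0, 2, 4] ![3, 1, 5, 6] (by decide) (by decide),
    ho.star_coframe ![0, 3, 5] ![2, 1, 4, 6] (by decide) (by decide),
    ho.star_coframe ![1, 2, 5] ![3, 0, 4, 6] (by decide) (by decide),
    ho.star_coframe ![1, 3, 4] ![2, 0, 5, 6] (by decide) (by decide),
    hneg 1 3, hneg 1 2, hneg 0 3, hneg 0 2]
  abel

end G2Structure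

/-! ### The instanton condition as a contraction with `φ` -/

namespace Ext

variable {V : Type*} [AddCommGroup V] [Module ℝ V]

/-- The sum `∑_{i,j} γ(e_i, e_j) α(e_i, e_j)`. -/
noncomputable def pairing {n : ℕ} (e : Basis (Fin n) ℝ V) (γ α : Form V 2) : ℝ :=
  ∑ I : Fin 2 → Fin n, γ (fun a => e (I a)) * α (fun a => e (I a))

theorem pairing_add {n : ℕ} (e : Basis (Fin n) ℝ V) (γ γ' α : Form V 2) :
    pairing e (γ + γ') α = pairing e γ α + pairing e γ' α := by
  simp only [pairing, AlternatingMap.add_apply, add_mul, Finset.sum_add_distrib]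

theorem pairing_sub {n : ℕ} (e : Basis (Fin n) ℝ V) (γ γ' α : Form V 2) :
    pairing e (γ - γ') α = pairing e γ α - pairing e γ' α := by
  simp only [pairing, AlternatingMap.sub_apply, sub_mul, Finset.sum_sub_distrib]

theorem pairing_neg {n : ℕ} (e : Basis (Fin n) ℝ V) (γ α : Form V 2) :
    pairing e (-γ) α = -pairing e γ α := by
  simp only [pairing, AlternatingMap.neg_apply, neg_mul, Finset.sum_neg_distrib]

theorem pairing_coframe {n : ℕ} (e : Basis (Fin n) ℝ V) (I : Fin 2 → Fin n) (α : Form V 2) :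
    pairing e (coframe e I) α = 2 * α (fun a => e (I a)) := by
  simpa [pairing, mul_comm] using sum_mul_coframe e α I

end Ext

namespace G2Structure

variable {V : Type*} [AddCommGroup V] [Module ℝ V] {S : G2Structure V}

/-- The contraction `∑_{i,j} φ(e_i, e_j, v) α(e_i, e_j)` of a two-form with `φ`. -/
noncomputable def phiContract (S : G2Structure V) (e : Basis (Fin 7) ℝ V) (v : V) (α : Form V 2) :
    ℝ := pairing e (interior v S.φ) α

theorem IsOrthonormal.phiContract_eq {e f : Basis (Fin 7) ℝ V} (he : S.IsOrthonormal e)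
    (hf : S.IsOrthonormal f) (v : V) (α : Form V 2) :
    S.phiContract f v α = S.phiContract e v α := by
  obtain ⟨P, hP, h⟩ := he.exists_matrix hf
  exact sum_orthogonal_frame (interior v S.φ).toMultilinearMap α.toMultilinearMap e f P hP h

/-- The component of `α ∧ ψ` on the six basis vectors other than `e_1` is, up to sign, half of the
contraction of `α` with `φ` at `e_1`. The following lemmas treat the other basis vectors. -/
theorem IsAdapted.wedge_psi_apply_omit_zero {e : Basis (Fin 7) ℝ V} (he : S.IsAdapted e) (α : Form V 2) :
    wedge α S.psi (fun a => e ((![1, 2, 3, 4, 5, 6] : Fin (2 + 4) → Fin 7) a)) =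
      (1 / 2) * S.phiContract e (e 0) α := by
  have h1 : interior (e 0) (phiModel e) = coframe e ![1, 6] + coframe e ![2, 4] - coframe e ![3, 5] := by
    ext v
    simp [interior_apply, phiModel, coframe_apply, Matrix.det_fin_three, Matrix.det_fin_two]
  rw [he.psi_eq, phiContract, he.2, h1]
  simp only [pairing_add, pairing_sub, pairing_coframe, AlternatingMap.add_apply,
    AlternatingMap.sub_apply, wedge_add_right, wedge_sub_right]
  rw [wedge_coframe_apply_of_notMem e α ![0, 1, 2, 3] ![1, 2, 3, 4, 5, 6] 0 (by decide),
    wedge_coframe_apply_of_notMem e α ![0, 1, 4, 5] ![1, 2, 3, 4, 5, 6] 0 (by decide),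
    wedge_coframe_apply_of_mem e α ![1, 6] ![2, 3, 4, 5] (L := ![1, 2, 3, 4, 5, 6])
      (by decide)
      (by decide) (by decide),
    wedge_coframe_apply_of_mem e α ![2, 4] ![1, 3, 5, 6] (L := ![1, 2, 3, 4, 5, 6])
      (by decide)
      (by decide) (by decide),
    wedge_coframe_apply_of_mem e α ![3, 5] ![1, 2, 4, 6] (L := ![1, 2, 3, 4, 5, 6])
      (by decide)
      (by decide) (by decide),
    wedge_coframe_apply_of_notMem e α ![0, 3, 4, 6] ![1, 2, 3, 4, 5, 6] 0 (by decide),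
    wedge_coframe_apply_of_notMem e α ![0, 2, 5, 6] ![1, 2, 3, 4, 5, 6] 0 (by decide),
    show tupleSign (Fin.append (![1, 6] : Fin 2 → Fin 7) ![2, 3, 4, 5]) = 1
      by decide,
    show tupleSign (Fin.append (![2, 4] : Fin 2 → Fin 7) ![1, 3, 5, 6]) = -1
      by decide,
    show tupleSign (Fin.append (![3, 5] : Fin 2 → Fin 7) ![1, 2, 4, 6]) = -1
      by decide]
  push_cast
  ring

theorem IsAdapted.wedge_psi_apply_omit_one {e : Basis (Fin 7) ℝ V} (he : S.IsAdapted e) (α : Form V 2) :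
    wedge α S.psi (fun a => e ((![0, 2, 3, 4, 5, 6] : Fin (2 + 4) → Fin 7) a)) =
      -(1 / 2) * S.phiContract e (e 1) α := by
  have h1 : interior (e 1) (phiModel e) = -coframe e ![0, 6] - coframe e ![2, 5] - coframe e ![3, 4] := by
    ext v
    simp [interior_apply, phiModel, coframe_apply, Matrix.det_fin_three, Matrix.det_fin_two]
    ring
  rw [he.psi_eq, phiContract, he.2, h1]
  simp only [pairing_sub, pairing_neg, pairing_coframe, AlternatingMap.add_apply,
    AlternatingMap.sub_apply, wedge_add_right, wedge_sub_right]
  rw [wedge_coframe_apply_of_notMem e α ![0, 1, 2, 3] ![0, 2, 3, 4, 5, 6] 1 (by decide),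
    wedge_coframe_apply_of_notMem e α ![0, 1, 4, 5] ![0, 2, 3, 4, 5, 6] 1 (by decide),
    wedge_coframe_apply_of_mem e α ![0, 6] ![2, 3, 4, 5] (L := ![0, 2, 3, 4, 5, 6])
      (by decide)
      (by decide) (by decide),
    wedge_coframe_apply_of_notMem e α ![1, 3, 5, 6] ![0, 2, 3, 4, 5, 6] 0 (by decide),
    wedge_coframe_apply_of_notMem e α ![1, 2, 4, 6] ![0, 2, 3, 4, 5, 6] 0 (by decide),
    wedge_coframe_apply_of_mem e α ![2, 5] ![0, 3, 4, 6] (L := ![0, 2, 3, 4, 5, 6])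
      (by decide)
      (by decide) (by decide),
    wedge_coframe_apply_of_mem e α ![3, 4] ![0, 2, 5, 6] (L := ![0, 2, 3, 4, 5, 6])
      (by decide)
      (by decide) (by decide),
    show tupleSign (Fin.append (![0, 6] : Fin 2 → Fin 7) ![2, 3, 4, 5]) = 1
      by decide,
    show tupleSign (Fin.append (![2, 5] : Fin 2 → Fin 7) ![0, 3, 4, 6]) = 1
      by decide,
    show tupleSign (Fin.append (![3, 4] : Fin 2 → Fin 7) ![0, 2, 5, 6]) = 1
      by decide]
  push_cast
  ring

theorem IsAdapted.wedge_psi_apply_omit_two {e : Basis (Fin 7) ℝ V} (he : S.IsAdapted e) (α : Form V 2) :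
    wedge α S.psi (fun a => e ((![0, 1, 3, 4, 5, 6] : Fin (2 + 4) → Fin 7) a)) =
      (1 / 2) * S.phiContract e (e 2) α := by
  have h1 : interior (e 2) (phiModel e) = -coframe e ![0, 4] + coframe e ![1, 5] + coframe e ![3, 6] := by
    ext v
    simp [interior_apply, phiModel, coframe_apply, Matrix.det_fin_three, Matrix.det_fin_two]
    ring
  rw [he.psi_eq, phiContract, he.2, h1]
  simp only [pairing_add, pairing_neg, pairing_coframe, AlternatingMap.add_apply,
    AlternatingMap.sub_apply, wedge_add_right, wedge_sub_right]
  rw [wedge_coframe_apply_of_notMem e α ![0, 1, 2, 3] ![0, 1, 3, 4, 5, 6] 2 (by decide),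
    wedge_coframe_apply_of_mem e α ![3, 6] ![0, 1, 4, 5] (L := ![0, 1, 3, 4, 5, 6])
      (by decide)
      (by decide) (by decide),
    wedge_coframe_apply_of_notMem e α ![2, 3, 4, 5] ![0, 1, 3, 4, 5, 6] 0 (by decide),
    wedge_coframe_apply_of_mem e α ![0, 4] ![1, 3, 5, 6] (L := ![0, 1, 3, 4, 5, 6])
      (by decide)
      (by decide) (by decide),
    wedge_coframe_apply_of_notMem e α ![1, 2, 4, 6] ![0, 1, 3, 4, 5, 6] 1 (by decide),
    wedge_coframe_apply_of_mem e α ![1, 5] ![0, 3, 4, 6] (L := ![0, 1, 3, 4, 5, 6])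
      (by decide)
      (by decide) (by decide),
    wedge_coframe_apply_of_notMem e α ![0, 2, 5, 6] ![0, 1, 3, 4, 5, 6] 1 (by decide),
    show tupleSign (Fin.append (![3, 6] : Fin 2 → Fin 7) ![0, 1, 4, 5]) = 1
      by decide,
    show tupleSign (Fin.append (![0, 4] : Fin 2 → Fin 7) ![1, 3, 5, 6]) = 1
      by decide,
    show tupleSign (Fin.append (![1, 5] : Fin 2 → Fin 7) ![0, 3, 4, 6]) = 1
      by decide]
  push_cast
  ring

theorem IsAdapted.wedge_psi_apply_omit_three {e : Basis (Fin 7) ℝ V} (he : S.IsAdapted e) (α : Form V 2) :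
    wedge α S.psi (fun a => e ((![0, 1, 2, 4, 5, 6] : Fin (2 + 4) → Fin 7) a)) =
      -(1 / 2) * S.phiContract e (e 3) α := by
  have h1 : interior (e 3) (phiModel e) = coframe e ![0, 5] + coframe e ![1, 4] - coframe e ![2, 6] := by
    ext v
    simp [interior_apply, phiModel, coframe_apply, Matrix.det_fin_three, Matrix.det_fin_two]
    ring
  rw [he.psi_eq, phiContract, he.2, h1]
  simp only [pairing_add, pairing_sub, pairing_coframe, AlternatingMap.add_apply,
    AlternatingMap.sub_apply, wedge_add_right, wedge_sub_right]
  rw [wedge_coframe_apply_of_notMem e α ![0, 1, 2, 3] ![0, 1, 2, 4, 5, 6] 3 (by decide),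
    wedge_coframe_apply_of_mem e α ![2, 6] ![0, 1, 4, 5] (L := ![0, 1, 2, 4, 5, 6])
      (by decide)
      (by decide) (by decide),
    wedge_coframe_apply_of_notMem e α ![2, 3, 4, 5] ![0, 1, 2, 4, 5, 6] 1 (by decide),
    wedge_coframe_apply_of_notMem e α ![1, 3, 5, 6] ![0, 1, 2, 4, 5, 6] 1 (by decide),
    wedge_coframe_apply_of_mem e α ![0, 5] ![1, 2, 4, 6] (L := ![0, 1, 2, 4, 5, 6])
      (by decide)
      (by decide) (by decide),
    wedge_coframe_apply_of_notMem e α ![0, 3, 4, 6] ![0, 1, 2, 4, 5, 6] 1 (by decide),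
    wedge_coframe_apply_of_mem e α ![1, 4] ![0, 2, 5, 6] (L := ![0, 1, 2, 4, 5, 6])
      (by decide)
      (by decide) (by decide),
    show tupleSign (Fin.append (![2, 6] : Fin 2 → Fin 7) ![0, 1, 4, 5]) = 1
      by decide,
    show tupleSign (Fin.append (![0, 5] : Fin 2 → Fin 7) ![1, 2, 4, 6]) = -1
      by decide,
    show tupleSign (Fin.append (![1, 4] : Fin 2 → Fin 7) ![0, 2, 5, 6]) = -1
      by decide]
  push_cast
  ring

theorem IsAdapted.wedge_psi_apply_omit_four {e : Basis (Fin 7) ℝ V} (he : S.IsAdapted e) (α : Form V 2) :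
    wedge α S.psi (fun a => e ((![0, 1, 2, 3, 5, 6] : Fin (2 + 4) → Fin 7) a)) =
      (1 / 2) * S.phiContract e (e 4) α := by
  have h1 : interior (e 4) (phiModel e) = coframe e ![0, 2] - coframe e ![1, 3] + coframe e ![5, 6] := by
    ext v
    simp [interior_apply, phiModel, coframe_apply, Matrix.det_fin_three, Matrix.det_fin_two]
    ring
  rw [he.psi_eq, phiContract, he.2, h1]
  simp only [pairing_add, pairing_sub, pairing_coframe, AlternatingMap.add_apply,
    AlternatingMap.sub_apply, wedge_add_right, wedge_sub_right]
  rw [wedge_coframe_apply_of_mem e α ![5, 6] ![0, 1, 2, 3] (L := ![0, 1, 2, 3, 5, 6])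
      (by decide)
      (by decide) (by decide),
    wedge_coframe_apply_of_notMem e α ![0, 1, 4, 5] ![0, 1, 2, 3, 5, 6] 2 (by decide),
    wedge_coframe_apply_of_notMem e α ![2, 3, 4, 5] ![0, 1, 2, 3, 5, 6] 2 (by decide),
    wedge_coframe_apply_of_mem e α ![0, 2] ![1, 3, 5, 6] (L := ![0, 1, 2, 3, 5, 6])
      (by decide)
      (by decide) (by decide),
    wedge_coframe_apply_of_notMem e α ![1, 2, 4, 6] ![0, 1, 2, 3, 5, 6] 2 (by decide),
    wedge_coframe_apply_of_notMem e α ![0, 3, 4, 6] ![0, 1, 2, 3, 5, 6] 2 (by decide),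
    wedge_coframe_apply_of_mem e α ![1, 3] ![0, 2, 5, 6] (L := ![0, 1, 2, 3, 5, 6])
      (by decide)
      (by decide) (by decide),
    show tupleSign (Fin.append (![5, 6] : Fin 2 → Fin 7) ![0, 1, 2, 3]) = 1
      by decide,
    show tupleSign (Fin.append (![0, 2] : Fin 2 → Fin 7) ![1, 3, 5, 6]) = -1
      by decide,
    show tupleSign (Fin.append (![1, 3] : Fin 2 → Fin 7) ![0, 2, 5, 6]) = -1
      by decide]
  push_cast
  ring

theorem IsAdapted.wedge_psi_apply_omit_five {e : Basis (Fin 7) ℝ V} (he : S.IsAdapted e) (α : Form V 2) :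
    wedge α S.psi (fun a => e ((![0, 1, 2, 3, 4, 6] : Fin (2 + 4) → Fin 7) a)) =
      -(1 / 2) * S.phiContract e (e 5) α := by
  have h1 : interior (e 5) (phiModel e) = -coframe e ![0, 3] - coframe e ![1, 2] - coframe e ![4, 6] := by
    ext v
    simp [interior_apply, phiModel, coframe_apply, Matrix.det_fin_three, Matrix.det_fin_two]
    ring
  rw [he.psi_eq, phiContract, he.2, h1]
  simp only [pairing_sub, pairing_neg, pairing_coframe, AlternatingMap.add_apply,
    AlternatingMap.sub_apply, wedge_add_right, wedge_sub_right]
  rw [wedge_coframe_apply_of_mem e α ![4, 6] ![0, 1, 2, 3] (L := ![0, 1, 2, 3, 4, 6])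
      (by decide)
      (by decide) (by decide),
    wedge_coframe_apply_of_notMem e α ![0, 1, 4, 5] ![0, 1, 2, 3, 4, 6] 3 (by decide),
    wedge_coframe_apply_of_notMem e α ![2, 3, 4, 5] ![0, 1, 2, 3, 4, 6] 3 (by decide),
    wedge_coframe_apply_of_notMem e α ![1, 3, 5, 6] ![0, 1, 2, 3, 4, 6] 2 (by decide),
    wedge_coframe_apply_of_mem e α ![0, 3] ![1, 2, 4, 6] (L := ![0, 1, 2, 3, 4, 6])
      (by decide)
      (by decide) (by decide),
    wedge_coframe_apply_of_mem e α ![1, 2] ![0, 3, 4, 6] (L := ![0, 1, 2, 3, 4, 6])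
      (by decide)
      (by decide) (by decide),
    wedge_coframe_apply_of_notMem e α ![0, 2, 5, 6] ![0, 1, 2, 3, 4, 6] 2 (by decide),
    show tupleSign (Fin.append (![4, 6] : Fin 2 → Fin 7) ![0, 1, 2, 3]) = 1
      by decide,
    show tupleSign (Fin.append (![0, 3] : Fin 2 → Fin 7) ![1, 2, 4, 6]) = 1
      by decide,
    show tupleSign (Fin.append (![1, 2] : Fin 2 → Fin 7) ![0, 3, 4, 6]) = 1
      by decide]
  push_cast
  ring

theorem IsAdapted.wedge_psi_apply_omit_six {e : Basis (Fin 7) ℝ V} (he : S.IsAdapted e) (α : Form V 2) :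
    wedge α S.psi (fun a => e ((![0, 1, 2, 3, 4, 5] : Fin (2 + 4) → Fin 7) a)) =
      (1 / 2) * S.phiContract e (e 6) α := by
  have h1 : interior (e 6) (phiModel e) = coframe e ![0, 1] + coframe e ![2, 3] + coframe e ![4, 5] := by
    ext v
    simp [interior_apply, phiModel, coframe_apply, Matrix.det_fin_three, Matrix.det_fin_two]
  rw [he.psi_eq, phiContract, he.2, h1]
  simp only [pairing_add, pairing_coframe, AlternatingMap.add_apply,
    AlternatingMap.sub_apply, wedge_add_right, wedge_sub_right]
  rw [wedge_coframe_apply_of_mem e α ![4, 5] ![0, 1, 2, 3] (L := ![0, 1, 2, 3, 4, 5])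
      (by decide)
      (by decide) (by decide),
    wedge_coframe_apply_of_mem e α ![2, 3] ![0, 1, 4, 5] (L := ![0, 1, 2, 3, 4, 5])
      (by decide)
      (by decide) (by decide),
    wedge_coframe_apply_of_mem e α ![0, 1] ![2, 3, 4, 5] (L := ![0, 1, 2, 3, 4, 5])
      (by decide)
      (by decide) (by decide),
    wedge_coframe_apply_of_notMem e α ![1, 3, 5, 6] ![0, 1, 2, 3, 4, 5] 3 (by decide),
    wedge_coframe_apply_of_notMem e α ![1, 2, 4, 6] ![0, 1, 2, 3, 4, 5] 3 (by decide),
    wedge_coframe_apply_of_notMem e α ![0, 3, 4, 6] ![0, 1, 2, 3, 4, 5] 3 (by decide),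
    wedge_coframe_apply_of_notMem e α ![0, 2, 5, 6] ![0, 1, 2, 3, 4, 5] 3 (by decide),
    show tupleSign (Fin.append (![4, 5] : Fin 2 → Fin 7) ![0, 1, 2, 3]) = 1
      by decide,
    show tupleSign (Fin.append (![2, 3] : Fin 2 → Fin 7) ![0, 1, 4, 5]) = 1
      by decide,
    show tupleSign (Fin.append (![0, 1] : Fin 2 → Fin 7) ![2, 3, 4, 5]) = 1
      by decide]
  push_cast
  ring

/-- A two-form `α` satisfies `α ∧ ψ = 0` if and only if its contraction with `φ` vanishes: both
say that `α` has no component in the seven-dimensional summand `{v ⌟ φ}` of the two-forms. -/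
theorem wedge_psi_eq_zero_iff {e : Basis (Fin 7) ℝ V} (he : S.IsOrthonormal e) (α : Form V 2) :
    wedge α S.psi = 0 ↔ ∀ v, S.phiContract e v α = 0 := by
  set f := S.frame
  have hf : S.IsAdapted f := S.frame_isAdapted
  constructor
  · intro h v
    rw [hf.1.phiContract_eq he]
    have hb : ∀ m, S.phiContract f (f m) α = 0 := by
      intro m
      have h0 := hf.wedge_psi_apply_omit_zero α
      have h1 := hf.wedge_psi_apply_omit_one α
      have h2 := hf.wedge_psi_apply_omit_two α
      have h3 := hf.wedge_psi_apply_omit_three α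
      have h4 := hf.wedge_psi_apply_omit_four α
      have h5 := hf.wedge_psi_apply_omit_five α
      have h6 := hf.wedge_psi_apply_omit_six α
      rw [h, AlternatingMap.zero_apply] at h0 h1 h2 h3 h4 h5 h6
      fin_cases m
      exacts [by simpa using h0.symm, by simpa using h1.symm, by simpa using h2.symm,
        by simpa using h3.symm, by simpa using h4.symm, by simpa using h5.symm,
        by simpa using h6.symm]
    have hl : ∀ v, S.phiContract f v α = ∑ m, f.repr v m * S.phiContract f (f m) α := by
      intro v
      conv_lhs => rw [← f.sum_repr v]
      have hs : Ext.interior (∑ m, f.repr v m • f m) S.φ =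
          ∑ m, f.repr v m • Ext.interior (f m) S.φ := by
        change S.φ.curryLeft _ = _
        rw [map_sum]
        simp only [map_smul]
        rfl
      rw [phiContract, hs]
      simp only [phiContract, pairing, form_sum_apply,
        AlternatingMap.smul_apply, smul_eq_mul, Finset.sum_mul, Finset.mul_sum, mul_assoc]
      exact Finset.sum_comm
    rw [hl]
    simp [hb]
  · intro h
    have hb : ∀ m, S.phiContract f (f m) α = 0 := fun m => by rw [he.phiContract_eq hf.1, h]
    refine form_ext f fun K hK => ?_
    rw [AlternatingMap.zero_apply]
    -- an increasing `6`-tuple omits exactly one index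
    obtain ⟨m, hm⟩ : ∃ m, m ∉ Set.range K := by
      by_contra hc
      push Not at hc
      have := Fintype.card_le_of_surjective K fun m => hc m
      simp at this
    have key : ∀ L : Fin (2 + 4) → Fin 7, StrictMono L → (∀ j, L j ≠ m) → K = L := by
      intro L hL hLm
      have hr : ∀ M : Fin (2 + 4) → Fin 7, StrictMono M → (∀ j, M j ≠ m) →
          Set.range M = {m}ᶜ := by
        intro M hM hMm
        refine Set.eq_of_subset_of_ncard_le ?_ ?_ (Set.toFinite _)
        · rintro x ⟨j, rfl⟩
          exact hMm j
        · rw [Set.ncard_compl, Set.ncard_range_of_injective hM.injective]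
          simp
      exact (hK.range_inj hL).1
        ((hr K hK fun j h => hm ⟨j, h⟩).trans (hr L hL hLm).symm)
    fin_cases m
    · rw [key ![1, 2, 3, 4, 5, 6] (by decide) (by decide), hf.wedge_psi_apply_omit_zero, hb, mul_zero]
    · rw [key ![0, 2, 3, 4, 5, 6] (by decide) (by decide), hf.wedge_psi_apply_omit_one, hb, mul_zero]
    · rw [key ![0, 1, 3, 4, 5, 6] (by decide) (by decide), hf.wedge_psi_apply_omit_two, hb, mul_zero]
    · rw [key ![0, 1, 2, 4, 5, 6] (by decide) (by decide), hf.wedge_psi_apply_omit_three, hb, mul_zero]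
    · rw [key ![0, 1, 2, 3, 5, 6] (by decide) (by decide), hf.wedge_psi_apply_omit_four, hb, mul_zero]
    · rw [key ![0, 1, 2, 3, 4, 6] (by decide) (by decide), hf.wedge_psi_apply_omit_five, hb, mul_zero]
    · rw [key ![0, 1, 2, 3, 4, 5] (by decide) (by decide), hf.wedge_psi_apply_omit_six, hb, mul_zero]

end G2Structure

/-! ### The cross product and the existence of adapted bases -/

namespace Ext

variable {V : Type*} [AddCommGroup V] [Module ℝ V]

theorem form_swap_left (ω : Form V 3) (x y z : V) : ω ![y, x, z] = -ω ![x, y, z] := by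
  rw [← ω.map_swap ![x, y, z] (i := 0) (j := 1) (by decide)]
  congr 1
  ext i
  fin_cases i <;> rfl

theorem form_swap_right (ω : Form V 3) (x y z : V) : ω ![x, z, y] = -ω ![x, y, z] := by
  rw [← ω.map_swap ![x, y, z] (i := 1) (j := 2) (by decide)]
  congr 1
  ext i
  fin_cases i <;> rfl

end Ext

namespace G2Structure

variable {V : Type*} [AddCommGroup V] [Module ℝ V] (S : G2Structure V)

/-- The cross product of the `G₂`-structure, `g(x × y, z) = φ(x, y, z)`. -/
noncomputable def cross (x y : V) : V := S.sharp (thirdSlot S.φ x y)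

theorem g_cross (x y z : V) : S.g (S.cross x y) z = S.φ ![x, y, z] := S.g_sharp _ _

theorem ext_g {x y : V} (h : ∀ z, S.g x z = S.g y z) : x = y := by
  have h0 : S.g (x - y) (x - y) = 0 := by
    rw [map_sub S.g, LinearMap.sub_apply, h, sub_self]
  exact sub_eq_zero.1 (S.g_self_eq_zero h0)

theorem cross_add_left (x x' y : V) : S.cross (x + x') y = S.cross x y + S.cross x' y := by
  rw [cross, thirdSlot_add_left, map_add]; rfl

theorem cross_smul_left (c : ℝ) (x y : V) : S.cross (c • x) y = c • S.cross x y := by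
  rw [cross, thirdSlot_smul_left, map_smul]; rfl

theorem cross_neg_left (x y : V) : S.cross (-x) y = -S.cross x y := by
  rw [← neg_one_smul ℝ x, cross_smul_left, neg_one_smul]

theorem phi_swap_left (x y z : V) : S.φ ![y, x, z] = -S.φ ![x, y, z] := form_swap_left _ _ _ _

theorem phi_swap_right (x y z : V) : S.φ ![x, z, y] = -S.φ ![x, y, z] := form_swap_right _ _ _ _

theorem phi_self_left (x y : V) : S.φ ![x, x, y] = 0 :=
  S.φ.map_eq_zero_of_eq _ (i := 0) (j := 1) rfl (by decide)

theorem phi_self_right (x y : V) : S.φ ![x, y, y] = 0 :=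
  S.φ.map_eq_zero_of_eq _ (i := 1) (j := 2) rfl (by decide)

theorem phi_self_mid (x y : V) : S.φ ![x, y, x] = 0 :=
  S.φ.map_eq_zero_of_eq _ (i := 0) (j := 2) rfl (by decide)

theorem cross_swap (x y : V) : S.cross y x = -S.cross x y := by
  refine S.ext_g fun z => ?_
  rw [map_neg, LinearMap.neg_apply, g_cross, g_cross, phi_swap_left]

theorem cross_neg_right (x y : V) : S.cross x (-y) = -S.cross x y := by
  rw [cross_swap, cross_neg_left, ← cross_swap]

theorem cross_add_right (x y y' : V) : S.cross x (y + y') = S.cross x y + S.cross x y' := by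
  rw [S.cross_swap (y + y') x, cross_add_left, S.cross_swap y x, S.cross_swap y' x]
  abel

theorem g_cross_left (x y : V) : S.g (S.cross x y) x = 0 := by
  rw [g_cross, phi_self_mid]

theorem g_cross_right (x y : V) : S.g (S.cross x y) y = 0 := by
  rw [g_cross, phi_self_right]

theorem phiModel_apply (e : Basis (Fin 7) ℝ V) (x y z : V) : phiModel e ![x, y, z] =
      (e.repr x 1 * e.repr y 6 - e.repr x 6 * e.repr y 1 + e.repr x 2 * e.repr y 4
        - e.repr x 4 * e.repr y 2 - (e.repr x 3 * e.repr y 5 - e.repr x 5 * e.repr y 3))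
          * e.repr z 0
      + (e.repr x 6 * e.repr y 0 - e.repr x 0 * e.repr y 6 - (e.repr x 2 * e.repr y 5
        - e.repr x 5 * e.repr y 2) - (e.repr x 3 * e.repr y 4 - e.repr x 4 * e.repr y 3))
          * e.repr z 1
      + (e.repr x 3 * e.repr y 6 - e.repr x 6 * e.repr y 3 - (e.repr x 0 * e.repr y 4
        - e.repr x 4 * e.repr y 0) + (e.repr x 1 * e.repr y 5 - e.repr x 5 * e.repr y 1))
          * e.repr z 2
      + (e.repr x 6 * e.repr y 2 - e.repr x 2 * e.repr y 6 + (e.repr x 0 * e.repr y 5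
        - e.repr x 5 * e.repr y 0) + (e.repr x 1 * e.repr y 4 - e.repr x 4 * e.repr y 1))
          * e.repr z 3
      + (e.repr x 5 * e.repr y 6 - e.repr x 6 * e.repr y 5 + (e.repr x 0 * e.repr y 2
        - e.repr x 2 * e.repr y 0) - (e.repr x 1 * e.repr y 3 - e.repr x 3 * e.repr y 1))
          * e.repr z 4
      + (e.repr x 6 * e.repr y 4 - e.repr x 4 * e.repr y 6 - (e.repr x 0 * e.repr y 3
        - e.repr x 3 * e.repr y 0) - (e.repr x 1 * e.repr y 2 - e.repr x 2 * e.repr y 1))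
          * e.repr z 5
      + (e.repr x 4 * e.repr y 5 - e.repr x 5 * e.repr y 4 + (e.repr x 0 * e.repr y 1
        - e.repr x 1 * e.repr y 0) + (e.repr x 2 * e.repr y 3 - e.repr x 3 * e.repr y 2))
          * e.repr z 6 := by
  simp only [phiModel, AlternatingMap.add_apply, AlternatingMap.sub_apply,
    coframe_apply, Matrix.det_fin_three, Matrix.of_apply, Matrix.cons_val]
  ring

/-- The polarised norm identity of the cross product, checked in coordinates. -/
theorem g_cross_cross (x y z : V) : S.g (S.cross x y) (S.cross x z) =
    S.g x x * S.g y z - S.g x y * S.g x z := by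
  have hf : S.IsAdapted S.frame := ⟨S.frame_orthonormal, S.frame_phi⟩
  rw [hf.1.g_eq]
  simp only [g_cross]
  simp only [S.g_eq_sum x, S.g_eq_sum y z, hf.2, phiModel_apply, Fin.sum_univ_seven, Basis.repr_self]
  generalize S.frame.repr x = a
  generalize S.frame.repr y = b
  generalize S.frame.repr z = c
  have h1 (i j : Fin 7) (h : i ≠ j) : (Finsupp.single i (1 : ℝ)) j = 0 :=
    Finsupp.single_eq_of_ne h.symm
  simp only [Finsupp.single_eq_same, ne_eq, h1, Fin.reduceEq, not_false_eq_true, mul_zero,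
    mul_one, add_zero, zero_add]
  ring

/-- The iterated cross product, by polarisation of the norm identity. -/
theorem cross_cross (x y : V) : S.cross x (S.cross x y) = S.g x y • x - S.g x x • y := by
  refine S.ext_g fun z => ?_
  have h := S.g_cross_cross x y z
  rw [g_cross, phi_swap_right, ← g_cross, S.g_symm, h, map_sub S.g, map_smul S.g, map_smul S.g]
  simp only [LinearMap.sub_apply, LinearMap.smul_apply, smul_eq_mul]
  ring

theorem cross_cross_of_orthonormal {x y : V} (hx : S.g x x = 1) (hxy : S.g x y = 0) :
    S.cross x (S.cross x y) = -y := by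
  rw [cross_cross, hx, hxy]
  simp

theorem cross_cross_anticomm {x y z : V} (hxy : S.g x y = 0) (hxz : S.g x z = 0)
    (hyz : S.g y z = 0) : S.cross x (S.cross y z) = -S.cross y (S.cross x z) := by
  have h := S.cross_cross (x + y) z
  have h1 := S.cross_cross x z
  have h2 := S.cross_cross y z
  simp only [cross_add_left, cross_add_right, map_add, LinearMap.add_apply, h1, h2, hxz, hyz,
    hxy, S.g_symm y x, add_zero, zero_add] at h
  rw [eq_neg_iff_add_eq_zero]
  simp only [zero_smul, zero_sub, add_smul] at h
  have : S.cross x (S.cross y z) + S.cross y (S.cross x z) =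
    (-(S.g x x • z) + S.cross y (S.cross x z) + (S.cross x (S.cross y z) + -(S.g y y • z))) +
      (S.g x x • z + S.g y y • z) := by abel
  rw [this, h]
  abel

/-- Seven orthonormal vectors form a basis. -/
theorem exists_basis_of_orthonormal {f : Fin 7 → V}
    (hf : ∀ i j, S.g (f i) (f j) = if i = j then 1 else 0) :
    ∃ e : Basis (Fin 7) ℝ V, ∀ i, e i = f i := by
  have := S.finiteDimensional
  have hli : LinearIndependent ℝ f := by
    rw [Fintype.linearIndependent_iff]
    intro c hc i
    have h := congrArg (fun x => S.g x (f i)) hc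
    simpa [map_sum, hf] using h
  have hcard : Fintype.card (Fin 7) = finrank ℝ V := by
    rw [finrank_eq_card_basis S.frame]
  exact ⟨basisOfLinearIndependentOfCardEqFinrank hli hcard, fun i => by simp⟩

/-- Two orthonormal vectors `u, v` and a unit vector `w` orthogonal to `u`, `v` and `u × v`
generate an adapted basis with `e_5 = u`, `e_6 = v`, `e_7 = u × v` and `e_1 = w`. -/
theorem exists_isAdapted {u v w : V} (hu : S.g u u = 1) (hv : S.g v v = 1) (hw : S.g w w = 1)
    (huv : S.g u v = 0) (huw : S.g u w = 0) (hvw : S.g v w = 0)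
    (hc : S.g (S.cross u v) w = 0) :
    ∃ e : Basis (Fin 7) ℝ V, S.IsAdapted e ∧ e 4 = u ∧ e 5 = v ∧ e 6 = S.cross u v ∧ e 0 = w := by
  set p := S.cross u v with hp
  set q := S.cross u w with hq
  set r := S.cross w v with hr
  set n := S.cross p w with hn
  have hvu : S.g v u = 0 := by rw [S.g_symm, huv]
  have hwu : S.g w u = 0 := by rw [S.g_symm, huw]
  have hwv : S.g w v = 0 := by rw [S.g_symm, hvw]
  have hwp : S.g w p = 0 := by rw [S.g_symm, hc]
  have hup : S.g u p = 0 := by rw [S.g_symm]; exact S.g_cross_left u v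
  have hvp : S.g v p = 0 := by rw [S.g_symm]; exact S.g_cross_right u v
  have hpu : S.g p u = 0 := by rw [S.g_symm, hup]
  have hpv : S.g p v = 0 := by rw [S.g_symm, hvp]
  have hpp : S.g p p = 1 := by rw [hp, g_cross_cross, hu, hv, huv]; norm_num
  have hqq : S.g q q = 1 := by rw [hq, g_cross_cross, hu, hw, huw]; norm_num
  have hrr : S.g r r = 1 := by rw [hr, g_cross_cross, hv, hw, hwv]; norm_num
  have hnn : S.g n n = 1 := by rw [hn, g_cross_cross, hpp, hw, hc]; norm_num
  -- the multiplication table of the seven vectors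
  have c_up : S.cross u p = -v := S.cross_cross_of_orthonormal hu huv
  have c_vp : S.cross v p = u := by
    rw [hp, S.cross_swap v u, cross_neg_right, S.cross_cross_of_orthonormal hv hvu, neg_neg]
  have c_uq : S.cross u q = -w := S.cross_cross_of_orthonormal hu huw
  have c_wq : S.cross w q = u := by
    rw [hq, S.cross_swap w u, cross_neg_right, S.cross_cross_of_orthonormal hw hwu, neg_neg]
  have c_vw : S.cross v w = -r := S.cross_swap w v
  have c_vr : S.cross v r = w := by
    rw [hr, S.cross_swap v w, cross_neg_right, S.cross_cross_of_orthonormal hv hvw, neg_neg]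
  have c_wr : S.cross w r = -v := S.cross_cross_of_orthonormal hw hwv
  have c_pn : S.cross p n = -w := S.cross_cross_of_orthonormal hpp hc
  have c_wn : S.cross w n = p := by
    rw [hn, S.cross_swap w p, cross_neg_right, S.cross_cross_of_orthonormal hw hwp, neg_neg]
  have c_ur : S.cross u r = n := by
    rw [hr, S.cross_cross_anticomm huw huv hwv, ← hp, S.cross_swap p w, neg_neg]
  have e1 (y z : V) (h : S.g y z = 0) : S.g z y = 0 := by rw [S.g_symm, h]
  have hur : S.g u r = 0 := by
    rw [S.g_symm, hr, g_cross, phi_swap_right, phi_swap_left, phi_swap_right, neg_neg,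
      phi_swap_left, ← g_cross, S.cross_swap u v, ← hp]
    simp [hc]
  have c_un : S.cross u n = -r := by rw [← c_ur, S.cross_cross_of_orthonormal hu hur]
  have hqv : S.g q v = 0 := by
    rw [hq, g_cross, phi_swap_right, ← g_cross, ← hp, hc, neg_zero]
  have hpq : S.g p q = 0 := by rw [hp, hq, g_cross_cross, hvw, huv]; ring
  have c_vq : S.cross v q = n := by
    rw [hq, S.cross_cross_anticomm hvu hvw huw, c_vw, cross_neg_right, c_ur, neg_neg]
  have c_vn : S.cross v n = -q := by
    rw [← c_vq, S.cross_cross_of_orthonormal hv (e1 _ _ hqv)]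
  have c_pq : S.cross p q = r := by
    rw [hq, S.cross_cross_anticomm hpu hc huw, ← hn, c_un, neg_neg]
  have c_qr : S.cross q r = p := by
    rw [← c_pq, S.cross_swap q p, cross_neg_right,
      S.cross_cross_of_orthonormal hqq (e1 _ _ hpq), neg_neg]
  have c_qn : S.cross q n = v := by
    rw [← c_vq, S.cross_swap q v, cross_neg_right, S.cross_cross_of_orthonormal hqq hqv, neg_neg]
  have c_rn : S.cross r n = u := by
    rw [← c_ur, S.cross_swap r u, cross_neg_right,
      S.cross_cross_of_orthonormal hrr (e1 _ _ hur), neg_neg]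
  have sw {x y z : V} (h : S.cross x y = z) : S.cross y x = -z := by rw [cross_swap, h]
  let f : Fin 7 → V := ![w, n, q, r, u, v, p]
  have hnw : S.g n w = 0 := S.g_cross_right p w
  have hnp : S.g n p = 0 := S.g_cross_left p w
  have hqw : S.g q w = 0 := S.g_cross_right u w
  have hqu : S.g q u = 0 := S.g_cross_left u w
  have hrw : S.g r w = 0 := S.g_cross_left w v
  have hrv : S.g r v = 0 := S.g_cross_right w v
  have hqn : S.g q n = 0 := by rw [S.g_symm, ← c_vq, g_cross_right]
  have hrn : S.g r n = 0 := by rw [S.g_symm, ← c_ur, g_cross_right]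
  have hun : S.g u n = 0 := by rw [S.g_symm, ← c_ur, g_cross_left]
  have hvn : S.g v n = 0 := by rw [S.g_symm, ← c_vq, g_cross_left]
  have hrq : S.g r q = 0 := by rw [← c_pq, g_cross_right]
  have hrp : S.g r p = 0 := by rw [← c_pq, g_cross_left]
  have hf : ∀ i j, S.g (f i) (f j) = if i = j then 1 else 0 := by
    intro i j
    fin_cases i <;> fin_cases j <;>
      simp [f, hu, hv, hw, hpp, hqq, hrr, hnn, huv, hvu, huw, hwu, hvw, hwv, hwp, hup, hvp, hpu,
        hpv, hc, hur, e1 _ _ hur, hqv, e1 _ _ hqv, hpq, e1 _ _ hpq, hnw, e1 _ _ hnw, hnp,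
        e1 _ _ hnp, hqw, e1 _ _ hqw, hqu, e1 _ _ hqu, hrw, e1 _ _ hrw, hrv, e1 _ _ hrv, hqn,
        e1 _ _ hqn, hrn, e1 _ _ hrn, hun, e1 _ _ hun, hvn, e1 _ _ hvn, hrq, e1 _ _ hrq, hrp,
        e1 _ _ hrp]
  obtain ⟨e, hef⟩ := S.exists_basis_of_orthonormal hf
  have heo : S.IsOrthonormal e := by
    intro i j
    rw [hef, hef, hf]
  refine ⟨e, ⟨heo, ?_⟩, hef 4, hef 5, hef 6, hef 0⟩
  refine form_ext e fun K hK => ?_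
  have h01 : K 0 < K 1 := hK (by decide)
  have h12 : K 1 < K 2 := hK (by decide)
  have hK3 : (fun a => e (K a)) = ![e (K 0), e (K 1), e (K 2)] := by
    ext a
    fin_cases a <;> rfl
  have h1 (i j : Fin 7) (h : i ≠ j) : (Finsupp.single i (1 : ℝ)) j = 0 :=
    Finsupp.single_eq_of_ne h.symm
  have c01 : S.cross (f 0) (f 1) = f 6 := c_wn
  have c02 : S.cross (f 0) (f 2) = f 4 := c_wq
  have c03 : S.cross (f 0) (f 3) = -f 5 := c_wr
  have c04 : S.cross (f 0) (f 4) = -f 2 := sw hq.symm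
  have c05 : S.cross (f 0) (f 5) = f 3 := hr.symm
  have c12 : S.cross (f 1) (f 2) = -f 5 := sw c_qn
  have c13 : S.cross (f 1) (f 3) = -f 4 := sw c_rn
  have c14 : S.cross (f 1) (f 4) = f 3 := (sw c_un).trans (neg_neg r)
  have c15 : S.cross (f 1) (f 5) = f 2 := (sw c_vn).trans (neg_neg q)
  have c23 : S.cross (f 2) (f 3) = f 6 := c_qr
  have c24 : S.cross (f 2) (f 4) = f 0 := (sw c_uq).trans (neg_neg w)
  have c25 : S.cross (f 2) (f 5) = -f 1 := sw c_vq
  have c34 : S.cross (f 3) (f 4) = -f 1 := sw c_ur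
  have c35 : S.cross (f 3) (f 5) = -f 0 := sw c_vr
  have c45 : S.cross (f 4) (f 5) = f 6 := hp.symm
  have table : ∀ i j k : Fin 7, i < j → j < k →
      S.g (S.cross (f i) (f j)) (f k) = phiModel e ![e i, e j, e k] := by
    intro i j k hij hjk
    rw [phiModel_apply]
    simp only [Basis.repr_self]
    clear_value f
    fin_cases i <;> fin_cases j <;> first
      | exact absurd hij (by decide)
      | (fin_cases k <;> first
          | exact absurd hjk (by decide)
          | simp [c01, c02, c03, c04, c05, c12, c13, c14, c15, c23, c24, c25, c34, c35, c45,
              hf])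
  rw [hK3, ← table _ _ _ h01 h12, g_cross, hef, hef, hef]

end G2Structure

/-! ### Differential, torsion and curvature in an orthonormal basis -/

section Differential

variable {L : Type*} [LieRing L] [LieAlgebra ℝ L]

theorem ceDiff_apply_four (ω : Form L 3) (a b c d : L) :
    ceDiff ω ![a, b, c, d] = -ω ![⁅a, b⁆, c, d] + ω ![⁅a, c⁆, b, d] - ω ![⁅a, d⁆, b, c]
      - ω ![⁅b, c⁆, a, d] + ω ![⁅b, d⁆, a, c] - ω ![⁅c, d⁆, a, b] := by
  have hn : ∀ p q u v : L, ω ![⁅q, p⁆, u, v] = -ω ![⁅p, q⁆, u, v] := by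
    intro p q u v
    rw [← lie_skew]
    have := (ω.curryLeft).map_neg ⁅p, q⁆
    simpa using congrArg (fun f => f ![u, v]) this
  have key : ∀ f : (Fin 3 → L) → ℝ, (∀ p q u v : L, f ![⁅q, p⁆, u, v] = -f ![⁅p, q⁆, u, v]) →
      -(1 / 2) * ∑ i : Fin 4, ∑ j : Fin 3, (-1 : ℝ) ^ ((i : ℕ) + (j : ℕ)) *
        f (Matrix.vecCons ⁅![a, b, c, d] i, i.removeNth ![a, b, c, d] j⁆
          (j.removeNth (i.removeNth ![a, b, c, d]))) =
      -f ![⁅a, b⁆, c, d] + f ![⁅a, c⁆, b, d] - f ![⁅a, d⁆, b, c]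
        - f ![⁅b, c⁆, a, d] + f ![⁅b, d⁆, a, c] - f ![⁅c, d⁆, a, b] := by
    intro f hf
    let M : Fin 4 → Fin 3 → Fin 3 → L := ![
        ![![⁅a, b⁆, c, d], ![⁅a, c⁆, b, d], ![⁅a, d⁆, b, c]],
        ![![⁅b, a⁆, c, d], ![⁅b, c⁆, a, d], ![⁅b, d⁆, a, c]],
        ![![⁅c, a⁆, b, d], ![⁅c, b⁆, a, d], ![⁅c, d⁆, a, b]],
        ![![⁅d, a⁆, b, c], ![⁅d, b⁆, a, c], ![⁅d, c⁆, a, b]]]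
    have hM : ∀ i j, Matrix.vecCons ⁅![a, b, c, d] i, i.removeNth ![a, b, c, d] j⁆
        (j.removeNth (i.removeNth ![a, b, c, d])) = M i j := by
      intro i j
      fin_cases i <;> fin_cases j <;> (ext x; fin_cases x <;> rfl)
    simp only [hM]
    simp only [M, Fin.sum_univ_four, Fin.sum_univ_three, Matrix.cons_val]
    rw [hf a b, hf a c, hf a d, hf b c, hf b d, hf c d]
    norm_num
    ring
  exact (ceDiff_apply ω _).trans (key ω hn)

theorem ceDiff_apply_five (ω : Form L 4) (a b c d e : L) :
    ceDiff ω ![a, b, c, d, e] = -ω ![⁅a, b⁆, c, d, e] + ω ![⁅a, c⁆, b, d, e]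
      - ω ![⁅a, d⁆, b, c, e] + ω ![⁅a, e⁆, b, c, d] - ω ![⁅b, c⁆, a, d, e]
      + ω ![⁅b, d⁆, a, c, e] - ω ![⁅b, e⁆, a, c, d] - ω ![⁅c, d⁆, a, b, e]
      + ω ![⁅c, e⁆, a, b, d] - ω ![⁅d, e⁆, a, b, c] := by
  have hn : ∀ p q u v w : L, ω ![⁅q, p⁆, u, v, w] = -ω ![⁅p, q⁆, u, v, w] := by
    intro p q u v w
    rw [← lie_skew]
    have := (ω.curryLeft).map_neg ⁅p, q⁆
    simpa using congrArg (fun f => f ![u, v, w]) this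
  have key : ∀ f : (Fin 4 → L) → ℝ,
      (∀ p q u v w : L, f ![⁅q, p⁆, u, v, w] = -f ![⁅p, q⁆, u, v, w]) →
      -(1 / 2) * ∑ i : Fin 5, ∑ j : Fin 4, (-1 : ℝ) ^ ((i : ℕ) + (j : ℕ)) *
        f (Matrix.vecCons ⁅![a, b, c, d, e] i, i.removeNth ![a, b, c, d, e] j⁆
          (j.removeNth (i.removeNth ![a, b, c, d, e]))) =
      -f ![⁅a, b⁆, c, d, e] + f ![⁅a, c⁆, b, d, e]
        - f ![⁅a, d⁆, b, c, e] + f ![⁅a, e⁆, b, c, d] - f ![⁅b, c⁆, a, d, e]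
        + f ![⁅b, d⁆, a, c, e] - f ![⁅b, e⁆, a, c, d] - f ![⁅c, d⁆, a, b, e]
        + f ![⁅c, e⁆, a, b, d] - f ![⁅d, e⁆, a, b, c] := by
    intro f hf
    let M : Fin 5 → Fin 4 → Fin 4 → L := ![
        ![![⁅a, b⁆, c, d, e], ![⁅a, c⁆, b, d, e], ![⁅a, d⁆, b, c, e], ![⁅a, e⁆, b, c, d]],
        ![![⁅b, a⁆, c, d, e], ![⁅b, c⁆, a, d, e], ![⁅b, d⁆, a, c, e], ![⁅b, e⁆, a, c, d]],
        ![![⁅c, a⁆, b, d, e], ![⁅c, b⁆, a, d, e], ![⁅c, d⁆, a, b, e], ![⁅c, e⁆, a, b, d]],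
        ![![⁅d, a⁆, b, c, e], ![⁅d, b⁆, a, c, e], ![⁅d, c⁆, a, b, e], ![⁅d, e⁆, a, b, c]],
        ![![⁅e, a⁆, b, c, d], ![⁅e, b⁆, a, c, d], ![⁅e, c⁆, a, b, d], ![⁅e, d⁆, a, b, c]]]
    have hM : ∀ i j, Matrix.vecCons ⁅![a, b, c, d, e] i, i.removeNth ![a, b, c, d, e] j⁆
        (j.removeNth (i.removeNth ![a, b, c, d, e])) = M i j := by
      intro i j
      fin_cases i <;> fin_cases j <;> (ext x; fin_cases x <;> rfl)
    simp only [hM]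
    simp only [M, Fin.sum_univ_five, Fin.sum_univ_four, Matrix.cons_val]
    rw [hf a b, hf a c, hf a d, hf b c, hf b d, hf c d, hf a e, hf b e, hf c e, hf d e]
    norm_num
    ring
  exact (ceDiff_apply ω _).trans (key ω hn)

end Differential

namespace G2Structure

variable {L : Type*} [LieRing L] [LieAlgebra ℝ L] {S : G2Structure L}

theorem IsOriented.star_seven {e : Basis (Fin 7) ℝ L} (he : S.IsOriented e) (h : 7 + 0 = 7)
    (ω : Form L 7) : S.star 7 0 h ω ![] = ω (fun a => e a) := by
  have hs : tupleSign (fun a : Fin 7 =>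
      Fin.append (id : Fin 7 → Fin 7) ![] (Fin.cast h.symm a)) = 1 := by
    clear ω
    revert h
    set_option maxRecDepth 4000 in decide
  have h0 : (![] : Fin 0 → L) = fun a => e ((![] : Fin 0 → Fin 7) a) := Subsingleton.elim _ _
  rw [h0]
  exact he.star_apply h ω id ![] hs

theorem IsOriented.star_apply_of_eq {e : Basis (Fin 7) ℝ L} (he : S.IsOriented e) {k m : ℕ}
    (h : k + m = 7) (ω : Form L k) (I : Fin k → Fin 7) (J : Fin m → Fin 7)
    (hs : tupleSign (fun x : Fin 7 => Fin.append I J (Fin.cast h.symm x)) = 1)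
    (u : Fin m → L) (w : Fin k → L) (hu : ∀ x, e (J x) = u x) (hw : ∀ x, e (I x) = w x) :
    S.star k m h ω u = ω w := by
  obtain rfl : (fun x => e (J x)) = u := funext hu
  obtain rfl : (fun x => e (I x)) = w := funext hw
  exact he.star_apply h ω I J hs

theorem IsOriented.star_four {e : Basis (Fin 7) ℝ L} (he : S.IsOriented e) (h : 4 + 3 = 7)
    (ω : Form L 4) (a b c d i j k : Fin 7) (hs : tupleSign ![a, b, c, d, i, j, k] = 1) :
    S.star 4 3 h ω ![e i, e j, e k] = ω ![e a, e b, e c, e d] := by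
  have hs' : tupleSign (fun x : Fin 7 =>
      Fin.append ![a, b, c, d] ![i, j, k] (Fin.cast h.symm x)) = 1 := by
    rw [← hs]
    congr 1
    ext x
    fin_cases x <;> rfl
  refine he.star_apply_of_eq h ω _ _ hs' _ _ (fun x => ?_) (fun x => ?_)
  · fin_cases x <;> rfl
  · fin_cases x <;> rfl

theorem IsOriented.star_three {e : Basis (Fin 7) ℝ L} (he : S.IsOriented e) (h : 3 + 4 = 7)
    (ω : Form L 3) (a b c i j k l : Fin 7) (hs : tupleSign ![a, b, c, i, j, k, l] = 1) :
    S.star 3 4 h ω ![e i, e j, e k, e l] = ω ![e a, e b, e c] := by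
  have hs' : tupleSign (fun x : Fin 7 =>
      Fin.append ![a, b, c] ![i, j, k, l] (Fin.cast h.symm x)) = 1 := by
    rw [← hs]
    congr 1
    ext x
    fin_cases x <;> rfl
  refine he.star_apply_of_eq h ω _ _ hs' _ _ (fun x => ?_) (fun x => ?_)
  · fin_cases x <;> rfl
  · fin_cases x <;> rfl

/-- The torsion on three basis vectors, from the values of `φ` there and of `dφ` on the
complementary basis vectors. -/
theorem IsOriented.torsion_apply {e : Basis (Fin 7) ℝ L} (he : S.IsOriented e)
    (a b c d i j k : Fin 7) (h : tupleSign ![a, b, c, d, i, j, k] = 1) :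
    S.torsion ![e i, e j, e k] =
      1 / 6 * wedge (ceDiff S.φ) S.φ (fun x : Fin (4 + 3) => e x) * S.φ ![e i, e j, e k]
        - ceDiff S.φ ![e a, e b, e c, e d] := by
  rw [torsion, AlternatingMap.sub_apply, AlternatingMap.smul_apply, he.star_seven,
    he.star_four _ _ a b c d i j k h, smul_eq_mul]

/-- The component `g(∇^λ_x y, z)` of the connection. -/
noncomputable def conn (S : G2Structure L) (lam : ℝ) (x y z : L) : ℝ :=
  S.g (S.connection lam x y) z

theorem conn_eq (S : G2Structure L) (lam : ℝ) (x y z : L) : S.conn lam x y z =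
    (1 / 2) * (S.g ⁅x, y⁆ z + S.g ⁅z, x⁆ y + S.g ⁅z, y⁆ x) + lam / 2 * S.torsion ![x, y, z] :=
  S.g_connection lam x y z

/-- The connection is metric. -/
theorem conn_skew (S : G2Structure L) (lam : ℝ) (x y z : L) :
    S.conn lam x z y = -S.conn lam x y z := by
  have ht : S.torsion ![x, z, y] = -S.torsion ![x, y, z] := by
    exact form_swap_right _ _ _ _
  rw [conn_eq, conn_eq, ht, ← lie_skew z x, ← lie_skew y x, ← lie_skew z y]
  simp only [map_neg, LinearMap.neg_apply]
  ring

theorem IsOrthonormal.curvatureForm_apply {e : Basis (Fin 7) ℝ L} (he : S.IsOrthonormal e)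
    (lam : ℝ) (x y w z : L) : S.curvatureForm lam w z ![x, y] =
      ∑ m, (S.conn lam x w (e m) * S.conn lam y z (e m)
        - S.conn lam y w (e m) * S.conn lam x z (e m)) - S.conn lam ⁅x, y⁆ w z := by
  have key : ∀ p q, S.g (S.connection lam p (S.connection lam q w)) z =
      -∑ m, S.conn lam p z (e m) * S.conn lam q w (e m) := by
    intro p q
    have h := S.conn_skew lam p z (S.connection lam q w)
    rw [conn] at h
    rw [h, conn, he.g_eq]
    rfl
  change S.g (S.curvature lam x y w) z = _
  simp only [curvature, LinearMap.sub_apply, Module.End.mul_apply, map_sub, key,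
    Finset.sum_sub_distrib]
  rw [conn]
  simp only [mul_comm]
  ring

theorem conn_sum_left (S : G2Structure L) (lam : ℝ) {ι : Type*} (s : Finset ι) (c : ι → ℝ)
    (v : ι → L) (w z : L) :
    S.conn lam (∑ k ∈ s, c k • v k) w z = ∑ k ∈ s, c k * S.conn lam (v k) w z := by
  simp [conn, map_sum, LinearMap.sum_apply]

end G2Structure

/-! ### Self-dual and anti-self-dual matrices, and adapted bases with central `e_5, e_6, e_7` -/

/-- The coefficients `σ_k(e_a, e_b)` of the self-dual forms `σ_k⁺`, with indices from zero. -/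
def sigmaMat : Fin 3 → Fin 4 → Fin 4 → ℝ :=
  ![![![0, 0, 1, 0], ![0, 0, 0, -1], ![-1, 0, 0, 0], ![0, 1, 0, 0]],
    ![![0, 0, 0, -1], ![0, 0, -1, 0], ![0, 1, 0, 0], ![1, 0, 0, 0]],
    ![![0, 1, 0, 0], ![-1, 0, 0, 0], ![0, 0, 0, 1], ![0, 0, -1, 0]]]

/-- The coefficients of the anti-self-dual forms `e^{13} + e^{24}`, `-e^{14} + e^{23}`,
`e^{12} - e^{34}`. -/
def tauMat : Fin 3 → Fin 4 → Fin 4 → ℝ :=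
  ![![![0, 0, 1, 0], ![0, 0, 0, 1], ![-1, 0, 0, 0], ![0, -1, 0, 0]],
    ![![0, 0, 0, -1], ![0, 0, 1, 0], ![0, -1, 0, 0], ![1, 0, 0, 0]],
    ![![0, 1, 0, 0], ![-1, 0, 0, 0], ![0, 0, 0, -1], ![0, 0, 1, 0]]]

/-- The Levi-Civita symbol on three indices. -/
def eps : Fin 3 → Fin 3 → Fin 3 → ℝ :=
  ![![![0, 0, 0], ![0, 0, 1], ![0, -1, 0]],
    ![![0, 0, -1], ![0, 0, 0], ![1, 0, 0]],
    ![![0, 1, 0], ![-1, 0, 0], ![0, 0, 0]]]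

/-- The two-form on `ℝ⁴` with self-dual coefficients `s` and anti-self-dual coefficients `a`. -/
def pairMat (s a : Fin 3 → ℝ) (p q : Fin 4) : ℝ :=
  ∑ j, (s j * sigmaMat j p q + a j * tauMat j p q)

/-- Every skew matrix of size four is the sum of its self-dual and anti-self-dual parts. -/
theorem eq_pairMat_of_skew {X : Fin 4 → Fin 4 → ℝ} (hX : ∀ p q, X q p = -X p q) :
    X = pairMat ![(X 0 2 - X 1 3) / 2, (-X 0 3 - X 1 2) / 2, (X 0 1 + X 2 3) / 2]
      ![(X 0 2 + X 1 3) / 2, (-X 0 3 + X 1 2) / 2, (X 0 1 - X 2 3) / 2] := by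
  have hd : ∀ p, X p p = 0 := fun p => by linarith [hX p p]
  ext p q
  fin_cases p <;> fin_cases q <;>
    simp [pairMat, sigmaMat, tauMat, Fin.sum_univ_three, hd, hX 0 1, hX 0 2, hX 0 3, hX 1 2,
      hX 1 3, hX 2 3] <;> ring

namespace G2Structure

section Blocks

variable {V : Type*} [AddCommGroup V] [Module ℝ V] {S : G2Structure V}

/-- The first four vectors of a basis. -/
noncomputable def hor (e : Basis (Fin 7) ℝ V) (a : Fin 4) : V := e (![0, 1, 2, 3] a)

/-- The last three vectors of a basis. -/
noncomputable def ver (e : Basis (Fin 7) ℝ V) (k : Fin 3) : V := e (![4, 5, 6] k)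

theorem sum_hor_add_sum_ver (e : Basis (Fin 7) ℝ V) (f : V → ℝ) :
    ∑ m, f (e m) = ∑ a, f (hor e a) + ∑ k, f (ver e k) := by
  simp only [Fin.sum_univ_seven, Fin.sum_univ_four, Fin.sum_univ_three, hor, ver, Matrix.cons_val]
  ring

theorem IsAdapted.phi_ver_hor_hor {e : Basis (Fin 7) ℝ V} (he : S.IsAdapted e) (k : Fin 3)
    (a b : Fin 4) : S.φ ![ver e k, hor e a, hor e b] = sigmaMat k a b := by
  rw [he.2, phiModel_apply]
  simp only [hor, ver, Basis.repr_self]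
  fin_cases k <;> fin_cases a <;> fin_cases b <;>
    simp [sigmaMat]

theorem IsAdapted.phi_ver_ver_ver {e : Basis (Fin 7) ℝ V} (he : S.IsAdapted e) (i j k : Fin 3) :
    S.φ ![ver e i, ver e j, ver e k] = eps i j k := by
  rw [he.2, phiModel_apply]
  simp only [ver, Basis.repr_self]
  fin_cases i <;> fin_cases j <;> fin_cases k <;>
    simp [eps]

theorem IsAdapted.phi_ver_ver_hor {e : Basis (Fin 7) ℝ V} (he : S.IsAdapted e) (i j : Fin 3)
    (a : Fin 4) : S.φ ![ver e i, ver e j, hor e a] = 0 := by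
  rw [he.2, phiModel_apply]
  simp only [hor, ver, Basis.repr_self]
  fin_cases i <;> fin_cases j <;> fin_cases a <;>
    simp

theorem IsAdapted.phi_hor_hor_hor {e : Basis (Fin 7) ℝ V} (he : S.IsAdapted e) (a b c : Fin 4) :
    S.φ ![hor e a, hor e b, hor e c] = 0 := by
  rw [he.2, phiModel_apply]
  simp only [hor, Basis.repr_self]
  fin_cases a <;> fin_cases b <;> fin_cases c <;>
    simp

/-- A linear combination in the first slot of a three-form. -/
theorem form_sum_left {ι : Type*} (ω : Form V 3) (s : Finset ι) (c : ι → ℝ) (v : ι → V) (y z : V) :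
    ω ![∑ k ∈ s, c k • v k, y, z] = ∑ k ∈ s, c k * ω ![v k, y, z] := by
  have h : ∀ x, ω ![x, y, z] = ω.curryLeft x ![y, z] := fun x => rfl
  simp only [h, map_sum, map_smul]
  rw [form_sum_apply]
  rfl

theorem form_zero_left (ω : Form V 3) (y z : V) : ω ![0, y, z] = 0 :=
  ω.map_coord_zero 0 rfl

end Blocks

variable {L : Type*} [LieRing L] [LieAlgebra ℝ L] {S : G2Structure L}

/-- An adapted basis whose last three vectors are central and span a space that contains all
brackets: `[e_a, e_b] = -∑_k X_k(e_a, e_b) e_{k+4}`, where `X_k = de^{k+4}` has self-dual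
coefficients `s k` and anti-self-dual coefficients `a k`. -/
structure IsCentralFrame (S : G2Structure L) (e : Basis (Fin 7) ℝ L) (s a : Fin 3 → Fin 3 → ℝ) :
    Prop where
  adapted : S.IsAdapted e
  lie_ver : ∀ (k : Fin 3) (v : L), ⁅ver e k, v⁆ = 0
  lie_hor : ∀ p q : Fin 4, ⁅hor e p, hor e q⁆ = ∑ k, (-pairMat (s k) (a k) p q) • ver e k

namespace IsCentralFrame

variable {e : Basis (Fin 7) ℝ L} {s a : Fin 3 → Fin 3 → ℝ}

theorem lie_ver_right (h : S.IsCentralFrame e s a) (k : Fin 3) (v : L) : ⁅v, ver e k⁆ = 0 := by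
  rw [← lie_skew, h.lie_ver, neg_zero]

theorem dphi_hor_hor_ver_ver (h : S.IsCentralFrame e s a) (p q : Fin 4) (i j : Fin 3) :
    ceDiff S.φ ![hor e p, hor e q, ver e i, ver e j] =
      ∑ k, pairMat (s k) (a k) p q * eps k i j := by
  rw [ceDiff_apply_four, h.lie_hor]
  simp only [h.lie_ver, h.lie_ver_right, form_zero_left, form_sum_left, h.adapted.phi_ver_ver_ver]
  simp [Finset.sum_neg_distrib]

theorem dphi_hor_ver_ver_ver (h : S.IsCentralFrame e s a) (p : Fin 4) (i j k : Fin 3) :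
    ceDiff S.φ ![hor e p, ver e i, ver e j, ver e k] = 0 := by
  rw [ceDiff_apply_four]
  simp [h.lie_ver, h.lie_ver_right, form_zero_left]

theorem dphi_hor_hor_hor_ver (h : S.IsCentralFrame e s a) (p q r : Fin 4) (k : Fin 3) :
    ceDiff S.φ ![hor e p, hor e q, hor e r, ver e k] = 0 := by
  have hz : ∀ (i j : Fin 3) (b : Fin 4), S.φ ![ver e i, hor e b, ver e j] = 0 := by
    intro i j b
    rw [phi_swap_right, h.adapted.phi_ver_ver_hor, neg_zero]
  rw [ceDiff_apply_four]
  simp only [h.lie_hor, h.lie_ver_right, form_zero_left, form_sum_left, hz]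
  simp

theorem dphi_hor (h : S.IsCentralFrame e s a) :
    ceDiff S.φ ![hor e 0, hor e 1, hor e 2, hor e 3] = 2 * (s 0 0 + s 1 1 + s 2 2) := by
  rw [ceDiff_apply_four]
  simp only [h.lie_hor, form_sum_left, h.adapted.phi_ver_hor_hor]
  simp [pairMat, Fin.sum_univ_three, sigmaMat, tauMat]
  ring

end IsCentralFrame

end G2Structure

/-! ### The torsion of a central frame -/

namespace Ext

variable {V : Type*} [AddCommGroup V] [Module ℝ V]

theorem wedge_coframe_apply_of_eq {n k l : ℕ} (e : Basis (Fin n) ℝ V) (β : Form V k)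
    (I : Fin k → Fin n) (J : Fin l → Fin n) {L : Fin (k + l) → Fin n} (hL : StrictMono L)
    (hIJ : Function.Injective (Fin.append I J)) (hr : ∀ i, ∃ j, L j = Fin.append I J i)
    (u : Fin (k + l) → V) (w : Fin k → V) (hu : ∀ x, e (L x) = u x) (hw : ∀ x, e (I x) = w x) :
    wedge β (coframe e J) u = tupleSign (Fin.append I J) * β w := by
  obtain rfl : (fun x => e (L x)) = u := funext hu
  obtain rfl : (fun x => e (I x)) = w := funext hw
  exact wedge_coframe_apply_of_mem e β I J hL hIJ hr

/-- The coefficient of `β ∧ e^{ijk}` is that of `β` on the four complementary basis vectors. -/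
theorem wedge_coframe_top (e : Basis (Fin 7) ℝ V) (β : Form V 4) (a b c d i j k : Fin 7)
    (h : tupleSign ![a, b, c, d, i, j, k] = 1) :
    wedge β (coframe e ![i, j, k]) (fun x : Fin (4 + 3) => e x) = β ![e a, e b, e c, e d] := by
  have ha : Fin.append ![a, b, c, d] ![i, j, k] = ![a, b, c, d, i, j, k] := by
    ext x
    fin_cases x <;> rfl
  have hi : Function.Injective (Fin.append ![a, b, c, d] ![i, j, k]) := by
    rw [ha]
    exact injective_of_tupleSign_ne_zero (by rw [h]; decide)
  have h2 := wedge_coframe_apply_of_eq e β ![a, b, c, d] ![i, j, k] (L := fun x => x)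
    strictMono_id hi (fun x => ⟨_, rfl⟩) (fun x : Fin (4 + 3) => e x) ![e a, e b, e c, e d]
    (fun x => rfl) (fun x => by fin_cases x <;> rfl)
  rwa [ha, h, Int.cast_one, one_mul] at h2

/-- An alternating form that vanishes on increasing triples of a family vanishes on all. -/
theorem form_three_eq_zero {n : ℕ} (ω : Form V 3) (f : Fin n → V)
    (h : ∀ a b c, a < b → b < c → ω ![f a, f b, f c] = 0) (a b c : Fin n) :
    ω ![f a, f b, f c] = 0 := by
  have h1 := form_swap_left ω
  have h2 := form_swap_right ω
  have e1 : ∀ x z : V, ω ![x, x, z] = 0 := fun x z => by linarith [h1 x x z]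
  have e2 : ∀ x z : V, ω ![z, x, x] = 0 := fun x z => by linarith [h2 z x x]
  have e3 : ∀ x z : V, ω ![x, z, x] = 0 := fun x z => by linarith [h2 x z x, e1 x z]
  rcases lt_trichotomy a b with hab | rfl | hab
  · rcases lt_trichotomy b c with hbc | rfl | hbc
    · exact h a b c hab hbc
    · exact e2 _ _
    · rcases lt_trichotomy a c with hac | rfl | hac
      · linarith [h a c b hac hbc, h2 (f a) (f c) (f b)]
      · exact e3 _ _
      · linarith [h c a b hac hab, h2 (f a) (f c) (f b), h1 (f c) (f a) (f b)]
  · exact e1 _ _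
  · rcases lt_trichotomy a c with hac | rfl | hac
    · linarith [h b a c hab hac, h1 (f b) (f a) (f c)]
    · exact e3 _ _
    · rcases lt_trichotomy b c with hbc | rfl | hbc
      · linarith [h b c a hbc hac, h1 (f b) (f a) (f c), h2 (f b) (f c) (f a)]
      · exact e2 _ _
      · linarith [h c b a hbc hab, h1 (f b) (f a) (f c), h2 (f b) (f c) (f a),
          h1 (f c) (f b) (f a)]

end Ext

namespace G2Structure

variable {L : Type*} [LieRing L] [LieAlgebra ℝ L] {S : G2Structure L}

namespace IsCentralFrame

variable {e : Basis (Fin 7) ℝ L} {s a : Fin 3 → Fin 3 → ℝ}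

theorem dphi_wedge_phi (h : S.IsCentralFrame e s a) :
    wedge (ceDiff S.φ) S.φ (fun x : Fin (4 + 3) => e x) = 4 * (s 0 0 + s 1 1 + s 2 2) := by
  have hw : wedge (ceDiff S.φ) S.φ = wedge (ceDiff S.φ) (phiModel e) := by rw [← h.adapted.2]
  have h0 := h.dphi_hor
  have h1 := h.dphi_hor_hor_ver_ver 2 3 0 1
  have h2 := h.dphi_hor_hor_ver_ver 0 1 0 1
  have h3 := h.dphi_hor_hor_ver_ver 3 1 1 2
  have h4 := h.dphi_hor_hor_ver_ver 2 1 0 2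
  have h5 := h.dphi_hor_hor_ver_ver 3 0 0 2
  have h6 := h.dphi_hor_hor_ver_ver 2 0 1 2
  simp only [hor, ver, Matrix.cons_val] at h0 h1 h2 h3 h4 h5 h6
  rw [hw, phiModel]
  simp only [wedge_add_right, wedge_sub_right, AlternatingMap.add_apply, AlternatingMap.sub_apply]
  rw [wedge_coframe_top e _ 2 3 4 5 0 1 6 (by decide),
    wedge_coframe_top e _ 0 1 4 5 2 3 6 (by decide),
    wedge_coframe_top e _ 0 1 2 3 4 5 6 (by decide),
    wedge_coframe_top e _ 3 1 5 6 0 2 4 (by decide),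
    wedge_coframe_top e _ 2 1 4 6 0 3 5 (by decide),
    wedge_coframe_top e _ 3 0 4 6 1 2 5 (by decide),
    wedge_coframe_top e _ 2 0 5 6 1 3 4 (by decide), h0, h1, h2, h3, h4, h5, h6]
  simp [pairMat, Fin.sum_univ_three, sigmaMat, tauMat, eps]
  ring

theorem torsion_apply (h : S.IsCentralFrame e s a) (p q r t i j k : Fin 7)
    (hs : tupleSign ![p, q, r, t, i, j, k] = 1) :
    S.torsion ![e i, e j, e k] = 2 / 3 * (s 0 0 + s 1 1 + s 2 2) * S.φ ![e i, e j, e k]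
      - ceDiff S.φ ![e p, e q, e r, e t] := by
  rw [h.adapted.isOriented.torsion_apply p q r t i j k hs, h.dphi_wedge_phi]
  ring

theorem torsion_ver (h : S.IsCentralFrame e s a) (i j k : Fin 3) :
    S.torsion ![ver e i, ver e j, ver e k] = -4 / 3 * (s 0 0 + s 1 1 + s 2 2) * eps i j k := by
  have key := form_three_eq_zero (S.torsion + (4 / 3 * (s 0 0 + s 1 1 + s 2 2)) • S.φ) (ver e) ?_
    i j k
  · simp only [AlternatingMap.add_apply, AlternatingMap.smul_apply, h.adapted.phi_ver_ver_ver,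
      smul_eq_mul] at key
    linarith
  · intro i j k hij hjk
    obtain ⟨rfl, rfl, rfl⟩ : i = 0 ∧ j = 1 ∧ k = 2 := by lia
    have h1 := h.torsion_apply 0 1 2 3 4 5 6 (by decide)
    have h2 := h.adapted.phi_ver_ver_ver 0 1 2
    have h3 := h.dphi_hor
    simp only [hor, ver, Matrix.cons_val] at h1 h2 h3 ⊢
    simp only [AlternatingMap.add_apply, AlternatingMap.smul_apply, smul_eq_mul, h1, h2, h3]
    simp [eps]
    ring

theorem torsion_hor (h : S.IsCentralFrame e s a) (p q r : Fin 4) :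
    S.torsion ![hor e p, hor e q, hor e r] = 0 := by
  refine form_three_eq_zero S.torsion (hor e) (fun p q r hpq hqr => ?_) p q r
  have key : ∀ t : Fin 4, ∀ i j : Fin 3, tupleSign ![(![0, 1, 2, 3] : Fin 4 → Fin 7) t,
      (![4, 5, 6] : Fin 3 → Fin 7) i, (![4, 5, 6] : Fin 3 → Fin 7) j, 6,
      (![0, 1, 2, 3] : Fin 4 → Fin 7) p, (![0, 1, 2, 3] : Fin 4 → Fin 7) q,
      (![0, 1, 2, 3] : Fin 4 → Fin 7) r] = 1 → S.torsion ![hor e p, hor e q, hor e r] = 0 := by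
    intro t i j hs
    have h1 := h.torsion_apply _ _ _ _ _ _ _ hs
    have h2 := h.adapted.phi_hor_hor_hor p q r
    have h3 := h.dphi_hor_ver_ver_ver t i j 2
    simp only [hor, ver, Matrix.cons_val] at h1 h2 h3 ⊢
    rw [h1, h2, h3]
    ring
  have hc : (p = 0 ∧ q = 1 ∧ r = 2) ∨ (p = 0 ∧ q = 1 ∧ r = 3) ∨ (p = 0 ∧ q = 2 ∧ r = 3) ∨
      (p = 1 ∧ q = 2 ∧ r = 3) := by lia
  rcases hc with ⟨rfl, rfl, rfl⟩ | ⟨rfl, rfl, rfl⟩ | ⟨rfl, rfl, rfl⟩ | ⟨rfl, rfl, rfl⟩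
  · exact key 3 0 1 (by decide)
  · exact key 2 1 0 (by decide)
  · exact key 1 0 1 (by decide)
  · exact key 0 1 0 (by decide)

theorem torsion_hor_ver_ver (h : S.IsCentralFrame e s a) (p : Fin 4) (i j : Fin 3) :
    S.torsion ![hor e p, ver e i, ver e j] = 0 := by
  have key : ∀ p q r t : Fin 4, ∀ i j k : Fin 3, tupleSign ![(![0, 1, 2, 3] : Fin 4 → Fin 7) q,
      (![0, 1, 2, 3] : Fin 4 → Fin 7) r, (![0, 1, 2, 3] : Fin 4 → Fin 7) t,
      (![4, 5, 6] : Fin 3 → Fin 7) k, (![0, 1, 2, 3] : Fin 4 → Fin 7) p,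
      (![4, 5, 6] : Fin 3 → Fin 7) i, (![4, 5, 6] : Fin 3 → Fin 7) j] = 1 →
      S.torsion ![hor e p, ver e i, ver e j] = 0 := by
    intro p q r t i j k hs
    have h1 := h.torsion_apply _ _ _ _ _ _ _ hs
    have h2 : S.φ ![hor e p, ver e i, ver e j] = 0 := by
      rw [phi_swap_left, phi_swap_right, h.adapted.phi_ver_ver_hor]
      simp
    have h3 := h.dphi_hor_hor_hor_ver q r t k
    simp only [hor, ver] at h1 h2 h3 ⊢
    rw [h1, h2, h3]
    ring
  have hsw : ∀ i j, S.torsion ![hor e p, ver e j, ver e i] =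
      -S.torsion ![hor e p, ver e i, ver e j] := by
    intro i j
    exact form_swap_right _ _ _ _
  have hself : ∀ i, S.torsion ![hor e p, ver e i, ver e i] = 0 := fun i => by linarith [hsw i i]
  have h3 : ∀ i j k : Fin 3, (i = 0 ∧ j = 1 ∧ k = 2) ∨ (i = 1 ∧ j = 2 ∧ k = 0) ∨
      (i = 2 ∧ j = 0 ∧ k = 1) → S.torsion ![hor e p, ver e i, ver e j] = 0 := by
    intro i j k hk
    have hp : p = 0 ∨ p = 1 ∨ p = 2 ∨ p = 3 := by lia
    rcases hp with rfl | rfl | rfl | rfl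
    · refine key 0 1 2 3 i j k ?_
      rcases hk with ⟨rfl, rfl, rfl⟩ | ⟨rfl, rfl, rfl⟩ | ⟨rfl, rfl, rfl⟩ <;> decide
    · refine key 1 0 3 2 i j k ?_
      rcases hk with ⟨rfl, rfl, rfl⟩ | ⟨rfl, rfl, rfl⟩ | ⟨rfl, rfl, rfl⟩ <;> decide
    · refine key 2 0 1 3 i j k ?_
      rcases hk with ⟨rfl, rfl, rfl⟩ | ⟨rfl, rfl, rfl⟩ | ⟨rfl, rfl, rfl⟩ <;> decide
    · refine key 3 0 2 1 i j k ?_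
      rcases hk with ⟨rfl, rfl, rfl⟩ | ⟨rfl, rfl, rfl⟩ | ⟨rfl, rfl, rfl⟩ <;> decide
  have h01 := h3 0 1 2 (by decide)
  have h12 := h3 1 2 0 (by decide)
  have h20 := h3 2 0 1 (by decide)
  have h02 : S.torsion ![hor e p, ver e 0, ver e 2] = 0 := by rw [hsw, h20, neg_zero]
  have h10 : S.torsion ![hor e p, ver e 1, ver e 0] = 0 := by rw [hsw, h01, neg_zero]
  have h21 : S.torsion ![hor e p, ver e 2, ver e 1] = 0 := by rw [hsw, h12, neg_zero]
  have all : ∀ i j : Fin 3, (i = j) ∨ (i = 0 ∧ j = 1) ∨ (i = 0 ∧ j = 2) ∨ (i = 1 ∧ j = 0) ∨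
      (i = 1 ∧ j = 2) ∨ (i = 2 ∧ j = 0) ∨ (i = 2 ∧ j = 1) := by decide
  rcases all i j with rfl | ⟨rfl, rfl⟩ | ⟨rfl, rfl⟩ | ⟨rfl, rfl⟩ | ⟨rfl, rfl⟩ | ⟨rfl, rfl⟩ | ⟨rfl, rfl⟩
  exacts [hself i, h01, h02, h10, h12, h20, h21]

/-- The mixed part of the torsion is `(2/3) tr(s) σ_k - ⋆X_k`, with the star of `ℝ⁴`. -/
theorem torsion_hor_hor_ver (h : S.IsCentralFrame e s a) (p q : Fin 4) (k : Fin 3) :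
    S.torsion ![hor e p, hor e q, ver e k] =
      2 / 3 * (s 0 0 + s 1 1 + s 2 2) * sigmaMat k p q - pairMat (s k) (-a k) p q := by
  have key : ∀ p q r t : Fin 4, (∀ k : Fin 3, tupleSign ![(![0, 1, 2, 3] : Fin 4 → Fin 7) r,
      (![0, 1, 2, 3] : Fin 4 → Fin 7) t, (![4, 5, 6] : Fin 3 → Fin 7) (k + 1),
      (![4, 5, 6] : Fin 3 → Fin 7) (k + 2), (![0, 1, 2, 3] : Fin 4 → Fin 7) p,
      (![0, 1, 2, 3] : Fin 4 → Fin 7) q, (![4, 5, 6] : Fin 3 → Fin 7) k] = 1) →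
      ∀ k, S.torsion ![hor e p, hor e q, ver e k] =
        2 / 3 * (s 0 0 + s 1 1 + s 2 2) * sigmaMat k p q - pairMat (s k) (a k) r t := by
    intro p q r t hs k
    have h1 := h.torsion_apply _ _ _ _ _ _ _ (hs k)
    have h2 : S.φ ![hor e p, hor e q, ver e k] = sigmaMat k p q := by
      rw [phi_swap_right, phi_swap_left, h.adapted.phi_ver_hor_hor]
      simp
    have h3 := h.dphi_hor_hor_ver_ver r t (k + 1) (k + 2)
    have h4 : ∑ l, pairMat (s l) (a l) r t * eps l (k + 1) (k + 2) = pairMat (s k) (a k) r t := by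
      fin_cases k <;> simp [Fin.sum_univ_three, eps]
    rw [h4] at h3
    simp only [hor, ver] at h2 h3 ⊢
    rw [h1, h2, h3]
  have hself : ∀ x y : L, S.torsion ![x, x, y] = 0 := fun x y =>
    S.torsion.map_eq_zero_of_eq _ (i := 0) (j := 1) rfl (by decide)
  have h01 := key 0 1 2 3 (by decide) k
  have h02 := key 0 2 3 1 (by decide) k
  have h03 := key 0 3 1 2 (by decide) k
  have h12 := key 1 2 0 3 (by decide) k
  have h13 := key 1 3 2 0 (by decide) k
  have h23 := key 2 3 0 1 (by decide) k
  have h10 := key 1 0 3 2 (by decide) k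
  have h20 := key 2 0 1 3 (by decide) k
  have h30 := key 3 0 2 1 (by decide) k
  have h21 := key 2 1 3 0 (by decide) k
  have h31 := key 3 1 0 2 (by decide) k
  have h32 := key 3 2 1 0 (by decide) k
  have hd : ∀ p : Fin 4, sigmaMat k p p = 0 ∧ ∀ u v : Fin 3 → ℝ, pairMat u v p p = 0 := by
    intro p
    constructor
    · fin_cases k <;> fin_cases p <;> simp [sigmaMat]
    · intro u v
      fin_cases p <;> simp [pairMat, sigmaMat, tauMat, Fin.sum_univ_three]
  have hst : ∀ p q r t : Fin 4, tupleSign ![p, q, r, t] = 1 → ∀ u v : Fin 3 → ℝ,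
      pairMat u v r t = pairMat u (-v) p q := by
    intro p q r t hs u v
    fin_cases p <;> fin_cases q <;> first
      | exact absurd hs (by revert r t; decide)
      | (fin_cases r <;> fin_cases t <;> first
          | exact absurd hs (by decide)
          | (simp [pairMat, sigmaMat, tauMat, Fin.sum_univ_three]))
  have hpq : p = q ∨ p ≠ q := eq_or_ne p q
  rcases hpq with rfl | hpq
  · rw [hself, (hd p).1, (hd p).2]
    ring
  · fin_cases p <;> fin_cases q <;> first
      | exact absurd rfl hpq
      | (simp only [Fin.zero_eta, Fin.mk_one, Fin.reduceFinMk]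
         first
          | rw [h01, hst 0 1 2 3 (by decide)]
          | rw [h02, hst 0 2 3 1 (by decide)]
          | rw [h03, hst 0 3 1 2 (by decide)]
          | rw [h12, hst 1 2 0 3 (by decide)]
          | rw [h13, hst 1 3 2 0 (by decide)]
          | rw [h23, hst 2 3 0 1 (by decide)]
          | rw [h10, hst 1 0 3 2 (by decide)]
          | rw [h20, hst 2 0 1 3 (by decide)]
          | rw [h30, hst 3 0 2 1 (by decide)]
          | rw [h21, hst 2 1 3 0 (by decide)]
          | rw [h31, hst 3 1 0 2 (by decide)]
          | rw [h32, hst 3 2 1 0 (by decide)])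

end IsCentralFrame

end G2Structure

/-! ### Contractions of self-dual and anti-self-dual matrices -/

theorem sum_sigmaMat_mul_pairMat (k : Fin 3) (u b : Fin 3 → ℝ) :
    ∑ p, ∑ q, sigmaMat k p q * pairMat u b p q = 4 * u k := by
  fin_cases k <;> simp [pairMat, sigmaMat, tauMat, Fin.sum_univ_three, Fin.sum_univ_four] <;> ring

theorem sum_tauMat_mul_pairMat (k : Fin 3) (u b : Fin 3 → ℝ) :
    ∑ p, ∑ q, tauMat k p q * pairMat u b p q = 4 * b k := by
  fin_cases k <;> simp [pairMat, sigmaMat, tauMat, Fin.sum_univ_three, Fin.sum_univ_four] <;> ring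

/-- The commutator of two skew matrices of size four: the self-dual and anti-self-dual parts
commute, and each of them is a copy of the cross product of `ℝ³`. -/
theorem commutator_pairMat (u b v d : Fin 3 → ℝ) (p q : Fin 4) :
    ∑ c, (pairMat u b p c * pairMat v d q c - pairMat u b q c * pairMat v d p c) =
      pairMat (fun m => -2 * ∑ i, ∑ j, eps m i j * (u i * v j))
        (fun m => 2 * ∑ i, ∑ j, eps m i j * (b i * d j)) p q := by
  fin_cases p <;> fin_cases q <;>
    simp [pairMat, sigmaMat, tauMat, eps, Fin.sum_univ_three, Fin.sum_univ_four] <;> ring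

/-- The self-dual part of a commutator of skew matrices. -/
theorem sum_sigmaMat_mul_commutator (k : Fin 3) (u b v d : Fin 3 → ℝ) :
    ∑ p, ∑ q, sigmaMat k p q *
      ∑ c, (pairMat u b p c * pairMat v d q c - pairMat u b q c * pairMat v d p c) =
      -8 * ∑ i, ∑ j, eps k i j * (u i * v j) := by
  simp only [commutator_pairMat, sum_sigmaMat_mul_pairMat]
  ring

/-- The anti-self-dual part of a commutator of skew matrices. -/
theorem sum_tauMat_mul_commutator (k : Fin 3) (u b v d : Fin 3 → ℝ) :
    ∑ p, ∑ q, tauMat k p q *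
      ∑ c, (pairMat u b p c * pairMat v d q c - pairMat u b q c * pairMat v d p c) =
      8 * ∑ i, ∑ j, eps k i j * (b i * d j) := by
  simp only [commutator_pairMat, sum_tauMat_mul_pairMat]
  ring

theorem sum_sigmaMat_mul_sigmaMat_mul (k : Fin 3) (u b : Fin 3 → ℝ) :
    ∑ p, ∑ q, sigmaMat k p q * ∑ i, ∑ j, sigmaMat k i j *
      (pairMat u b i p * pairMat u b j q - pairMat u b j p * pairMat u b i q) =
      8 * (2 * u k ^ 2 + ∑ i, (b i ^ 2 - u i ^ 2)) := by
  fin_cases k <;>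
    simp [pairMat, sigmaMat, tauMat, Fin.sum_univ_three, Fin.sum_univ_four] <;> ring

theorem sum_tauMat_mul_sigmaMat_mul (k m : Fin 3) (u b : Fin 3 → ℝ) :
    ∑ p, ∑ q, tauMat m p q * ∑ i, ∑ j, sigmaMat k i j *
      (pairMat u b i p * pairMat u b j q - pairMat u b j p * pairMat u b i q) =
      16 * (u k * b m) := by
  fin_cases k <;> fin_cases m <;>
    simp [pairMat, sigmaMat, tauMat, Fin.sum_univ_three, Fin.sum_univ_four] <;> ring

namespace G2Structure

section Contraction

variable {V : Type*} [AddCommGroup V] [Module ℝ V] {S : G2Structure V}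

theorem phiContract_eq_sum (e : Basis (Fin 7) ℝ V) (v : V) (α : Form V 2) :
    S.phiContract e v α = ∑ i, ∑ j, S.φ ![v, e i, e j] * α ![e i, e j] := by
  have h : ∀ I : Fin 2 → Fin 7, (fun a => e (I a)) = ![e (I 0), e (I 1)] := by
    intro I
    ext a
    fin_cases a <;> rfl
  rw [← Fintype.sum_prod_type']
  rw [phiContract, pairing]
  refine Fintype.sum_equiv (finTwoArrowEquiv (Fin 7)) _ _ fun I => ?_
  simp only [h, finTwoArrowEquiv_apply]
  rfl

theorem form_two_swap (α : Form V 2) (x y : V) : α ![y, x] = -α ![x, y] := by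
  rw [← α.map_swap ![x, y] (i := 0) (j := 1) (by decide)]
  congr 1
  ext i
  fin_cases i <;> rfl

theorem IsAdapted.phiContract_ver {e : Basis (Fin 7) ℝ V} (he : S.IsAdapted e) (k : Fin 3)
    (α : Form V 2) : S.phiContract e (ver e k) α =
      ∑ p, ∑ q, sigmaMat k p q * α ![hor e p, hor e q]
        + ∑ i, ∑ j, eps k i j * α ![ver e i, ver e j] := by
  have h1 : ∀ i p, S.φ ![ver e k, hor e p, ver e i] = 0 := by
    intro i p
    rw [phi_swap_right, he.phi_ver_ver_hor, neg_zero]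
  rw [phiContract_eq_sum, sum_hor_add_sum_ver e (fun x => ∑ j, S.φ ![ver e k, x, e j] * α ![x, e j])]
  simp only [fun x => sum_hor_add_sum_ver e (fun y => S.φ ![ver e k, x, y] * α ![x, y]),
    he.phi_ver_hor_hor, he.phi_ver_ver_ver, he.phi_ver_ver_hor, h1, zero_mul,
    Finset.sum_const_zero, add_zero, zero_add]

theorem IsAdapted.phiContract_hor {e : Basis (Fin 7) ℝ V} (he : S.IsAdapted e) (r : Fin 4)
    (α : Form V 2) : S.phiContract e (hor e r) α =
      2 * ∑ p, ∑ k, sigmaMat k r p * α ![hor e p, ver e k] := by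
  have h1 : ∀ p k, S.φ ![hor e r, hor e p, ver e k] = sigmaMat k r p := by
    intro p k
    rw [phi_swap_right, phi_swap_left, he.phi_ver_hor_hor, neg_neg]
  have h2 : ∀ p k, S.φ ![hor e r, ver e k, hor e p] = -sigmaMat k r p := by
    intro p k
    rw [phi_swap_left, he.phi_ver_hor_hor]
  have h3 : ∀ k l, S.φ ![hor e r, ver e k, ver e l] = 0 := by
    intro k l
    rw [phi_swap_left, phi_swap_right, he.phi_ver_ver_hor]
    simp
  rw [phiContract_eq_sum, sum_hor_add_sum_ver e (fun x => ∑ j, S.φ ![hor e r, x, e j] * α ![x, e j])]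
  simp only [fun x => sum_hor_add_sum_ver e (fun y => S.φ ![hor e r, x, y] * α ![x, y]),
    he.phi_hor_hor_hor, h1, h2, h3, zero_mul,
    Finset.sum_const_zero, add_zero, zero_add]
  rw [Finset.sum_comm (s := (Finset.univ : Finset (Fin 3))), ← Finset.sum_add_distrib, Finset.mul_sum]
  refine Finset.sum_congr rfl fun p _ => ?_
  rw [← Finset.sum_add_distrib, Finset.mul_sum]
  refine Finset.sum_congr rfl fun k _ => ?_
  rw [form_two_swap α (hor e p) (ver e k)]
  ring

end Contraction

variable {L : Type*} [LieRing L] [LieAlgebra ℝ L] {S : G2Structure L}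

/-! ### The connection of a central frame -/

theorem IsInstanton.phiContract {lam : ℝ} (hi : S.IsInstanton lam) {e : Basis (Fin 7) ℝ L}
    (he : S.IsOrthonormal e) (v w z : L) : S.phiContract e v (S.curvatureForm lam w z) = 0 :=
  (wedge_psi_eq_zero_iff he _).1 (hi w z) v

theorem IsOrthonormal.g_ver_ver {e : Basis (Fin 7) ℝ L} (he : S.IsOrthonormal e) (i j : Fin 3) :
    S.g (ver e i) (ver e j) = if i = j then 1 else 0 := by
  rw [ver, ver, he]
  fin_cases i <;> fin_cases j <;> simp

theorem IsOrthonormal.g_ver_hor {e : Basis (Fin 7) ℝ L} (he : S.IsOrthonormal e) (i : Fin 3)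
    (p : Fin 4) : S.g (ver e i) (hor e p) = 0 := by
  rw [ver, hor, he]
  fin_cases i <;> fin_cases p <;> simp

namespace IsCentralFrame

variable {e : Basis (Fin 7) ℝ L} {s a : Fin 3 → Fin 3 → ℝ}

/-- The self-dual coefficients of `(x, y) ↦ g(∇^λ_x y, e_{k+4})` for `x, y` among the first four
basis vectors; the anti-self-dual ones are `(λ - 1) / 2` times those of `de^{k+4}`. -/
noncomputable def uCoeff (lam : ℝ) (s : Fin 3 → Fin 3 → ℝ) (k j : Fin 3) : ℝ :=
  -(1 + lam) / 2 * s k j + lam / 3 * (s 0 0 + s 1 1 + s 2 2) * if k = j then 1 else 0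

/-- The self-dual coefficients of `(x, y) ↦ g(∇^λ_{e_{k+4}} x, y)` for `x, y` among the first four
basis vectors; the anti-self-dual ones are `(1 + λ) / 2` times those of `de^{k+4}`. -/
noncomputable def wCoeff (lam : ℝ) (s : Fin 3 → Fin 3 → ℝ) (k j : Fin 3) : ℝ :=
  (1 - lam) / 2 * s k j + lam / 3 * (s 0 0 + s 1 1 + s 2 2) * if k = j then 1 else 0

theorem g_lie_ver (h : S.IsCentralFrame e s a) (p q : Fin 4) (k : Fin 3) :
    S.g ⁅hor e p, hor e q⁆ (ver e k) = -pairMat (s k) (a k) p q := by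
  rw [h.lie_hor]
  simp [h.adapted.1.g_ver_ver]

theorem g_lie_hor (h : S.IsCentralFrame e s a) (p q r : Fin 4) :
    S.g ⁅hor e p, hor e q⁆ (hor e r) = 0 := by
  rw [h.lie_hor]
  simp [h.adapted.1.g_ver_hor]

theorem sum_ite_sigmaMat (k : Fin 3) (p q : Fin 4) :
    ∑ j, (if k = j then (1 : ℝ) else 0) * sigmaMat j p q = sigmaMat k p q := by
  simp

theorem conn_hor_hor_hor (h : S.IsCentralFrame e s a) (lam : ℝ) (p q r : Fin 4) :
    S.conn lam (hor e p) (hor e q) (hor e r) = 0 := by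
  rw [conn_eq, h.torsion_hor]
  simp [h.g_lie_hor]

theorem conn_hor_hor_ver (h : S.IsCentralFrame e s a) (lam : ℝ) (p q : Fin 4) (k : Fin 3) :
    S.conn lam (hor e p) (hor e q) (ver e k) =
      pairMat (uCoeff lam s k) (fun j => (lam - 1) / 2 * a k j) p q := by
  rw [conn_eq, h.torsion_hor_hor_ver, h.g_lie_ver, h.lie_ver, h.lie_ver]
  rw [← sum_ite_sigmaMat k p q]
  simp only [pairMat, uCoeff, Fin.sum_univ_three, map_zero, LinearMap.zero_apply, Pi.neg_apply]
  ring

theorem conn_hor_ver_hor (h : S.IsCentralFrame e s a) (lam : ℝ) (p q : Fin 4) (k : Fin 3) :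
    S.conn lam (hor e p) (ver e k) (hor e q) =
      -pairMat (uCoeff lam s k) (fun j => (lam - 1) / 2 * a k j) p q := by
  rw [conn_skew, h.conn_hor_hor_ver]

theorem conn_hor_ver_ver (h : S.IsCentralFrame e s a) (lam : ℝ) (p : Fin 4) (i j : Fin 3) :
    S.conn lam (hor e p) (ver e i) (ver e j) = 0 := by
  rw [conn_eq, h.torsion_hor_ver_ver, h.lie_ver, h.lie_ver, h.lie_ver_right]
  simp

theorem conn_ver_hor_hor (h : S.IsCentralFrame e s a) (lam : ℝ) (p q : Fin 4) (k : Fin 3) :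
    S.conn lam (ver e k) (hor e p) (hor e q) =
      pairMat (wCoeff lam s k) (fun j => (1 + lam) / 2 * a k j) p q := by
  have ht : S.torsion ![ver e k, hor e p, hor e q] = S.torsion ![hor e p, hor e q, ver e k] := by
    rw [form_swap_left, form_swap_right, neg_neg]
  have hs : S.g ⁅hor e q, hor e p⁆ (ver e k) = pairMat (s k) (a k) p q := by
    rw [← lie_skew, map_neg, LinearMap.neg_apply, h.g_lie_ver, neg_neg]
  rw [conn_eq, ht, h.torsion_hor_hor_ver, hs, h.lie_ver, h.lie_ver_right]
  rw [← sum_ite_sigmaMat k p q]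
  simp only [pairMat, wCoeff, Fin.sum_univ_three, map_zero, LinearMap.zero_apply, Pi.neg_apply]
  ring

theorem conn_ver_ver_hor (h : S.IsCentralFrame e s a) (lam : ℝ) (p : Fin 4) (i j : Fin 3) :
    S.conn lam (ver e i) (ver e j) (hor e p) = 0 := by
  have ht : S.torsion ![ver e i, ver e j, hor e p] = 0 := by
    rw [form_swap_right, form_swap_left, h.torsion_hor_ver_ver]
    simp
  rw [conn_eq, ht, h.lie_ver, h.lie_ver_right, h.lie_ver_right]
  simp

theorem conn_ver_hor_ver (h : S.IsCentralFrame e s a) (lam : ℝ) (p : Fin 4) (i j : Fin 3) :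
    S.conn lam (ver e i) (hor e p) (ver e j) = 0 := by
  rw [conn_skew, h.conn_ver_ver_hor, neg_zero]

theorem conn_ver_ver_ver (h : S.IsCentralFrame e s a) (lam : ℝ) (i j k : Fin 3) :
    S.conn lam (ver e i) (ver e j) (ver e k) =
      -2 / 3 * lam * (s 0 0 + s 1 1 + s 2 2) * eps i j k := by
  rw [conn_eq, h.torsion_ver, h.lie_ver, h.lie_ver, h.lie_ver]
  simp
  ring

end IsCentralFrame

end G2Structure

/-! ### The instanton equations for a central adapted basis -/

theorem sum_sum_mul_sum {ι κ : Type*} [Fintype ι] [Fintype κ] (M : ι → ι → ℝ)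
    (F : κ → ι → ι → ℝ) :
    ∑ p, ∑ q, M p q * ∑ l, F l p q = ∑ l, ∑ p, ∑ q, M p q * F l p q := by
  simp only [Finset.mul_sum]
  rw [Finset.sum_congr rfl fun p _ => Finset.sum_comm, Finset.sum_comm]

theorem sum_sum_mul_const_mul {ι : Type*} [Fintype ι] (M : ι → ι → ℝ) (c : ℝ)
    (F : ι → ι → ℝ) : ∑ p, ∑ q, M p q * (c * F p q) = c * ∑ p, ∑ q, M p q * F p q := by
  simp only [Finset.mul_sum, mul_left_comm c]

theorem sum_sigmaMat_mul_sigmaMat_mul_pairMat (k l : Fin 3) (u b : Fin 3 → ℝ) :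
    ∑ r, ∑ q, sigmaMat l r q * ∑ p, sigmaMat k r p * pairMat u b p q =
      -4 * ∑ j, eps k l j * u j := by
  fin_cases k <;> fin_cases l <;>
    simp [pairMat, sigmaMat, tauMat, eps, Fin.sum_univ_three, Fin.sum_univ_four] <;> ring

theorem sum_sigmaMat_mul_sigmaMat_mul_mul (k l : Fin 3) (u b v d : Fin 3 → ℝ) :
    ∑ r, ∑ q, sigmaMat l r q * ∑ p, sigmaMat k r p * ∑ c, pairMat v d q c * pairMat u b p c =
      4 * ((if k = l then ∑ j, (u j * v j + b j * d j) else 0) + u k * v l - u l * v k) := by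
  fin_cases k <;> fin_cases l <;>
    simp [pairMat, sigmaMat, tauMat, Fin.sum_univ_three, Fin.sum_univ_four] <;> ring

namespace G2Structure

variable {L : Type*} [LieRing L] [LieAlgebra ℝ L] {S : G2Structure L}

/-- The curvature, with the sum over the basis split into the first four and last three vectors. -/
theorem IsOrthonormal.curvatureForm_apply' {e : Basis (Fin 7) ℝ L} (he : S.IsOrthonormal e)
    (lam : ℝ) (x y w z : L) : S.curvatureForm lam w z ![x, y] =
      ∑ p, (S.conn lam x w (hor e p) * S.conn lam y z (hor e p)
        - S.conn lam y w (hor e p) * S.conn lam x z (hor e p))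
      + ∑ k, (S.conn lam x w (ver e k) * S.conn lam y z (ver e k)
        - S.conn lam y w (ver e k) * S.conn lam x z (ver e k)) - S.conn lam ⁅x, y⁆ w z := by
  rw [he.curvatureForm_apply, sum_hor_add_sum_ver e (fun m =>
    S.conn lam x w m * S.conn lam y z m - S.conn lam y w m * S.conn lam x z m)]

theorem conn_zero_left (S : G2Structure L) (lam : ℝ) (w z : L) : S.conn lam 0 w z = 0 := by
  simp [conn]

namespace IsCentralFrame

variable {e : Basis (Fin 7) ℝ L} {s a : Fin 3 → Fin 3 → ℝ}

theorem conn_lie_hor (h : S.IsCentralFrame e s a) (lam : ℝ) (p q : Fin 4) (w z : L) :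
    S.conn lam ⁅hor e p, hor e q⁆ w z =
      -∑ k, pairMat (s k) (a k) p q * S.conn lam (ver e k) w z := by
  rw [h.lie_hor, conn_sum_left]
  simp [Finset.sum_neg_distrib]

theorem curvature_hor_hor_ver_ver (h : S.IsCentralFrame e s a) (lam : ℝ) (p q : Fin 4)
    (i j : Fin 3) : S.curvatureForm lam (ver e i) (ver e j) ![hor e p, hor e q] =
      ∑ c, (pairMat (uCoeff lam s i) (fun l => (lam - 1) / 2 * a i l) p c
          * pairMat (uCoeff lam s j) (fun l => (lam - 1) / 2 * a j l) q c
        - pairMat (uCoeff lam s i) (fun l => (lam - 1) / 2 * a i l) q c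
          * pairMat (uCoeff lam s j) (fun l => (lam - 1) / 2 * a j l) p c)
      + ∑ k, pairMat (s k) (a k) p q * (-2 / 3 * lam * (s 0 0 + s 1 1 + s 2 2) * eps k i j) := by
  rw [h.adapted.1.curvatureForm_apply', h.conn_lie_hor]
  simp only [h.conn_hor_ver_hor, h.conn_hor_ver_ver, h.conn_ver_ver_ver]
  simp

theorem curvature_ver_ver_ver_ver (h : S.IsCentralFrame e s a) (lam : ℝ) (k l i j : Fin 3) :
    S.curvatureForm lam (ver e i) (ver e j) ![ver e k, ver e l] =
      (-2 / 3 * lam * (s 0 0 + s 1 1 + s 2 2)) ^ 2 *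
        ∑ m, (eps k i m * eps l j m - eps l i m * eps k j m) := by
  rw [h.adapted.1.curvatureForm_apply', h.lie_ver, conn_zero_left]
  simp only [h.conn_ver_ver_hor, h.conn_ver_ver_ver, Finset.mul_sum]
  simp only [mul_zero, sub_zero, Finset.sum_const_zero, zero_add]
  exact Finset.sum_congr rfl fun m _ => by ring

theorem curvature_hor_hor_hor_hor (h : S.IsCentralFrame e s a) (lam : ℝ) (i j p q : Fin 4) :
    S.curvatureForm lam (hor e p) (hor e q) ![hor e i, hor e j] =
      ∑ k, (pairMat (uCoeff lam s k) (fun l => (lam - 1) / 2 * a k l) i p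
          * pairMat (uCoeff lam s k) (fun l => (lam - 1) / 2 * a k l) j q
        - pairMat (uCoeff lam s k) (fun l => (lam - 1) / 2 * a k l) j p
          * pairMat (uCoeff lam s k) (fun l => (lam - 1) / 2 * a k l) i q)
      + ∑ k, pairMat (s k) (a k) i j *
          pairMat (wCoeff lam s k) (fun l => (1 + lam) / 2 * a k l) p q := by
  rw [h.adapted.1.curvatureForm_apply', h.conn_lie_hor]
  simp only [h.conn_hor_hor_hor, h.conn_hor_hor_ver, h.conn_ver_hor_hor]
  simp

theorem curvature_ver_ver_hor_hor (h : S.IsCentralFrame e s a) (lam : ℝ) (i j : Fin 3)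
    (p q : Fin 4) : S.curvatureForm lam (hor e p) (hor e q) ![ver e i, ver e j] =
      ∑ c, (pairMat (wCoeff lam s i) (fun l => (1 + lam) / 2 * a i l) p c
          * pairMat (wCoeff lam s j) (fun l => (1 + lam) / 2 * a j l) q c
        - pairMat (wCoeff lam s j) (fun l => (1 + lam) / 2 * a j l) p c
          * pairMat (wCoeff lam s i) (fun l => (1 + lam) / 2 * a i l) q c) := by
  rw [h.adapted.1.curvatureForm_apply', h.lie_ver, conn_zero_left]
  simp only [h.conn_ver_hor_hor, h.conn_ver_hor_ver]
  simp

theorem curvature_hor_ver_hor_ver (h : S.IsCentralFrame e s a) (lam : ℝ) (p q : Fin 4)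
    (k l : Fin 3) : S.curvatureForm lam (hor e q) (ver e l) ![hor e p, ver e k] =
      ∑ c, pairMat (wCoeff lam s k) (fun l => (1 + lam) / 2 * a k l) q c
          * pairMat (uCoeff lam s l) (fun j => (lam - 1) / 2 * a l j) p c
      + ∑ m, pairMat (uCoeff lam s m) (fun j => (lam - 1) / 2 * a m j) p q
          * (-2 / 3 * lam * (s 0 0 + s 1 1 + s 2 2) * eps k l m) := by
  rw [h.adapted.1.curvatureForm_apply', h.lie_ver_right, conn_zero_left]
  simp only [h.conn_hor_hor_hor, h.conn_hor_hor_ver, h.conn_ver_hor_hor, h.conn_ver_ver_ver,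
    h.conn_hor_ver_hor, h.conn_ver_hor_ver]
  simp

/-- The trace of the instanton equations for the curvature components `g(R w, z)` with `w, z`
among the last three basis vectors. -/
theorem trace_ver (h : S.IsCentralFrame e s a) (hs : ∀ i j, s j i = s i j) {lam : ℝ}
    (hi : S.IsInstanton lam) :
    (1 + lam) ^ 2 * ((s 0 0 + s 1 1 + s 2 2) ^ 2 - ∑ i, ∑ j, s i j ^ 2) =
      8 / 3 * lam ^ 2 * (s 0 0 + s 1 1 + s 2 2) ^ 2 := by
  have key : ∀ k i j, -8 * ∑ l, ∑ m, eps k l m * (uCoeff lam s i l * uCoeff lam s j m)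
      + 4 * ∑ l, s l k * (-2 / 3 * lam * (s 0 0 + s 1 1 + s 2 2) * eps l i j)
      + (-2 / 3 * lam * (s 0 0 + s 1 1 + s 2 2)) ^ 2 *
        ∑ l, ∑ m, eps k l m * ∑ n, (eps l i n * eps m j n - eps m i n * eps l j n) = 0 := by
    intro k i j
    have h1 := hi.phiContract h.adapted.1 (ver e k) (ver e i) (ver e j)
    rw [h.adapted.phiContract_ver] at h1
    simp only [h.curvature_hor_hor_ver_ver, h.curvature_ver_ver_ver_ver,
      fun p q => mul_add (sigmaMat k p q),
      Finset.sum_add_distrib, sum_sigmaMat_mul_commutator] at h1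
    have h2 : ∑ p, ∑ q, sigmaMat k p q * ∑ l, pairMat (s l) (a l) p q *
        (-2 / 3 * lam * (s 0 0 + s 1 1 + s 2 2) * eps l i j) =
        4 * ∑ l, s l k * (-2 / 3 * lam * (s 0 0 + s 1 1 + s 2 2) * eps l i j) := by
      simp only [Finset.mul_sum, ← mul_assoc]
      rw [Finset.sum_congr rfl fun p _ => Finset.sum_comm, Finset.sum_comm]
      refine Finset.sum_congr rfl fun l _ => ?_
      simp only [← Finset.sum_mul, sum_sigmaMat_mul_pairMat]
    rw [h2] at h1
    simp only [Finset.mul_sum] at h1 ⊢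
    rw [← h1]
    congr 1
    refine Finset.sum_congr rfl fun l _ => Finset.sum_congr rfl fun m _ =>
      Finset.sum_congr rfl fun n _ => by ring
  have h0 := key 0 1 2
  have h1 := key 1 2 0
  have h2 := key 2 0 1
  simp only [Fin.sum_univ_three, eps, uCoeff, Matrix.cons_val, hs 0 1, hs 0 2, hs 1 2] at h0 h1 h2 ⊢
  simp at h0 h1 h2
  linear_combination -(h0 + h1 + h2)

/-- The contraction with `φ` at the basis vector `ver e k` vanishes on the curvature components
`g(R w, z)` with `w, z` among the first four basis vectors; here these equations are contracted with
a matrix `M` in `w` and `z`. -/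
theorem contract_hor_hor (h : S.IsCentralFrame e s a) {lam : ℝ} (hi : S.IsInstanton lam)
    (M : Fin 4 → Fin 4 → ℝ) (k : Fin 3) :
    ∑ l, ∑ p, ∑ q, M p q * ∑ i, ∑ j, sigmaMat k i j *
        (pairMat (uCoeff lam s l) (fun n => (lam - 1) / 2 * a l n) i p
            * pairMat (uCoeff lam s l) (fun n => (lam - 1) / 2 * a l n) j q
          - pairMat (uCoeff lam s l) (fun n => (lam - 1) / 2 * a l n) j p
            * pairMat (uCoeff lam s l) (fun n => (lam - 1) / 2 * a l n) i q)
      + 4 * ∑ l, s l k * ∑ p, ∑ q, M p q *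
          pairMat (wCoeff lam s l) (fun n => (1 + lam) / 2 * a l n) p q
      + ∑ i, ∑ j, eps k i j * ∑ p, ∑ q, M p q *
          ∑ c, (pairMat (wCoeff lam s i) (fun l => (1 + lam) / 2 * a i l) p c
            * pairMat (wCoeff lam s j) (fun l => (1 + lam) / 2 * a j l) q c
          - pairMat (wCoeff lam s i) (fun l => (1 + lam) / 2 * a i l) q c
            * pairMat (wCoeff lam s j) (fun l => (1 + lam) / 2 * a j l) p c) = 0 := by
  set U : Fin 3 → Fin 4 → Fin 4 → ℝ :=
    fun l => pairMat (uCoeff lam s l) (fun n => (lam - 1) / 2 * a l n) with hU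
  set W : Fin 3 → Fin 4 → Fin 4 → ℝ :=
    fun l => pairMat (wCoeff lam s l) (fun n => (1 + lam) / 2 * a l n) with hW
  have key : ∀ p q, ∑ l, ∑ i, ∑ j, sigmaMat k i j * (U l i p * U l j q - U l j p * U l i q)
      + 4 * ∑ l, s l k * W l p q
      + ∑ i, ∑ j, eps k i j * ∑ c, (W i p c * W j q c - W i q c * W j p c) = 0 := by
    intro p q
    have h1 := hi.phiContract h.adapted.1 (ver e k) (hor e p) (hor e q)
    rw [h.adapted.phiContract_ver] at h1
    have h2 : ∑ i, ∑ j, sigmaMat k i j * ∑ l, pairMat (s l) (a l) i j * W l p q =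
        4 * ∑ l, s l k * W l p q := by
      simp only [Finset.mul_sum, ← mul_assoc]
      rw [Finset.sum_congr rfl fun p _ => Finset.sum_comm, Finset.sum_comm]
      refine Finset.sum_congr rfl fun l _ => ?_
      simp only [← Finset.sum_mul, sum_sigmaMat_mul_pairMat]
    have h3 : ∑ i, ∑ j, sigmaMat k i j * ∑ l, (U l i p * U l j q - U l j p * U l i q) =
        ∑ l, ∑ i, ∑ j, sigmaMat k i j * (U l i p * U l j q - U l j p * U l i q) := by
      simp only [Finset.mul_sum]
      rw [Finset.sum_congr rfl fun p _ => Finset.sum_comm, Finset.sum_comm]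
    rw [← h2, ← h3, ← h1]
    simp only [h.curvature_hor_hor_hor_hor, h.curvature_ver_ver_hor_hor,
      fun p q => mul_add (sigmaMat k p q), Finset.sum_add_distrib]
    congr 1
    refine Finset.sum_congr rfl fun i _ => Finset.sum_congr rfl fun j _ => ?_
    congr 1
    exact Finset.sum_congr rfl fun c _ => by ring
  have hz : ∑ p, ∑ q, M p q * (∑ l, ∑ i, ∑ j, sigmaMat k i j *
        (U l i p * U l j q - U l j p * U l i q) + 4 * ∑ l, s l k * W l p q
      + ∑ i, ∑ j, eps k i j * ∑ c, (W i p c * W j q c - W i q c * W j p c)) = 0 := by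
    simp only [key, mul_zero, Finset.sum_const_zero]
  rw [← hz]
  simp only [fun p q => mul_add (M p q), Finset.sum_add_distrib, sum_sum_mul_sum M,
    sum_sum_mul_const_mul M]
  rfl

/-- The case `M = σ_k` of `contract_hor_hor`, summed over `k`. -/
theorem trace_selfDual (h : S.IsCentralFrame e s a) (hs : ∀ i j, s j i = s i j) {lam : ℝ}
    (hi : S.IsInstanton lam) :
    3 / 2 * (1 - lam) ^ 2 * ∑ i, ∑ j, a i j ^ 2 + (2 - 4 * lam) * ∑ i, ∑ j, s i j ^ 2
      - 1 / 2 * (1 - 10 / 3 * lam + lam ^ 2) * (s 0 0 + s 1 1 + s 2 2) ^ 2 = 0 := by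
  have key := fun k => h.contract_hor_hor hi (sigmaMat k) k
  simp only [sum_sigmaMat_mul_sigmaMat_mul, sum_sigmaMat_mul_pairMat,
    sum_sigmaMat_mul_commutator] at key
  have h0 := key 0
  have h1 := key 1
  have h2 := key 2
  simp only [Fin.sum_univ_three, eps, uCoeff, wCoeff, Matrix.cons_val, hs 0 1, hs 0 2, hs 1 2]
    at h0 h1 h2 ⊢
  simp at h0 h1 h2
  linear_combination (1 / 4) * (h0 + h1 + h2)

/-- The case of an anti-self-dual `M` of `contract_hor_hor`, at `λ = 1` and for scalar `s`: the
left-hand side is twice the `(k, m)` entry of the cofactor matrix of `a`. -/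
theorem cofactor_eq (h : S.IsCentralFrame e s a) {c : ℝ}
    (hs : ∀ i j, s i j = if i = j then c else 0) (hi : S.IsInstanton 1) (k m : Fin 3) :
    ∑ i, ∑ j, eps k i j * ∑ n, ∑ l, eps m n l * (a i n * a j l) = -2 * c * a k m := by
  have key := h.contract_hor_hor hi (tauMat m) k
  simp only [sum_tauMat_mul_sigmaMat_mul, sum_tauMat_mul_pairMat, sum_tauMat_mul_commutator]
    at key
  have h1 : ∑ l, s l k * (4 * ((1 + 1) / 2 * a l m)) = 4 * c * a k m := by
    simp only [hs]
    simp
    ring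
  rw [h1] at key
  simp only [fun i j (x : ℝ) => mul_left_comm (eps k i j) 8 x, ← Finset.mul_sum] at key
  norm_num at key
  linarith

/-- The trace against `σ_l` of the instanton equations for the curvature components
`g(R w, e_{l+4})` with `w` among the first four basis vectors. -/
theorem trace_mixed (h : S.IsCentralFrame e s a) (hs : ∀ i j, s j i = s i j) {lam : ℝ}
    (hi : S.IsInstanton lam) :
    (1 - lam) * ((1 - 5 / 3 * lam) * (s 0 0 + s 1 1 + s 2 2) ^ 2
      - (1 + lam) * (∑ i, ∑ j, a i j ^ 2 + 2 * ∑ i, ∑ j, s i j ^ 2)) = 0 := by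
  set U : Fin 3 → Fin 4 → Fin 4 → ℝ :=
    fun l => pairMat (uCoeff lam s l) (fun n => (lam - 1) / 2 * a l n) with hU
  set W : Fin 3 → Fin 4 → Fin 4 → ℝ :=
    fun l => pairMat (wCoeff lam s l) (fun n => (1 + lam) / 2 * a l n) with hW
  set β : ℝ := -2 / 3 * lam * (s 0 0 + s 1 1 + s 2 2) with hβ
  have key : ∀ r q l, ∑ k, ∑ p, sigmaMat k r p * ∑ c, W k q c * U l p c
      + ∑ k, ∑ m, β * eps k l m * ∑ p, sigmaMat k r p * U m p q = 0 := by
    intro r q l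
    have h1 := hi.phiContract h.adapted.1 (hor e r) (hor e q) (ver e l)
    rw [h.adapted.phiContract_hor, mul_eq_zero, or_iff_right two_ne_zero, Finset.sum_comm] at h1
    rw [← h1, ← Finset.sum_add_distrib]
    refine Finset.sum_congr rfl fun k _ => ?_
    simp only [h.curvature_hor_ver_hor_ver, fun p => mul_add (sigmaMat k r p),
      Finset.sum_add_distrib]
    congr 1
    simp only [Finset.mul_sum]
    rw [Finset.sum_comm]
    refine Finset.sum_congr rfl fun p _ => Finset.sum_congr rfl fun m _ => ?_
    simp only [hU, hβ]
    ring
  have hz : ∀ l, ∑ r, ∑ q, sigmaMat l r q * (∑ k, ∑ p, sigmaMat k r p * ∑ c, W k q c * U l p c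
      + ∑ k, ∑ m, β * eps k l m * ∑ p, sigmaMat k r p * U m p q) = 0 := by
    intro l
    simp only [key, mul_zero, Finset.sum_const_zero]
  have hz' : ∀ l, ∑ k, ∑ r, ∑ q, sigmaMat l r q * ∑ p, sigmaMat k r p * ∑ c, W k q c * U l p c
      + ∑ k, ∑ m, β * eps k l m * ∑ r, ∑ q, sigmaMat l r q * ∑ p, sigmaMat k r p * U m p q = 0 := by
    intro l
    rw [← hz l]
    simp only [fun r q => mul_add (sigmaMat l r q), Finset.sum_add_distrib,
      sum_sum_mul_sum (sigmaMat l), sum_sum_mul_const_mul (sigmaMat l)]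
  simp only [hU, hW, sum_sigmaMat_mul_sigmaMat_mul_pairMat, sum_sigmaMat_mul_sigmaMat_mul_mul] at hz'
  have h0 := hz' 0
  have h1 := hz' 1
  have h2 := hz' 2
  simp only [Fin.sum_univ_three, eps, uCoeff, wCoeff, Matrix.cons_val, hs 0 1, hs 0 2, hs 1 2]
    at h0 h1 h2 ⊢
  simp [hβ] at h0 h1 h2
  linear_combination h0 + h1 + h2

end IsCentralFrame

end G2Structure

/-! ### The trace equations determine `λ` and the self-dual part -/

section Commutator

variable {L : Type*} [LieRing L] [LieAlgebra ℝ L]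

theorem lie_mem_commutatorIdeal (x y : L) : ⁅x, y⁆ ∈ (commutatorIdeal L).toSubmodule :=
  LieSubmodule.lie_mem_lie (LieSubmodule.mem_top x) (LieSubmodule.mem_top y)

theorem commutatorIdeal_le {W : Submodule ℝ L} (h : ∀ x y : L, ⁅x, y⁆ ∈ W) :
    (commutatorIdeal L).toSubmodule ≤ W := by
  rw [commutatorIdeal, LieSubmodule.lieIdeal_oper_eq_linear_span', Submodule.span_le]
  rintro _ ⟨x, -, y, -, rfl⟩
  exact h x y

theorem commutatorIdeal_le_of_basis {ι : Type*} [Fintype ι] (e : Basis ι ℝ L) {W : Submodule ℝ L}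
    (h : ∀ i j, ⁅e i, e j⁆ ∈ W) : (commutatorIdeal L).toSubmodule ≤ W := by
  refine commutatorIdeal_le fun x y => ?_
  rw [← e.sum_repr x, ← e.sum_repr y]
  simp only [sum_lie, lie_sum, smul_lie, lie_smul]
  exact Submodule.sum_mem _ fun i _ => W.smul_mem _ (Submodule.sum_mem _ fun j _ =>
    W.smul_mem _ (h _ _))

end Commutator

/-- The three trace equations force `λ = 1`, unless all invariants vanish; `t`, `p` and `q` stand
for `tr s`, `|s|²` and `|a|²`. -/
theorem eq_one_of_scalar_equations {l t p q : ℝ} (hp : 0 ≤ p) (hq : 0 ≤ q)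
    (h1 : (1 + l) ^ 2 * (t ^ 2 - p) = 8 / 3 * l ^ 2 * t ^ 2)
    (h2 : 3 / 2 * (1 - l) ^ 2 * q + (2 - 4 * l) * p - 1 / 2 * (1 - 10 / 3 * l + l ^ 2) * t ^ 2 = 0)
    (h3 : (1 - l) * ((1 - 5 / 3 * l) * t ^ 2 - (1 + l) * (q + 2 * p)) = 0) :
    l = 1 ∨ (p = 0 ∧ q = 0) := by
  by_cases hl : l = 1
  · exact Or.inl hl
  right
  have h3' : (1 - 5 / 3 * l) * t ^ 2 - (1 + l) * (q + 2 * p) = 0 :=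
    (mul_eq_zero.1 h3).resolve_left fun h => hl (by linarith)
  by_cases hm : l = -1
  · subst hm
    have ht : t ^ 2 = 0 := by linarith
    rw [ht] at h2
    constructor <;> linarith
  have hm' : (1 + l) ≠ 0 := fun h => hm (by linarith)
  -- Elimination of `p` and `q`; the quadratic factor has no real root.
  have hE : l * (l - 1) * (3 * l ^ 2 - 4 * l + 5) * t ^ 2 = 0 := by
    linear_combination 3 / 2 * ((1 + l) ^ 2 * h2 + 3 / 2 * (1 - l) ^ 2 * (1 + l) * h3'
      + (-3 * (1 - l) ^ 2 + 2 - 4 * l) * h1)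
  have hpos : 3 * l ^ 2 - 4 * l + 5 ≠ 0 := by nlinarith [sq_nonneg (3 * l - 2)]
  have hl1 : l - 1 ≠ 0 := fun h => hl (by linarith)
  have hlt : l = 0 ∨ t ^ 2 = 0 := by
    rcases mul_eq_zero.1 hE with h | h
    · rcases mul_eq_zero.1 h with h | h
      · exact Or.inl ((mul_eq_zero.1 h).resolve_right hl1)
      · exact absurd h hpos
    · exact Or.inr h
  rcases hlt with rfl | ht
  · have := sq_nonneg t
    constructor <;> linarith
  · rw [ht] at h1 h3'
    have hp0 : p = 0 := by
      have : (1 + l) ^ 2 * p = 0 := by linarith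
      exact (mul_eq_zero.1 this).resolve_left (pow_ne_zero 2 hm')
    subst hp0
    refine ⟨rfl, ?_⟩
    have : (1 + l) * q = 0 := by linarith
    exact (mul_eq_zero.1 this).resolve_left hm'

namespace G2Structure

variable {L : Type*} [LieRing L] [LieAlgebra ℝ L] {S : G2Structure L}

/-- A property of all basis vectors may be checked on the first four and on the last three. -/
theorem basis_induction {V : Type*} [AddCommGroup V] [Module ℝ V] (e : Basis (Fin 7) ℝ V)
    {p : V → Prop} (hh : ∀ a, p (hor e a)) (hv : ∀ k, p (ver e k)) (i : Fin 7) : p (e i) := by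
  have h0 := hh 0
  have h1 := hh 1
  have h2 := hh 2
  have h3 := hh 3
  have h4 := hv 0
  have h5 := hv 1
  have h6 := hv 2
  fin_cases i <;> assumption

namespace IsCentralFrame

variable {e : Basis (Fin 7) ℝ L} {s a : Fin 3 → Fin 3 → ℝ}

theorem commutatorIdeal_le (h : S.IsCentralFrame e s a) {W : Submodule ℝ L}
    (hW : ∀ p q, ⁅hor e p, hor e q⁆ ∈ W) : (commutatorIdeal L).toSubmodule ≤ W := by
  refine commutatorIdeal_le_of_basis e fun i j => ?_
  refine basis_induction e (p := fun x => ⁅x, e j⁆ ∈ W) (fun p => ?_) (fun k => ?_) i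
  · refine basis_induction e (p := fun x => ⁅hor e p, x⁆ ∈ W) (fun q => hW p q) (fun k => ?_) j
    rw [h.lie_ver_right]
    exact W.zero_mem
  · rw [h.lie_ver]
    exact W.zero_mem

/-- If `s` vanishes and all two-by-two minors of `a` vanish, the brackets span at most a line. -/
theorem finrank_le_one_of_cofactor (h : S.IsCentralFrame e s a) (hs : ∀ i j, s i j = 0)
    (ha : ∀ k m, ∑ i, ∑ j, eps k i j * ∑ n, ∑ l, eps m n l * (a i n * a j l) = 0) :
    finrank ℝ (commutatorIdeal L).toSubmodule ≤ 1 := by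
  have hminor : ∀ i j n l, a i n * a j l = a i l * a j n := by
    have k00 := ha 0 0
    have k01 := ha 0 1
    have k02 := ha 0 2
    have k10 := ha 1 0
    have k11 := ha 1 1
    have k12 := ha 1 2
    have k20 := ha 2 0
    have k21 := ha 2 1
    have k22 := ha 2 2
    simp [Fin.sum_univ_three, eps] at k00 k01 k02 k10 k11 k12 k20 k21 k22
    intro i j n l
    fin_cases i <;> fin_cases j <;> fin_cases n <;> fin_cases l <;>
      simp only [Fin.zero_eta, Fin.mk_one, Fin.reduceFinMk] <;> linarith
  have hline : ∃ v : L, (commutatorIdeal L).toSubmodule ≤ Submodule.span ℝ {v} := by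
    by_cases h0 : ∃ i n, a i n ≠ 0
    · obtain ⟨i, n, hin⟩ := h0
      refine ⟨∑ k, a k n • ver e k, h.commutatorIdeal_le fun p q => ?_⟩
      rw [Submodule.mem_span_singleton]
      refine ⟨-(∑ j, a i j * tauMat j p q) / a i n, ?_⟩
      rw [h.lie_hor, Finset.smul_sum]
      refine Finset.sum_congr rfl fun k _ => ?_
      rw [smul_smul]
      congr 1
      simp only [pairMat, hs, zero_mul, zero_add]
      field_simp
      rw [Finset.mul_sum, Finset.sum_mul]
      congr 1
      refine Finset.sum_congr rfl fun x _ => ?_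
      rw [← mul_assoc, mul_right_comm, hminor i k x n]
    · push Not at h0
      refine ⟨0, h.commutatorIdeal_le fun p q => ?_⟩
      rw [h.lie_hor]
      simp [pairMat, hs, h0]
  obtain ⟨v, hv⟩ := hline
  have := S.finiteDimensional
  exact (Submodule.finrank_mono hv).trans ((finrank_span_le_card {v}).trans (by simp))

/-- For a central frame with symmetric `s`, an instanton has `λ = 1` and `s` is a nonzero multiple of
the identity. -/
theorem eq_one_of_isInstanton (h : S.IsCentralFrame e s a) (hs : ∀ i j, s j i = s i j) {lam : ℝ}
    (hi : S.IsInstanton lam) (hd : 2 ≤ finrank ℝ (commutatorIdeal L).toSubmodule) :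
    lam = 1 ∧ ∃ c : ℝ, c ≠ 0 ∧ ∀ i j, s i j = if i = j then c else 0 := by
  have hp : 0 ≤ ∑ i, ∑ j, s i j ^ 2 :=
    Finset.sum_nonneg fun i _ => Finset.sum_nonneg fun j _ => sq_nonneg _
  have hq : 0 ≤ ∑ i, ∑ j, a i j ^ 2 :=
    Finset.sum_nonneg fun i _ => Finset.sum_nonneg fun j _ => sq_nonneg _
  have hz : ∀ f : Fin 3 → Fin 3 → ℝ, ∑ i, ∑ j, f i j ^ 2 = 0 → ∀ i j, f i j = 0 := by
    intro f hf i j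
    have h1 := (Finset.sum_eq_zero_iff_of_nonneg (fun i _ =>
      Finset.sum_nonneg fun j _ => sq_nonneg (f i j))).1 hf i (Finset.mem_univ i)
    have h2 := (Finset.sum_eq_zero_iff_of_nonneg (fun j _ => sq_nonneg (f i j))).1 h1 j
      (Finset.mem_univ j)
    exact pow_eq_zero_iff two_ne_zero |>.1 h2
  rcases eq_one_of_scalar_equations hp hq (h.trace_ver hs hi) (h.trace_selfDual hs hi)
    (h.trace_mixed hs hi) with rfl | ⟨hp0, hq0⟩
  · refine ⟨rfl, (s 0 0 + s 1 1 + s 2 2) / 3, ?_⟩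
    have h1 := h.trace_ver hs hi
    -- At `λ = 1` the trace-free part of `s` has norm zero.
    have hc : ∀ i j, s i j = if i = j then (s 0 0 + s 1 1 + s 2 2) / 3 else 0 := by
      have h2 := hz (fun i j => s i j - if i = j then (s 0 0 + s 1 1 + s 2 2) / 3 else 0) (by
        simp [Fin.sum_univ_three] at h1 ⊢
        linarith)
      exact fun i j => sub_eq_zero.1 (h2 i j)
    refine ⟨fun h0 => ?_, hc⟩
    rw [h0] at hc
    have h2 := h.finrank_le_one_of_cofactor (fun i j => by rw [hc]; simp) (fun k m => by
      rw [h.cofactor_eq hc hi]; ring)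
    lia
  · have h2 := h.finrank_le_one_of_cofactor (hz s hp0) (fun k m => by
      simp [hz a hq0])
    lia

end IsCentralFrame

end G2Structure

/-! ### Self-dual parts of two-forms -/

/-- The determinant of a matrix of basis vectors is the sign of the tuple of their indices. -/
theorem det_eq_tupleSign {n : ℕ} (K : Fin n → Fin n) :
    (Matrix.of fun a b => if K a = b then (1 : ℝ) else 0).det = tupleSign K := by
  rw [← coframe_id_apply (Pi.basisFun ℝ (Fin n)) K, coframe_apply_basis]
  rfl

/-- The Hodge star of `ℝ⁴` fixes the forms `σ_k⁺`; the sum runs over ordered pairs, whence the factor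
two. -/
theorem sum_sigmaMat_mul_tupleSign (k : Fin 3) (p q : Fin 4) :
    ∑ i, ∑ j, sigmaMat k i j * (tupleSign ![i, j, p, q] : ℝ) = 2 * sigmaMat k p q := by
  have hz : ∃ m : Fin 3 → Fin 4 → Fin 4 → ℤ, (∀ k p q, (m k p q : ℝ) = sigmaMat k p q) ∧
      ∀ k p q, ∑ i, ∑ j, m k i j * tupleSign ![i, j, p, q] = 2 * m k p q := by
    refine ⟨![![![0, 0, 1, 0], ![0, 0, 0, -1], ![-1, 0, 0, 0], ![0, 1, 0, 0]],
      ![![0, 0, 0, -1], ![0, 0, -1, 0], ![0, 1, 0, 0], ![1, 0, 0, 0]],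
      ![![0, 1, 0, 0], ![-1, 0, 0, 0], ![0, 0, 0, 1], ![0, 0, -1, 0]]], ?_, by decide +kernel⟩
    intro k p q
    fin_cases k <;> fin_cases p <;> fin_cases q <;> simp [sigmaMat]
  obtain ⟨m, hm, h⟩ := hz
  simp only [← hm]
  exact_mod_cast h k p q

theorem sum_tauMat_mul_tupleSign (k : Fin 3) (p q : Fin 4) :
    ∑ i, ∑ j, tauMat k i j * (tupleSign ![i, j, p, q] : ℝ) = -2 * tauMat k p q := by
  have hz : ∃ m : Fin 3 → Fin 4 → Fin 4 → ℤ, (∀ k p q, (m k p q : ℝ) = tauMat k p q) ∧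
      ∀ k p q, ∑ i, ∑ j, m k i j * tupleSign ![i, j, p, q] = -2 * m k p q := by
    refine ⟨![![![0, 0, 1, 0], ![0, 0, 0, 1], ![-1, 0, 0, 0], ![0, -1, 0, 0]],
      ![![0, 0, 0, -1], ![0, 0, 1, 0], ![0, -1, 0, 0], ![1, 0, 0, 0]],
      ![![0, 1, 0, 0], ![-1, 0, 0, 0], ![0, 0, 0, -1], ![0, 0, 1, 0]]], ?_, by decide +kernel⟩
    intro k p q
    fin_cases k <;> fin_cases p <;> fin_cases q <;> simp [tauMat]
  obtain ⟨m, hm, h⟩ := hz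
  simp only [← hm]
  exact_mod_cast h k p q

theorem sum_pairMat_mul_tupleSign (u b : Fin 3 → ℝ) (p q : Fin 4) :
    ∑ i, ∑ j, pairMat u b i j * (tupleSign ![i, j, p, q] : ℝ) = 2 * pairMat u (-b) p q := by
  have h : ∀ i j, pairMat u b i j * (tupleSign ![i, j, p, q] : ℝ) =
      ∑ k, (u k * (sigmaMat k i j * (tupleSign ![i, j, p, q] : ℝ))
        + b k * (tauMat k i j * (tupleSign ![i, j, p, q] : ℝ))) := by
    intro i j
    rw [pairMat, Finset.sum_mul]
    exact Finset.sum_congr rfl fun k _ => by ring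
  simp only [h]
  rw [Finset.sum_congr rfl fun i _ => Finset.sum_comm, Finset.sum_comm, pairMat, Finset.mul_sum]
  refine Finset.sum_congr rfl fun k _ => ?_
  simp only [Finset.sum_add_distrib, ← Finset.mul_sum, sum_sigmaMat_mul_tupleSign,
    sum_tauMat_mul_tupleSign, Pi.neg_apply]
  ring

namespace G2Structure

section SelfDual

variable {V : Type*} [AddCommGroup V] [Module ℝ V]

theorem coframe_hor (e : Basis (Fin 7) ℝ V) (i j p q : Fin 4) :
    coframe e ![0, 1, 2, 3] ![hor e i, hor e j, hor e p, hor e q] = tupleSign ![i, j, p, q] := by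
  have h : ![hor e i, hor e j, hor e p, hor e q] =
      fun a => e (![0, 1, 2, 3] (![i, j, p, q] a)) := by
    ext a
    fin_cases a <;> rfl
  have hinj : ∀ a b : Fin 4, (![0, 1, 2, 3] : Fin 4 → Fin 7) a = ![0, 1, 2, 3] b ↔ a = b := by
    decide
  rw [h, coframe_apply_basis e ![0, 1, 2, 3] (fun a => ![0, 1, 2, 3] (![i, j, p, q] a)),
    ← det_eq_tupleSign]
  simp only [hinj]

theorem coframe_hor_ver (e : Basis (Fin 7) ℝ V) (x y z : V) (k : Fin 3) :
    coframe e ![0, 1, 2, 3] ![x, y, z, ver e k] = 0 := by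
  rw [coframe_apply]
  refine Matrix.det_eq_zero_of_row_eq_zero 3 fun b => ?_
  fin_cases k <;> fin_cases b <;> simp [ver]

theorem hodgeStar_hor_apply (e : Basis (Fin 7) ℝ V) (α : Form V 2) (x y : V) :
    hodgeStar (k := 2) (m := 2) ![e 0, e 1, e 2, e 3] (coframe e ![0, 1, 2, 3]) α ![x, y] =
      1 / 2 * ∑ i, ∑ j, α ![hor e i, hor e j] *
        coframe e ![0, 1, 2, 3] ![hor e i, hor e j, x, y] := by
  have h : ∀ i, (![e 0, e 1, e 2, e 3] : Fin 4 → V) i = hor e i := by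
    intro i
    fin_cases i <;> rfl
  have h2 : ∀ I : Fin 2 → Fin 4, (fun a => hor e (I a)) = ![hor e (I 0), hor e (I 1)] := by
    intro I
    ext a
    fin_cases a <;> rfl
  have h3 : ∀ u v : V, Fin.append ![u, v] ![x, y] = ![u, v, x, y] := by
    intro u v
    ext a
    fin_cases a <;> rfl
  have h4 : ∀ (u v : V), contract ![u, v] (coframe e ![0, 1, 2, 3]) ![x, y] =
      coframe e ![0, 1, 2, 3] ![u, v, x, y] := by
    intro u v
    rw [← h3]
    rfl
  rw [hodgeStar, ← Fintype.sum_prod_type', AlternatingMap.smul_apply, form_sum_apply, smul_eq_mul]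
  congr 1
  refine Fintype.sum_equiv (finTwoArrowEquiv (Fin 4)) _ _ fun I => ?_
  simp only [AlternatingMap.smul_apply, smul_eq_mul]
  have h5 : (fun a => (![e 0, e 1, e 2, e 3] : Fin 4 → V) (I a)) =
      ![hor e (I 0), hor e (I 1)] := by
    rw [← h2]
    exact funext fun a => h (I a)
  rw [h5, h4]
  rfl

theorem selfDualPart_hor {e : Basis (Fin 7) ℝ V} {α : Form V 2} {u b : Fin 3 → ℝ}
    (hα : ∀ p q, α ![hor e p, hor e q] = pairMat u b p q) (p q : Fin 4) :
    selfDualPart e α ![hor e p, hor e q] = ∑ k, u k * sigmaMat k p q := by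
  rw [selfDualPart, AlternatingMap.smul_apply, AlternatingMap.add_apply, hodgeStar_hor_apply]
  simp only [hα, coframe_hor, sum_pairMat_mul_tupleSign]
  simp only [pairMat, Finset.sum_add_distrib, smul_eq_mul, Pi.neg_apply, neg_mul,
    Finset.sum_neg_distrib]
  ring

theorem selfDualPart_ver {e : Basis (Fin 7) ℝ V} {α : Form V 2} {x : V} {k : Fin 3}
    (hα : α ![x, ver e k] = 0) : selfDualPart e α ![x, ver e k] = 0 := by
  rw [selfDualPart, AlternatingMap.smul_apply, AlternatingMap.add_apply, hodgeStar_hor_apply]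
  simp [hα, coframe_hor_ver]

theorem coframe_two_apply (e : Basis (Fin 7) ℝ V) (i j : Fin 7) (x y : V) :
    coframe e ![i, j] ![x, y] = e.repr x i * e.repr y j - e.repr x j * e.repr y i := by
  rw [coframe_apply, Matrix.det_fin_two]
  simp

theorem sigmaPlus_hor (e : Basis (Fin 7) ℝ V) (k : Fin 3) (p q : Fin 4) :
    sigmaPlus e k ![hor e p, hor e q] = sigmaMat k p q := by
  fin_cases k <;> fin_cases p <;> fin_cases q <;>
    simp [sigmaPlus, coframe_two_apply, hor, sigmaMat]

theorem sigmaPlus_ver (e : Basis (Fin 7) ℝ V) (k l : Fin 3) (x : V) :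
    sigmaPlus e k ![x, ver e l] = 0 := by
  fin_cases k <;> fin_cases l <;>
    simp [sigmaPlus, coframe_two_apply, ver]

/-- Two-forms that vanish on `e_5, e_6, e_7` are determined by their values on the first four
basis vectors. -/
theorem form_two_ext_hor {e : Basis (Fin 7) ℝ V} {α β : Form V 2}
    (hh : ∀ p q, α ![hor e p, hor e q] = β ![hor e p, hor e q])
    (hα : ∀ x k, α ![x, ver e k] = 0) (hβ : ∀ x k, β ![x, ver e k] = 0) : α = β := by
  refine form_ext e fun K _ => ?_
  have h : (fun a => e (K a)) = ![e (K 0), e (K 1)] := by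
    ext a
    fin_cases a <;> rfl
  rw [h]
  refine basis_induction e (p := fun y => α ![e (K 0), y] = β ![e (K 0), y])
    (fun q => ?_) (fun k => by rw [hα, hβ]) (K 1)
  refine basis_induction e (p := fun x => α ![x, hor e q] = β ![x, hor e q])
    (fun p => hh p q) (fun k => ?_) (K 0)
  rw [form_two_swap α (hor e q) (ver e k), form_two_swap β (hor e q) (ver e k), hα, hβ]

/-- The self-dual part of a two-form on the first four directions is `c σ_k⁺` exactly if its
self-dual coefficients are those of `c σ_k⁺`. -/
theorem selfDualPart_eq_iff {e : Basis (Fin 7) ℝ V} {α : Form V 2} {u b : Fin 3 → ℝ} {c : ℝ}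
    (hα : ∀ p q, α ![hor e p, hor e q] = pairMat u b p q) (hv : ∀ x k, α ![x, ver e k] = 0)
    (k : Fin 3) :
    selfDualPart e α = c • sigmaPlus e k ↔ ∀ j, u j = if k = j then c else 0 := by
  constructor
  · intro h j
    have h1 : ∀ p q, ∑ l, u l * sigmaMat l p q = c * sigmaMat k p q := by
      intro p q
      rw [← selfDualPart_hor hα, h, AlternatingMap.smul_apply, sigmaPlus_hor, smul_eq_mul]
    have h02 := h1 0 2
    have h03 := h1 0 3
    have h01 := h1 0 1
    simp [Fin.sum_univ_three, sigmaMat] at h01 h02 h03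
    fin_cases k <;> fin_cases j <;> simp at h01 h02 h03 ⊢ <;> assumption
  · intro h
    refine form_two_ext_hor (fun p q => ?_) (fun x k => selfDualPart_ver (hv x k)) (fun x l => ?_)
    · rw [selfDualPart_hor hα, AlternatingMap.smul_apply, sigmaPlus_hor, smul_eq_mul]
      simp [h]
    · rw [AlternatingMap.smul_apply, sigmaPlus_ver, smul_zero]

end SelfDual

variable {L : Type*} [LieRing L] [LieAlgebra ℝ L] {S : G2Structure L}

theorem IsOrthonormal.ceDiff_coframe {e : Basis (Fin 7) ℝ L} (he : S.IsOrthonormal e) (k : Fin 3)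
    (x y : L) :
    ceDiff (coframe e ![Fin.natAdd 4 k]) ![x, y] = -S.g ⁅x, y⁆ (ver e k) := by
  have h : (Fin.natAdd 4 k : Fin 7) = ![4, 5, 6] k := by
    fin_cases k <;> rfl
  rw [ceDiff_one, coframe_apply, Matrix.det_fin_one, h]
  simp [he.repr_eq, ver]

end G2Structure

/-! ### The brackets of `j` and the cofactor equation -/

theorem pairMat_smul (c : ℝ) (u b : Fin 3 → ℝ) (p q : Fin 4) :
    c * pairMat u b p q = pairMat (fun m => c * u m) (fun m => c * b m) p q := by
  rw [pairMat, pairMat, Finset.mul_sum]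
  exact Finset.sum_congr rfl fun _ _ => by ring

theorem sum_pairMat {ι : Type*} [Fintype ι] (u b : ι → Fin 3 → ℝ) (p q : Fin 4) :
    ∑ k, pairMat (u k) (b k) p q = pairMat (fun m => ∑ k, u k m) (fun m => ∑ k, b k m) p q := by
  simp only [pairMat]
  rw [Finset.sum_comm]
  refine Finset.sum_congr rfl fun _ _ => ?_
  rw [Finset.sum_add_distrib, Finset.sum_mul, Finset.sum_mul]

/-- The two ways of writing that the cofactor matrix of `a` is `-c a`. -/
theorem cofactor_iff {a : Fin 3 → Fin 3 → ℝ} {c : ℝ} :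
    (∀ k m, ∑ i, ∑ j, eps k i j * ∑ n, ∑ l, eps m n l * (a i n * a j l) = -2 * c * a k m) ↔
      ∀ i j m, ∑ n, ∑ l, eps m n l * (a i n * a j l) = -c * ∑ k, eps i j k * a k m := by
  constructor
  · intro h i j m
    have h0 := h 0 m
    have h1 := h 1 m
    have h2 := h 2 m
    fin_cases m <;> simp [Fin.sum_univ_three, eps] at h0 h1 h2 <;>
      fin_cases i <;> fin_cases j <;> simp [Fin.sum_univ_three, eps] <;> linarith
  · intro h k m
    simp only [h]
    fin_cases k <;> simp [Fin.sum_univ_three, eps] <;> ring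

namespace G2Structure

section Linear

variable {V : Type*} [AddCommGroup V] [Module ℝ V] {S : G2Structure V}

/-- A linear condition on vectors holds if it holds on a basis. -/
theorem linear_induction (e : Basis (Fin 7) ℝ V) {p : V → Prop} (h0 : p 0)
    (hadd : ∀ x y, p x → p y → p (x + y)) (hsmul : ∀ (c : ℝ) x, p x → p (c • x))
    (hh : ∀ a, p (hor e a)) (hv : ∀ k, p (ver e k)) (x : V) : p x := by
  have hx : x ∈ Submodule.span ℝ (Set.range e) := by simp
  induction hx using Submodule.span_induction with
  | mem x hx =>
    obtain ⟨i, rfl⟩ := hx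
    exact basis_induction e hh hv i
  | zero => exact h0
  | add x y _ _ hx hy => exact hadd x y hx hy
  | smul c x _ hx => exact hsmul c x hx

theorem phiContract_add_left (e : Basis (Fin 7) ℝ V) (v w : V) (α : Form V 2) :
    S.phiContract e (v + w) α = S.phiContract e v α + S.phiContract e w α := by
  simp only [phiContract_eq_sum, ← thirdSlot_apply, thirdSlot_add_left, LinearMap.add_apply,
    add_mul, Finset.sum_add_distrib]

theorem phiContract_smul_left (e : Basis (Fin 7) ℝ V) (c : ℝ) (v : V) (α : Form V 2) :
    S.phiContract e (c • v) α = c * S.phiContract e v α := by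
  simp only [phiContract_eq_sum, ← thirdSlot_apply, thirdSlot_smul_left, LinearMap.smul_apply,
    smul_eq_mul, mul_assoc, Finset.mul_sum]

theorem phiContract_add_right (e : Basis (Fin 7) ℝ V) (v : V) (α β : Form V 2) :
    S.phiContract e v (α + β) = S.phiContract e v α + S.phiContract e v β := by
  simp only [phiContract_eq_sum, AlternatingMap.add_apply, mul_add, Finset.sum_add_distrib]

theorem phiContract_smul_right (e : Basis (Fin 7) ℝ V) (c : ℝ) (v : V) (α : Form V 2) :
    S.phiContract e v (c • α) = c * S.phiContract e v α := by
  simp only [phiContract_eq_sum, AlternatingMap.smul_apply, smul_eq_mul, mul_left_comm _ c,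
    Finset.mul_sum]

theorem IsOrthonormal.eq_sum {e : Basis (Fin 7) ℝ V} (he : S.IsOrthonormal e) (x : V) :
    x = ∑ p, S.g x (hor e p) • hor e p + ∑ k, S.g x (ver e k) • ver e k := by
  conv_lhs => rw [← e.sum_repr x]
  simp only [he.repr_eq, Fin.sum_univ_seven, Fin.sum_univ_four, Fin.sum_univ_three, hor, ver,
    Matrix.cons_val]
  abel

theorem ver_mem_span (e : Basis (Fin 7) ℝ V) (k : Fin 3) :
    ver e k ∈ Submodule.span ℝ (Set.range (ver e)) :=
  Submodule.subset_span ⟨k, rfl⟩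

theorem range_ver (e : Basis (Fin 7) ℝ V) : Set.range (ver e) = {e 4, e 5, e 6} := by
  ext x
  simp [ver, Fin.exists_fin_succ, eq_comm]

theorem IsOrthonormal.eq_sum_ver {e : Basis (Fin 7) ℝ V} (he : S.IsOrthonormal e) {x : V}
    (hx : x ∈ Submodule.span ℝ (Set.range (ver e))) : x = ∑ k, S.g x (ver e k) • ver e k := by
  have h : ∀ p, S.g x (hor e p) = 0 := by
    intro p
    induction hx using Submodule.span_induction with
    | mem x hx =>
      obtain ⟨k, rfl⟩ := hx
      rw [ver, hor, he]
      fin_cases k <;> fin_cases p <;> simp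
    | zero => simp
    | add x y _ _ hx hy => simp [hx, hy]
    | smul c x _ hx => simp [hx]
  conv_lhs => rw [he.eq_sum x]
  simp [h]

theorem finrank_span_ver (e : Basis (Fin 7) ℝ V) :
    finrank ℝ (Submodule.span ℝ (Set.range (ver e))) = 3 := by
  have h : LinearIndependent ℝ (ver e) :=
    e.linearIndependent.comp (![4, 5, 6] : Fin 3 → Fin 7) (by decide)
  rw [finrank_span_eq_card h, Fintype.card_fin]

end Linear

variable {L : Type*} [LieRing L] [LieAlgebra ℝ L] {S : G2Structure L}

theorem curvatureForm_add_left (lam : ℝ) (w w' z : L) :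
    S.curvatureForm lam (w + w') z = S.curvatureForm lam w z + S.curvatureForm lam w' z := by
  ext v
  simp [curvatureForm]

theorem curvatureForm_smul_left (lam c : ℝ) (w z : L) :
    S.curvatureForm lam (c • w) z = c • S.curvatureForm lam w z := by
  ext v
  simp [curvatureForm]

theorem curvatureForm_add_right (lam : ℝ) (w z z' : L) :
    S.curvatureForm lam w (z + z') = S.curvatureForm lam w z + S.curvatureForm lam w z' := by
  ext v
  simp [curvatureForm]

theorem curvatureForm_smul_right (lam c : ℝ) (w z : L) :
    S.curvatureForm lam w (c • z) = c • S.curvatureForm lam w z := by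
  ext v
  simp [curvatureForm]

/-- The instanton condition may be checked on basis vectors. -/
theorem isInstanton_of_basis {e : Basis (Fin 7) ℝ L} (he : S.IsOrthonormal e) {lam : ℝ}
    (h : ∀ i m n, S.phiContract e (e i) (S.curvatureForm lam (e m) (e n)) = 0) :
    S.IsInstanton lam := by
  intro w z
  rw [wedge_psi_eq_zero_iff he]
  intro v
  have hv : v ∈ Submodule.span ℝ (Set.range e) := by simp
  have hw : w ∈ Submodule.span ℝ (Set.range e) := by simp
  have hz : z ∈ Submodule.span ℝ (Set.range e) := by simp
  induction hv using Submodule.span_induction with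
  | zero => simpa using S.phiContract_smul_left e 0 0 (S.curvatureForm lam w z)
  | add x y _ _ hx hy => rw [phiContract_add_left, hx, hy, add_zero]
  | smul c x _ hx => rw [phiContract_smul_left, hx, mul_zero]
  | mem v hv =>
    obtain ⟨i, rfl⟩ := hv
    induction hw using Submodule.span_induction with
    | zero =>
      have h0 := S.curvatureForm_smul_left lam 0 0 z
      rw [zero_smul] at h0
      rw [h0, phiContract_smul_right, zero_mul]
    | add x y _ _ hx hy => rw [curvatureForm_add_left, phiContract_add_right, hx, hy, add_zero]
    | smul c x _ hx => rw [curvatureForm_smul_left, phiContract_smul_right, hx, mul_zero]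
    | mem w hw =>
      obtain ⟨m, rfl⟩ := hw
      induction hz using Submodule.span_induction with
      | zero =>
        have h0 := S.curvatureForm_smul_right lam 0 (e m) 0
        rw [zero_smul] at h0
        rw [h0, phiContract_smul_right, zero_mul]
      | add x y _ _ hx hy => rw [curvatureForm_add_right, phiContract_add_right, hx, hy, add_zero]
      | smul c x _ hx => rw [curvatureForm_smul_right, phiContract_smul_right, hx, mul_zero]
      | mem z hz =>
        obtain ⟨n, rfl⟩ := hz
        exact h i m n

/-- An adapted basis is a central frame if its last three vectors are central and span a space that
contains the brackets of the first four. -/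
theorem IsAdapted.exists_isCentralFrame {e : Basis (Fin 7) ℝ L} (he : S.IsAdapted e)
    (hz : ∀ (k : Fin 3) (v : L), ⁅ver e k, v⁆ = 0)
    (hb : ∀ p q, ⁅hor e p, hor e q⁆ ∈ Submodule.span ℝ (Set.range (ver e))) :
    ∃ s a, S.IsCentralFrame e s a := by
  have h : ∀ k, ∃ s a : Fin 3 → ℝ, ∀ p q, -S.g ⁅hor e p, hor e q⁆ (ver e k) = pairMat s a p q := by
    intro k
    have h1 := eq_pairMat_of_skew (X := fun p q => -S.g ⁅hor e p, hor e q⁆ (ver e k)) (by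
      intro p q
      rw [← lie_skew (hor e p) (hor e q), map_neg, LinearMap.neg_apply, neg_neg])
    exact ⟨_, _, fun p q => congrFun (congrFun h1 p) q⟩
  choose s a hsa using h
  refine ⟨s, a, he, hz, fun p q => ?_⟩
  rw [he.1.eq_sum_ver (hb p q)]
  simp only [← hsa, neg_neg, ← he.1.eq_sum_ver (hb p q)]

/-- The bracket of `j(z)` and `j(z')` in terms of structure constants. -/
theorem IsOrthonormal.g_commutator_j {e : Basis (Fin 7) ℝ L} (he : S.IsOrthonormal e)
    (z z' x y : L) : S.g ((S.j z * S.j z' - S.j z' * S.j z) x) y =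
      ∑ m, (S.g z ⁅x, e m⁆ * S.g z' ⁅y, e m⁆ - S.g z ⁅y, e m⁆ * S.g z' ⁅x, e m⁆) := by
  have h : ∀ z z' : L, S.g (S.j z (S.j z' x)) y = -∑ m, S.g z ⁅y, e m⁆ * S.g z' ⁅x, e m⁆ := by
    intro z z'
    rw [g_j, ← lie_skew, map_neg, ← g_j, he.g_eq]
    simp only [g_j]
  simp only [LinearMap.sub_apply, Module.End.mul_apply, map_sub, h, Finset.sum_sub_distrib]
  simp only [mul_comm]
  ring

namespace IsCentralFrame

variable {e : Basis (Fin 7) ℝ L} {s a : Fin 3 → Fin 3 → ℝ} {c : ℝ}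

theorem lie_mem_span_ver (h : S.IsCentralFrame e s a) (p q : Fin 4) :
    ⁅hor e p, hor e q⁆ ∈ Submodule.span ℝ (Set.range (ver e)) := by
  rw [h.lie_hor]
  exact Submodule.sum_mem _ fun k _ => Submodule.smul_mem _ _ (ver_mem_span e k)

/-- Contracting the brackets with `σ_k` isolates a multiple of `e_{k+4}`. -/
theorem commutatorIdeal_eq (h : S.IsCentralFrame e s a)
    (hs : ∀ i j, s i j = if i = j then c else 0) (hc : c ≠ 0) :
    (commutatorIdeal L).toSubmodule = Submodule.span ℝ (Set.range (ver e)) := by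
  refine le_antisymm (h.commutatorIdeal_le h.lie_mem_span_ver) ?_
  rw [Submodule.span_le]
  rintro _ ⟨k, rfl⟩
  have h1 : ∑ p, ∑ q, sigmaMat k p q • ⁅hor e p, hor e q⁆ = (-4 * c) • ver e k := by
    simp only [h.lie_hor, Finset.smul_sum, smul_smul, mul_neg]
    rw [Finset.sum_congr rfl fun p _ => Finset.sum_comm, Finset.sum_comm]
    simp only [← Finset.sum_smul, Finset.sum_neg_distrib, sum_sigmaMat_mul_pairMat, hs]
    simp
  have h2 : (-4 * c) • ver e k ∈ (commutatorIdeal L).toSubmodule := by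
    rw [← h1]
    exact Submodule.sum_mem _ fun p _ => Submodule.sum_mem _ fun q _ =>
      Submodule.smul_mem _ _ (lie_mem_commutatorIdeal _ _)
  exact (Submodule.smul_mem_iff _ (by simpa using hc)).1 h2

/-- The commutator of `j(e_{i+4})` and `j(e_{j+4})`: the self-dual part comes from `s = c · id` and the
anti-self-dual part from the two-by-two minors of `a`. -/
theorem g_commutator_j_ver (h : S.IsCentralFrame e s a)
    (hs : ∀ i j, s i j = if i = j then c else 0) (i j : Fin 3) (p q : Fin 4) :
    S.g ((S.j (ver e i) * S.j (ver e j) - S.j (ver e j) * S.j (ver e i)) (hor e p)) (hor e q) =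
      pairMat (fun m => -2 * c ^ 2 * eps i j m)
        (fun m => 2 * ∑ n, ∑ l, eps m n l * (a i n * a j l)) p q := by
  rw [h.adapted.1.g_commutator_j, sum_hor_add_sum_ver e (fun m =>
    S.g (ver e i) ⁅hor e p, m⁆ * S.g (ver e j) ⁅hor e q, m⁆
      - S.g (ver e i) ⁅hor e q, m⁆ * S.g (ver e j) ⁅hor e p, m⁆)]
  have hg : ∀ k p q, S.g (ver e k) ⁅hor e p, hor e q⁆ = -pairMat (s k) (a k) p q := by
    intro k p q
    rw [S.g_symm, h.g_lie_ver]
  simp only [hg, h.lie_ver_right, map_zero, mul_zero, sub_zero, Finset.sum_const_zero, add_zero,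
    neg_mul_neg, commutator_pairMat]
  congr 1
  ext m
  simp only [hs]
  fin_cases i <;> fin_cases j <;> fin_cases m <;> simp [eps] <;> ring

/-- The endomorphism `2 c j(τ(e_{i+4}) e_{j+4})`; its self-dual part is that of the commutator of
`j(e_{i+4})` and `j(e_{j+4})`. -/
theorem phi_ver_ver_lie (h : S.IsCentralFrame e s a)
    (hs : ∀ i j, s i j = if i = j then c else 0) (i j : Fin 3) (p q : Fin 4) :
    2 * c * S.φ ![ver e i, ver e j, ⁅hor e p, hor e q⁆] =
      pairMat (fun m => -2 * c ^ 2 * eps i j m) (fun m => -2 * c * ∑ k, eps i j k * a k m) p q := by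
  rw [← thirdSlot_apply, h.lie_hor]
  simp only [map_sum, map_smul, thirdSlot_apply, h.adapted.phi_ver_ver_ver, smul_eq_mul, neg_mul,
    Finset.sum_neg_distrib, mul_comm (pairMat _ _ p q), pairMat_smul (eps i j _), sum_pairMat]
  rw [mul_neg, ← neg_mul, pairMat_smul]
  congr 1
  · ext m
    simp only [hs]
    simp
    ring
  · ext m
    ring

/-- The condition on the brackets of `j` amounts to the cofactor equation for `a`. -/
theorem commutator_j_iff (h : S.IsCentralFrame e s a)
    (hs : ∀ i j, s i j = if i = j then c else 0)
    (hW : (commutatorIdeal L).toSubmodule = Submodule.span ℝ (Set.range (ver e))) :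
    (∀ z z' : (commutatorIdeal L).toSubmodule, S.j z * S.j z' - S.j z' * S.j z =
        (2 * c) • S.j (S.tau (commutatorIdeal L).toSubmodule z z')) ↔
      ∀ k m, ∑ i, ∑ j, eps k i j * ∑ n, ∑ l, eps m n l * (a i n * a j l) = -2 * c * a k m := by
  have hτ : ∀ (z z' : (commutatorIdeal L).toSubmodule) (x y : L),
      S.g (((2 * c) • S.j (S.tau (commutatorIdeal L).toSubmodule z z')) x) y =
        2 * c * S.φ ![(z : L), (z' : L), ⁅x, y⁆] := by
    intro z z' x y
    rw [LinearMap.smul_apply, map_smul, LinearMap.smul_apply, g_j, smul_eq_mul]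
    congr 1
    exact S.g_tau _ z z' ⟨⁅x, y⁆, lie_mem_commutatorIdeal x y⟩
  rw [cofactor_iff]
  constructor
  · intro hj i j m
    have hm : ∀ k, ver e k ∈ (commutatorIdeal L).toSubmodule := fun k => by
      rw [hW]
      exact ver_mem_span e k
    have h1 : ∀ p q, pairMat (fun m => -2 * c ^ 2 * eps i j m)
        (fun m => 2 * ∑ n, ∑ l, eps m n l * (a i n * a j l)) p q =
        pairMat (fun m => -2 * c ^ 2 * eps i j m)
          (fun m => -2 * c * ∑ k, eps i j k * a k m) p q := by
      intro p q
      rw [← h.phi_ver_ver_lie hs, ← h.g_commutator_j_ver hs,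
        ← hτ ⟨ver e i, hm i⟩ ⟨ver e j, hm j⟩, ← hj]
    have h2 := sum_tauMat_mul_pairMat m (fun m => -2 * c ^ 2 * eps i j m)
      (fun m => 2 * ∑ n, ∑ l, eps m n l * (a i n * a j l))
    simp only [h1, sum_tauMat_mul_pairMat] at h2
    linarith
  · intro hF z z'
    have key : ∀ (i j : Fin 3) (x y : L),
        ∑ m, (S.g (ver e i) ⁅x, e m⁆ * S.g (ver e j) ⁅y, e m⁆
          - S.g (ver e i) ⁅y, e m⁆ * S.g (ver e j) ⁅x, e m⁆) =
        2 * c * thirdSlot S.φ (ver e i) (ver e j) ⁅x, y⁆ := by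
      intro i j x y
      refine linear_induction e (p := fun x => ∑ m, (S.g (ver e i) ⁅x, e m⁆ * S.g (ver e j) ⁅y, e m⁆
          - S.g (ver e i) ⁅y, e m⁆ * S.g (ver e j) ⁅x, e m⁆) =
        2 * c * thirdSlot S.φ (ver e i) (ver e j) ⁅x, y⁆) (by simp) ?_ ?_ ?_ ?_ x
      · intro x x' hx hx'
        simp only [add_lie, map_add, mul_add, ← hx, ← hx', ← Finset.sum_add_distrib]
        exact Finset.sum_congr rfl fun m _ => by ring
      · intro r x hx
        simp only [smul_lie, map_smul, smul_eq_mul, mul_left_comm _ r, ← hx, Finset.mul_sum]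
        exact Finset.sum_congr rfl fun m _ => by ring
      · intro p
        refine linear_induction e (p := fun y => ∑ m, (S.g (ver e i) ⁅hor e p, e m⁆ *
            S.g (ver e j) ⁅y, e m⁆ - S.g (ver e i) ⁅y, e m⁆ * S.g (ver e j) ⁅hor e p, e m⁆) =
          2 * c * thirdSlot S.φ (ver e i) (ver e j) ⁅hor e p, y⁆) (by simp) ?_ ?_ ?_ ?_ y
        · intro x x' hx hx'
          simp only [add_lie, lie_add, map_add, mul_add, ← hx, ← hx', ← Finset.sum_add_distrib]
          exact Finset.sum_congr rfl fun m _ => by ring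
        · intro r x hx
          simp only [smul_lie, lie_smul, map_smul, smul_eq_mul, mul_left_comm _ r, ← hx,
            Finset.mul_sum]
          exact Finset.sum_congr rfl fun m _ => by ring
        · intro q
          rw [← h.adapted.1.g_commutator_j, h.g_commutator_j_ver hs, thirdSlot_apply,
            h.phi_ver_ver_lie hs]
          congr 1
          ext m
          rw [hF]
          ring
        · intro k
          simp [h.lie_ver, h.lie_ver_right]
      · intro k
        simp [h.lie_ver]
    have hz : ∀ z ∈ Submodule.span ℝ (Set.range (ver e)), ∀ z' ∈ Submodule.span ℝ (Set.range (ver e)),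
        ∀ x y : L, ∑ m, (S.g z ⁅x, e m⁆ * S.g z' ⁅y, e m⁆ - S.g z ⁅y, e m⁆ * S.g z' ⁅x, e m⁆) =
          2 * c * thirdSlot S.φ z z' ⁅x, y⁆ := by
      intro z hz z' hz' x y
      induction hz using Submodule.span_induction with
      | zero => simp [thirdSlot_apply, form_zero_left]
      | add z w _ _ hx hy =>
        simp only [map_add, LinearMap.add_apply, thirdSlot_add_left, mul_add, ← hx, ← hy,
          ← Finset.sum_add_distrib]
        exact Finset.sum_congr rfl fun m _ => by ring
      | smul r z _ hx =>
        simp only [map_smul, LinearMap.smul_apply, thirdSlot_smul_left, smul_eq_mul,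
          mul_left_comm _ r, ← hx, Finset.mul_sum]
        exact Finset.sum_congr rfl fun m _ => by ring
      | mem z hz =>
        obtain ⟨i, rfl⟩ := hz
        induction hz' using Submodule.span_induction with
        | zero =>
          have h0 := thirdSlot_smul_right S.φ 0 (ver e i) 0
          simp only [zero_smul] at h0
          simp [h0]
        | add z w _ _ hx hy =>
          simp only [map_add, LinearMap.add_apply, thirdSlot_add_right, mul_add, ← hx, ← hy,
            ← Finset.sum_add_distrib]
          exact Finset.sum_congr rfl fun m _ => by ring
        | smul r z _ hx =>
          simp only [map_smul, LinearMap.smul_apply, thirdSlot_smul_right, smul_eq_mul,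
            mul_left_comm _ r, ← hx, Finset.mul_sum]
          exact Finset.sum_congr rfl fun m _ => by ring
        | mem z hz =>
          obtain ⟨j, rfl⟩ := hz
          exact key i j x y
    refine LinearMap.ext fun x => S.ext_g fun y => ?_
    rw [h.adapted.1.g_commutator_j, hτ, ← thirdSlot_apply]
    exact hz z (hW ▸ z.2) z' (hW ▸ z'.2) x y

/-- At `λ = 1` and for `s = c · id`, the operators `∇_x` with `x` among the first four basis vectors
vanish. -/
theorem conn_one_hor (h : S.IsCentralFrame e s a)
    (hs : ∀ i j, s i j = if i = j then c else 0) (p : Fin 4) (i j : Fin 7) :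
    S.conn 1 (hor e p) (e i) (e j) = 0 := by
  have hU : ∀ k p q, pairMat (uCoeff 1 s k) (fun j => (1 - 1) / 2 * a k j) p q = 0 := by
    intro k p q
    have h1 : uCoeff 1 s k = fun _ => 0 := by
      ext j
      simp only [uCoeff, hs]
      split_ifs <;> simp
      ring
    rw [h1]
    simp [pairMat]
  refine basis_induction e (p := fun x => S.conn 1 (hor e p) x (e j) = 0) (fun q => ?_)
    (fun k => ?_) i
  · refine basis_induction e (p := fun x => S.conn 1 (hor e p) (hor e q) x = 0) (fun r => ?_)
      (fun l => ?_) j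
    · rw [h.conn_hor_hor_hor]
    · rw [h.conn_hor_hor_ver, hU]
  · refine basis_induction e (p := fun x => S.conn 1 (hor e p) (ver e k) x = 0) (fun r => ?_)
      (fun l => ?_) j
    · rw [h.conn_hor_ver_hor, hU, neg_zero]
    · rw [h.conn_hor_ver_ver]

end IsCentralFrame

end G2Structure

/-! ### The converse for central frames -/

namespace G2Structure

variable {L : Type*} [LieRing L] [LieAlgebra ℝ L] {S : G2Structure L}

theorem sum_eps_mul_sum_eps (k m : Fin 3) :
    ∑ i, ∑ j, eps k i j * eps i j m = if k = m then 2 else 0 := by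
  fin_cases k <;> fin_cases m <;> simp [Fin.sum_univ_three, eps] <;> norm_num

theorem sum_eps_mul_eps_mul_eps (k i j : Fin 3) :
    ∑ m, ∑ n, eps k m n * ∑ r, (eps m i r * eps n j r - eps n i r * eps m j r) =
      2 * eps k i j := by
  fin_cases k <;> fin_cases i <;> fin_cases j <;> simp [Fin.sum_univ_three, eps] <;> norm_num

namespace IsCentralFrame

variable {e : Basis (Fin 7) ℝ L} {s a : Fin 3 → Fin 3 → ℝ} {c : ℝ}

/-- For `s = c · id` and `λ = 1`, the instanton equations reduce to the cofactor equation for `a`. -/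
theorem isInstanton_one (h : S.IsCentralFrame e s a)
    (hs : ∀ i j, s i j = if i = j then c else 0)
    (hF : ∀ k m, ∑ i, ∑ j, eps k i j * ∑ n, ∑ l, eps m n l * (a i n * a j l) = -2 * c * a k m) :
    S.IsInstanton 1 := by
  have hU : ∀ k p q, pairMat (uCoeff 1 s k) (fun j => (1 - 1) / 2 * a k j) p q = 0 := by
    intro k p q
    rw [← h.conn_hor_hor_ver]
    exact h.conn_one_hor hs p _ _
  have hW : ∀ k p q, pairMat (wCoeff 1 s k) (fun j => (1 + 1) / 2 * a k j) p q =
      pairMat (fun m => if k = m then c else 0) (a k) p q := by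
    intro k p q
    congr 1
    · ext j
      simp only [wCoeff, hs]
      split_ifs <;> simp
      ring
    · ext j
      norm_num
  have ht : s 0 0 + s 1 1 + s 2 2 = 3 * c := by
    simp only [hs]
    norm_num
    ring
  -- The mixed components `g(R w, z)` have no values on pairs of the same kind.
  have hmix : ∀ k q i, S.phiContract e (ver e k) (S.curvatureForm 1 (hor e q) (ver e i)) = 0 := by
    intro k q i
    rw [h.adapted.phiContract_ver]
    have h1 : ∀ x y, S.curvatureForm 1 (hor e q) (ver e i) ![hor e x, hor e y] = 0 := by
      intro x y
      rw [h.adapted.1.curvatureForm_apply', h.conn_lie_hor]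
      simp only [h.conn_hor_hor_hor, h.conn_hor_ver_ver, h.conn_ver_hor_ver]
      simp
    have h2 : ∀ x y, S.curvatureForm 1 (hor e q) (ver e i) ![ver e x, ver e y] = 0 := by
      intro x y
      rw [h.adapted.1.curvatureForm_apply', h.lie_ver, conn_zero_left]
      simp only [h.conn_ver_ver_hor, h.conn_ver_hor_ver]
      simp
    simp [h1, h2]
  have hskew : ∀ w z : L, S.curvatureForm 1 z w = (-1 : ℝ) • S.curvatureForm 1 w z := by
    intro w z
    ext v
    have hv : v = ![v 0, v 1] := by
      ext i
      fin_cases i <;> rfl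
    rw [hv, AlternatingMap.smul_apply, h.adapted.1.curvatureForm_apply,
      h.adapted.1.curvatureForm_apply, S.conn_skew 1 ⁅v 0, v 1⁆ w z, smul_eq_mul]
    simp only [Finset.sum_sub_distrib, mul_comm]
    ring
  -- The remaining cases: `φ` contracted at a vector among the first four, where the curvature
  -- vanishes on mixed pairs, and at one of the last three, for the components `g(R w, z)` with
  -- `w, z` of the same kind.
  refine isInstanton_of_basis h.adapted.1 fun i m n => ?_
  refine basis_induction e (p := fun x => S.phiContract e x (S.curvatureForm 1 (e m) (e n)) = 0)
    (fun r => ?_) (fun k => ?_) i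
  · rw [h.adapted.phiContract_hor]
    have h1 : ∀ x k, S.curvatureForm 1 (e m) (e n) ![hor e x, ver e k] = 0 := by
      intro x k
      rw [h.adapted.1.curvatureForm_apply, h.lie_ver_right, conn_zero_left]
      simp only [h.conn_one_hor hs]
      simp
    simp [h1]
  · refine basis_induction e
      (p := fun w => S.phiContract e (ver e k) (S.curvatureForm 1 w (e n)) = 0)
      (fun q => ?_) (fun i => ?_) m
    · refine basis_induction e
        (p := fun z => S.phiContract e (ver e k) (S.curvatureForm 1 (hor e q) z) = 0)
        (fun r => ?_) (fun j => hmix k q j) n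
      rw [h.adapted.phiContract_ver]
      simp only [h.curvature_hor_hor_hor_hor, h.curvature_ver_ver_hor_hor, hU, hW]
      have h1 : ∑ i, ∑ j, sigmaMat k i j * ∑ l, pairMat (s l) (a l) i j *
          pairMat (fun m => if l = m then c else 0) (a l) q r =
          4 * c * pairMat (fun m => if k = m then c else 0) (a k) q r := by
        simp only [Finset.mul_sum, ← mul_assoc]
        rw [Finset.sum_congr rfl fun p _ => Finset.sum_comm, Finset.sum_comm]
        simp only [← Finset.sum_mul, sum_sigmaMat_mul_pairMat, hs]
        simp
      have h2 : ∀ i j, ∑ x, (pairMat (fun m => if i = m then c else 0) (a i) q x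
            * pairMat (fun m => if j = m then c else 0) (a j) r x
          - pairMat (fun m => if j = m then c else 0) (a j) q x
            * pairMat (fun m => if i = m then c else 0) (a i) r x) =
          pairMat (fun m => -2 * c ^ 2 * eps i j m)
            (fun m => -2 * c * ∑ k, eps i j k * a k m) q r := by
        intro i j
        rw [Finset.sum_congr rfl fun x _ => congrArg _ (mul_comm _ _), commutator_pairMat]
        congr 1
        · ext m
          fin_cases i <;> fin_cases j <;> fin_cases m <;> simp [eps] <;> ring
        · ext m
          rw [cofactor_iff.1 hF]
          ring
      simp only [mul_zero, sub_zero, zero_add, Finset.sum_const_zero]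
      rw [h1]
      simp only [h2]
      simp only [pairMat_smul, sum_pairMat]
      simp only [pairMat]
      rw [← Finset.sum_add_distrib]
      refine Finset.sum_eq_zero fun m _ => ?_
      have h3 : ∑ i, ∑ j, eps k i j * (-2 * c ^ 2 * eps i j m) =
          -4 * c * if k = m then c else 0 := by
        simp only [mul_left_comm (eps k _ _) (-2 * c ^ 2), ← Finset.mul_sum, sum_eps_mul_sum_eps]
        split_ifs <;> ring
      have h4 : ∑ i, ∑ j, eps k i j * (-2 * c * ∑ l, eps i j l * a l m) = -4 * c * a k m := by
        simp only [mul_left_comm (eps k _ _) (-2 * c), ← Finset.mul_sum, sum_sum_mul_sum (eps k)]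
        simp only [← mul_assoc, ← Finset.sum_mul, sum_eps_mul_sum_eps]
        simp
        ring
      rw [h3, h4]
      ring
    · refine basis_induction e
        (p := fun z => S.phiContract e (ver e k) (S.curvatureForm 1 (ver e i) z) = 0)
        (fun r => ?_) (fun j => ?_) n
      · rw [hskew, phiContract_smul_right, hmix, mul_zero]
      · rw [h.adapted.phiContract_ver]
        simp only [h.curvature_hor_hor_ver_ver, h.curvature_ver_ver_ver_ver, hU, ht]
        simp only [mul_zero, sub_zero, zero_add, Finset.sum_const_zero,
          mul_left_comm (eps _ _ _) ((-2 / 3 * 1 * (3 * c)) ^ 2) _, ← Finset.mul_sum,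
          sum_eps_mul_eps_mul_eps]
        have h1 : ∑ p, ∑ q, sigmaMat k p q * ∑ l, pairMat (s l) (a l) p q *
            (-2 / 3 * 1 * (3 * c) * eps l i j) = -8 * c ^ 2 * eps k i j := by
          simp only [Finset.mul_sum, ← mul_assoc]
          rw [Finset.sum_congr rfl fun p _ => Finset.sum_comm, Finset.sum_comm]
          simp only [← Finset.sum_mul, sum_sigmaMat_mul_pairMat, hs]
          simp
          ring
        rw [h1]
        ring

end IsCentralFrame

end G2Structure

/-! ### Tilted frames: commutators that are not closed under the cross product -/

/-- An alternating form on three vectors, in terms of cyclic pairs. -/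
theorem form_eps_left {V : Type*} [AddCommGroup V] [Module ℝ V] (ω : Form V 3) (f : Fin 3 → V)
    (i j : Fin 3) (w : V) :
    ω ![f i, f j, w] = ∑ k, eps i j k * ω ![f (k + 1), f (k + 2), w] := by
  have h := form_swap_left ω
  have e1 : ∀ x, ω ![x, x, w] = 0 := fun x => by linarith [h x x w]
  fin_cases i <;> fin_cases j <;> simp [Fin.sum_univ_three, eps, e1]
  · exact h _ _ _
  · exact h _ _ _
  · exact h _ _ _

/-- The variant of `form_eps_left` for the last two slots. -/
theorem form_eps_right {V : Type*} [AddCommGroup V] [Module ℝ V] (ω : Form V 3) (f : Fin 3 → V)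
    (i j : Fin 3) (w : V) :
    ω ![w, f i, f j] = ∑ k, eps i j k * ω ![w, f (k + 1), f (k + 2)] := by
  have h : ∀ x y, ω ![w, x, y] = ω ![x, y, w] := fun x y => by
    rw [form_swap_left, form_swap_right, neg_neg]
  simp only [h]
  exact form_eps_left ω f i j w

/-- The values of an alternating form on triples from a family of three vectors. -/
theorem form_eps {V : Type*} [AddCommGroup V] [Module ℝ V] (ω : Form V 3) (f : Fin 3 → V)
    (i j k : Fin 3) : ω ![f i, f j, f k] = eps i j k * ω ![f 0, f 1, f 2] := by
  have h1 := form_swap_left ω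
  have h2 := form_swap_right ω
  have e1 : ∀ x w, ω ![x, x, w] = 0 := fun x w => by linarith [h1 x x w]
  have e2 : ∀ x w, ω ![w, x, x] = 0 := fun x w => by linarith [h2 w x x]
  have e3 : ∀ x w, ω ![x, w, x] = 0 := fun x w => by linarith [h2 x w x, e1 x w]
  fin_cases i <;> fin_cases j <;> fin_cases k <;> simp [eps, e1, e2, e3]
  · exact h2 _ _ _
  · exact h1 _ _ _
  · rw [h2, h1, neg_neg]
  · rw [h1, h2, neg_neg]
  · rw [h1, h2, h1, neg_neg]

namespace G2Structure

section Blocks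

variable {V : Type*} [AddCommGroup V] [Module ℝ V] {S : G2Structure V}

/-- The first three vectors of a basis; in a tilted frame they span the commutator. -/
noncomputable def inn (F : Basis (Fin 7) ℝ V) (k : Fin 3) : V := F (![0, 1, 2] k)

/-- The three-form `φ` in a basis that arises from an adapted one by a rotation in the plane of
`e_1` and `e_7`, with cosine `c` and sine `r`. -/
noncomputable def tiltedModel (F : Basis (Fin 7) ℝ V) (c r : ℝ) : Form V 3 :=
  c • coframe F ![0, 1, 2] - r • coframe F ![0, 1, 6] + r • coframe F ![0, 2, 5]
    - coframe F ![0, 3, 4] - c • coframe F ![0, 5, 6] - r • coframe F ![1, 2, 4]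
    - coframe F ![1, 3, 5] + c • coframe F ![1, 4, 6] - coframe F ![2, 3, 6]
    - c • coframe F ![2, 4, 5] + r • coframe F ![4, 5, 6]

theorem coframe_three_apply (F : Basis (Fin 7) ℝ V) (i j k : Fin 7) (x y z : V) :
    coframe F ![i, j, k] ![x, y, z] =
      F.repr x i * (F.repr y j * F.repr z k - F.repr y k * F.repr z j)
      - F.repr x j * (F.repr y i * F.repr z k - F.repr y k * F.repr z i)
      + F.repr x k * (F.repr y i * F.repr z j - F.repr y j * F.repr z i) := by
  rw [coframe_apply, Matrix.det_fin_three]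
  simp
  ring

theorem tiltedModel_inn (F : Basis (Fin 7) ℝ V) (c r : ℝ) :
    tiltedModel F c r ![inn F 0, inn F 1, inn F 2] = c := by
  simp [tiltedModel, coframe_three_apply, inn]

theorem tiltedModel_ver (F : Basis (Fin 7) ℝ V) (c r : ℝ) :
    tiltedModel F c r ![ver F 0, ver F 1, ver F 2] = r := by
  simp [tiltedModel, coframe_three_apply, ver]

theorem tiltedModel_inn_inn_ver (F : Basis (Fin 7) ℝ V) (c r : ℝ) (i k : Fin 3) :
    tiltedModel F c r ![inn F (i + 1), inn F (i + 2), ver F k] = -r * if i = k then 1 else 0 := by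
  fin_cases i <;> fin_cases k <;>
    simp [tiltedModel, coframe_three_apply, inn, ver]

theorem tiltedModel_inn_ver_ver (F : Basis (Fin 7) ℝ V) (c r : ℝ) (i k : Fin 3) :
    tiltedModel F c r ![inn F k, ver F (i + 1), ver F (i + 2)] = -c * if k = i then 1 else 0 := by
  fin_cases i <;> fin_cases k <;>
    simp [tiltedModel, coframe_three_apply, inn, ver]

theorem tiltedModel_inn_ver (F : Basis (Fin 7) ℝ V) (c r : ℝ) (i k : Fin 3) :
    tiltedModel F c r ![F 3, inn F i, ver F k] = if i = k then 1 else 0 := by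
  fin_cases i <;> fin_cases k <;>
    simp [tiltedModel, coframe_three_apply, inn, ver]

theorem tiltedModel_inn_inn (F : Basis (Fin 7) ℝ V) (c r : ℝ) (i k : Fin 3) :
    tiltedModel F c r ![F 3, inn F i, inn F k] = 0 := by
  fin_cases i <;> fin_cases k <;>
    simp [tiltedModel, coframe_three_apply, inn]

theorem tiltedModel_ver_ver (F : Basis (Fin 7) ℝ V) (c r : ℝ) (i k : Fin 3) :
    tiltedModel F c r ![F 3, ver F i, ver F k] = 0 := by
  fin_cases i <;> fin_cases k <;>
    simp [tiltedModel, coframe_three_apply, ver]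

/-- Rotating an adapted basis in the plane of `e_1` and `e_7`, and reordering it so that `e_5`, `e_6`
and the rotated `e_7` come first. -/
theorem IsAdapted.exists_tilted {e : Basis (Fin 7) ℝ V} (he : S.IsAdapted e) {c r : ℝ}
    (hcr : c ^ 2 + r ^ 2 = 1) :
    ∃ F : Basis (Fin 7) ℝ V, S.IsOriented F ∧ S.φ = tiltedModel F c r ∧
      F 0 = e 4 ∧ F 1 = e 5 ∧ F 2 = c • e 6 + r • e 0 := by
  have hfo : ∀ i j, S.g ((![e 4, e 5, c • e 6 + r • e 0, e 1, e 3, e 2, -r • e 6 + c • e 0] :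
      Fin 7 → V) i) (![e 4, e 5, c • e 6 + r • e 0, e 1, e 3, e 2, -r • e 6 + c • e 0] j) =
      if i = j then 1 else 0 := by
    have h1 := he.1
    simp only [IsOrthonormal] at h1
    intro i j
    fin_cases i <;> fin_cases j <;> simp [h1] <;> nlinarith [hcr]
  obtain ⟨F, hF⟩ := S.exists_basis_of_orthonormal hfo
  have h0 : F 0 = e 4 := hF 0
  have h1 : F 1 = e 5 := hF 1
  have h2 : F 2 = c • e 6 + r • e 0 := hF 2
  have h3 : F 3 = e 1 := hF 3
  have h4 : F 4 = e 3 := hF 4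
  have h5 : F 5 = e 2 := hF 5
  have h6 : F 6 = -r • e 6 + c • e 0 := hF 6
  have ho : S.IsOrthonormal F := fun i j => by rw [hF, hF]; exact hfo i j
  refine ⟨F, ⟨ho, ?_⟩, ?_, h0, h1, h2⟩
  · -- expand the two rotated slots of the volume form
    set b : Fin 7 → V := ![e 4, e 5, 0, e 1, e 3, e 2, 0] with hb
    have hQ : ∀ u w, S.vol ![e 4, e 5, u, e 1, e 3, e 2, w] =
        S.vol (Function.update (Function.update b 2 u) 6 w) := by
      intro u w
      congr 1
      ext i
      fin_cases i <;> rfl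
    have hl : ∀ u u' w, S.vol ![e 4, e 5, c • u + r • u', e 1, e 3, e 2, w] =
        c * S.vol ![e 4, e 5, u, e 1, e 3, e 2, w] + r * S.vol ![e 4, e 5, u', e 1, e 3, e 2, w] := by
      intro u u' w
      simp only [hQ, fun u => Function.update_comm (show (2 : Fin 7) ≠ 6 by decide) u w b,
        AlternatingMap.map_update_add, AlternatingMap.map_update_smul, smul_eq_mul]
    have hr : ∀ u w w', S.vol ![e 4, e 5, u, e 1, e 3, e 2, -r • w + c • w'] =
        -r * S.vol ![e 4, e 5, u, e 1, e 3, e 2, w]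
          + c * S.vol ![e 4, e 5, u, e 1, e 3, e 2, w'] := by
      intro u w w'
      simp only [hQ, AlternatingMap.map_update_add, AlternatingMap.map_update_smul, smul_eq_mul]
    have hv : ∀ i j, S.vol ![e 4, e 5, e i, e 1, e 3, e 2, e j] =
        tupleSign ![4, 5, i, 1, 3, 2, j] := by
      intro i j
      rw [← he.isOriented.vol_apply]
      congr 1
      ext k
      fin_cases k <;> rfl
    have hF7 : (fun a => F a) = ![e 4, e 5, c • e 6 + r • e 0, e 1, e 3, e 2, -r • e 6 + c • e 0] :=
      funext hF
    rw [hF7, hl, hr, hr, hv, hv, hv, hv,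
      show tupleSign ![(4 : Fin 7), 5, 6, 1, 3, 2, 6] = 0 by decide,
      show tupleSign ![(4 : Fin 7), 5, 6, 1, 3, 2, 0] = 1 by decide,
      show tupleSign ![(4 : Fin 7), 5, 0, 1, 3, 2, 6] = -1 by decide,
      show tupleSign ![(4 : Fin 7), 5, 0, 1, 3, 2, 0] = 0 by decide]
    push_cast
    linear_combination hcr
  · rw [he.2]
    have g0 : ∀ x, e.repr x 0 = r * F.repr x 2 + c * F.repr x 6 := fun x => by
      rw [he.1.repr_eq, ho.repr_eq, ho.repr_eq, h2, h6]
      simp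
      linear_combination -S.g x (e 0) * hcr
    have g6 : ∀ x, e.repr x 6 = c * F.repr x 2 - r * F.repr x 6 := fun x => by
      rw [he.1.repr_eq, ho.repr_eq, ho.repr_eq, h2, h6]
      simp
      linear_combination -S.g x (e 6) * hcr
    have g4 : ∀ x, e.repr x 4 = F.repr x 0 := fun x => by rw [he.1.repr_eq, ho.repr_eq, h0]
    have g5 : ∀ x, e.repr x 5 = F.repr x 1 := fun x => by rw [he.1.repr_eq, ho.repr_eq, h1]
    have g1 : ∀ x, e.repr x 1 = F.repr x 3 := fun x => by rw [he.1.repr_eq, ho.repr_eq, h3]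
    have g3 : ∀ x, e.repr x 3 = F.repr x 4 := fun x => by rw [he.1.repr_eq, ho.repr_eq, h4]
    have g2 : ∀ x, e.repr x 2 = F.repr x 5 := fun x => by rw [he.1.repr_eq, ho.repr_eq, h5]
    ext v
    have hv : v = ![v 0, v 1, v 2] := by
      ext i
      fin_cases i <;> rfl
    rw [hv, phiModel_apply]
    simp only [g0, g1, g2, g3, g4, g5, g6, tiltedModel, AlternatingMap.add_apply,
      AlternatingMap.sub_apply, AlternatingMap.smul_apply, coframe_three_apply, smul_eq_mul]
    linear_combination -((F.repr (v 0) 2 * (F.repr (v 1) 3 * F.repr (v 2) 6 - F.repr (v 1) 6 * F.repr (v 2) 3)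
      - F.repr (v 0) 3 * (F.repr (v 1) 2 * F.repr (v 2) 6 - F.repr (v 1) 6 * F.repr (v 2) 2)
      + F.repr (v 0) 6 * (F.repr (v 1) 2 * F.repr (v 2) 3 - F.repr (v 1) 3 * F.repr (v 2) 2))) * hcr

end Blocks

end G2Structure

namespace G2Structure

section Blocks

variable {V : Type*} [AddCommGroup V] [Module ℝ V] {S : G2Structure V}

theorem IsOrthonormal.eq_sum_of_mem_span {e : Basis (Fin 7) ℝ V} (he : S.IsOrthonormal e)
    {n : ℕ} {I : Fin n → Fin 7} (hI : Function.Injective I) {x : V}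
    (hx : x ∈ Submodule.span ℝ (Set.range fun k => e (I k))) :
    x = ∑ k, S.g x (e (I k)) • e (I k) := by
  induction hx using Submodule.span_induction with
  | mem x hx =>
    obtain ⟨k, rfl⟩ := hx
    simp only [IsOrthonormal] at he
    simp [he, hI.eq_iff]
  | zero => simp
  | add x y _ _ hx hy =>
    conv_lhs => rw [hx, hy]
    simp [add_smul, Finset.sum_add_distrib]
  | smul c x _ hx =>
    conv_lhs => rw [hx]
    simp [Finset.smul_sum, smul_smul]

/-- A linear combination in the first slot of a four-form. -/
theorem form_four_sum_left {ι : Type*} (ω : Form V 4) (s : Finset ι) (c : ι → ℝ) (v : ι → V)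
    (x y z : V) : ω ![∑ k ∈ s, c k • v k, x, y, z] = ∑ k ∈ s, c k * ω ![v k, x, y, z] := by
  have h : ∀ u, ω ![u, x, y, z] = ω.curryLeft u ![x, y, z] := fun u => rfl
  simp only [h, map_sum, map_smul]
  rw [form_sum_apply]
  rfl

theorem form_four_zero_left (ω : Form V 4) (x y z : V) : ω ![0, x, y, z] = 0 :=
  ω.map_coord_zero 0 rfl

/-- A four-form with the last slot fixed, as a three-form. -/
theorem exists_three_form (ω : Form V 4) (w : V) :
    ∃ η : Form V 3, ∀ x y z, ω ![x, y, z, w] = η ![x, y, z] := by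
  refine ⟨-ω.curryLeft w, fun x y z => ?_⟩
  have h : ω ![x, y, z, w] = -ω ![w, x, y, z] := by
    have h1 := ω.map_perm ![w, x, y, z] (finRotate 4)
    rw [sign_finRotate] at h1
    have h2 : ![x, y, z, w] = ![w, x, y, z] ∘ finRotate 4 := by
      ext i
      fin_cases i <;> rfl
    rw [h2, h1]
    norm_num
  rw [h]
  rfl

/-- The value of `ψ = ⋆φ` on four basis vectors is that of `φ` on the complementary ones. -/
theorem IsOriented.psi_apply {L : Type*} [LieRing L] [LieAlgebra ℝ L] {S : G2Structure L}
    {F : Basis (Fin 7) ℝ L} (hF : S.IsOriented F)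
    (a b c i j k l : Fin 7) (hs : tupleSign ![a, b, c, i, j, k, l] = 1) :
    S.psi ![F i, F j, F k, F l] = S.φ ![F a, F b, F c] := by
  rw [psi, hF.star_three _ _ a b c i j k l hs]

end Blocks

variable {L : Type*} [LieRing L] [LieAlgebra ℝ L] {S : G2Structure L}

theorem IsOriented.psi_inn {F : Basis (Fin 7) ℝ L} (hF : S.IsOriented F) (i j k : Fin 3) :
    S.psi ![inn F i, inn F j, inn F k, F 3] = eps i j k * S.φ ![ver F 0, ver F 1, ver F 2] := by
  obtain ⟨η, hη⟩ := exists_three_form S.psi (F 3)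
  have h1 := hF.psi_apply 4 5 6 0 1 2 3 (by decide)
  rw [hη, form_eps, ← hη]
  simp only [inn, ver, Matrix.cons_val, h1]

theorem IsOriented.psi_inn_ver {F : Basis (Fin 7) ℝ L} (hF : S.IsOriented F) {c r : ℝ}
    (hφ : S.φ = tiltedModel F c r) (i j k l : Fin 3) :
    S.psi ![inn F i, inn F j, inn F k, ver F l] = 0 := by
  obtain ⟨η, hη⟩ := exists_three_form S.psi (ver F l)
  have h1 : S.psi ![inn F 0, inn F 1, inn F 2, ver F l] = S.φ ![F 3, ver F (l + 2), ver F (l + 1)] := by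
    have h2 := hF.psi_apply 3 (![4, 5, 6] (l + 2)) (![4, 5, 6] (l + 1)) (![0, 1, 2] 0)
      (![0, 1, 2] 1) (![0, 1, 2] 2) (![4, 5, 6] l) (by clear hη; revert l; decide)
    simp only [inn, ver]
    rw [h2]
  rw [hη, form_eps, ← hη, h1, hφ, tiltedModel_ver_ver, mul_zero]

theorem IsOriented.psi_inn_inn_ver_ver {F : Basis (Fin 7) ℝ L} (hF : S.IsOriented F) {c r : ℝ}
    (hφ : S.φ = tiltedModel F c r) (i j l : Fin 3) :
    S.psi ![inn F i, inn F j, ver F (l + 1), ver F (l + 2)] = -eps i j l := by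
  obtain ⟨η, hη⟩ := exists_three_form S.psi (ver F (l + 2))
  have h1 : ∀ k, S.psi ![inn F (k + 1), inn F (k + 2), ver F (l + 1), ver F (l + 2)] =
      S.φ ![inn F k, F 3, ver F l] := by
    intro k
    have h2 := hF.psi_apply (![0, 1, 2] k) 3 (![4, 5, 6] l) (![0, 1, 2] (k + 1)) (![0, 1, 2] (k + 2))
      (![4, 5, 6] (l + 1)) (![4, 5, 6] (l + 2)) (by clear hη; revert k l; decide)
    simp only [inn, ver]
    rw [h2]
  rw [hη, form_eps_left]
  simp only [← hη, h1, hφ, form_swap_left _ (F 3), tiltedModel_inn_ver]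
  simp

/-- A basis in which `φ` is the tilted model, the first three vectors span a central subspace that
contains all brackets, and the only brackets are `[e_4, e_{j+4}] = ∑_k P_{kj} e_k`. -/
structure IsTiltedFrame (S : G2Structure L) (F : Basis (Fin 7) ℝ L) (c r : ℝ)
    (P : Fin 3 → Fin 3 → ℝ) : Prop where
  oriented : S.IsOriented F
  phi : S.φ = tiltedModel F c r
  norm : c ^ 2 + r ^ 2 = 1
  lie_inn : ∀ (k : Fin 3) (v : L), ⁅inn F k, v⁆ = 0
  lie_ver : ∀ i j, ⁅ver F i, ver F j⁆ = 0
  lie_three : ∀ j, ⁅F 3, ver F j⁆ = ∑ k, P k j • inn F k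
  symm : ∀ i j, P j i = P i j

/-- Coclosedness determines the brackets for a commutator that is not closed under the cross
product: evaluating `dψ` shows that `F_5, F_6, F_7` commute and that `P` is symmetric. -/
theorem IsOriented.exists_isTiltedFrame {F : Basis (Fin 7) ℝ L} (hF : S.IsOriented F) {c r : ℝ}
    (hφ : S.φ = tiltedModel F c r) (hcr : c ^ 2 + r ^ 2 = 1) (hr : r ≠ 0) (hS : S.IsCoclosed)
    (hz : ∀ (k : Fin 3) (v : L), ⁅inn F k, v⁆ = 0)
    (hb : ∀ x y : L, ⁅x, y⁆ ∈ Submodule.span ℝ (Set.range (inn F))) :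
    ∃ P, S.IsTiltedFrame F c r P := by
  have hb' : ∀ x y : L, ⁅x, y⁆ = ∑ k, S.g ⁅x, y⁆ (inn F k) • inn F k := fun x y =>
    hF.1.eq_sum_of_mem_span (I := ![0, 1, 2]) (by decide) (hb x y)
  have hz' : ∀ (k : Fin 3) (v : L), ⁅v, inn F k⁆ = 0 := fun k v => by
    rw [← lie_skew, hz, neg_zero]
  have hd : ∀ a b c d e : L, ceDiff S.psi ![a, b, c, d, e] = 0 := fun a b c d e => by
    rw [hS]
    rfl
  have h1 : ∀ i j, ⁅ver F i, ver F j⁆ = 0 := by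
    intro i j
    have h2 : ∀ k, S.g ⁅ver F i, ver F j⁆ (inn F k) = 0 := by
      intro k
      have h3 := hd (inn F (k + 1)) (inn F (k + 2)) (F 3) (ver F i) (ver F j)
      rw [ceDiff_apply_five] at h3
      have h4 : ∀ i j, S.psi ![⁅F 3, ver F i⁆, inn F (k + 1), inn F (k + 2), ver F j] = 0 := by
        intro i j
        rw [hb', form_four_sum_left]
        simp [hF.psi_inn_ver hφ]
      have h5 : S.psi ![⁅ver F i, ver F j⁆, inn F (k + 1), inn F (k + 2), F 3] =
          S.g ⁅ver F i, ver F j⁆ (inn F k) * r := by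
        rw [hb', form_four_sum_left]
        simp only [hF.psi_inn, hφ, tiltedModel_ver]
        rw [← hb']
        fin_cases k <;> simp [Fin.sum_univ_three, eps]
      simp only [hz, form_four_zero_left, h4, h5] at h3
      simpa [hr] using h3
    rw [hb']
    simp [h2]
  refine ⟨fun k j => S.g ⁅F 3, ver F j⁆ (inn F k), hF, hφ, hcr, hz, h1, fun j => hb' _ _, ?_⟩
  have h2 : ∀ a, ∑ k, ∑ j, eps k a j * S.g ⁅F 3, ver F j⁆ (inn F k) = 0 := by
    intro a
    have h3 := hd (inn F a) (F 3) (ver F 0) (ver F 1) (ver F 2)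
    rw [ceDiff_apply_five] at h3
    have h4 : ∀ j, S.psi ![⁅F 3, ver F j⁆, inn F a, ver F (j + 1), ver F (j + 2)] =
        -∑ k, eps k a j * S.g ⁅F 3, ver F j⁆ (inn F k) := by
      intro j
      rw [hb', form_four_sum_left]
      simp only [hF.psi_inn_inn_ver_ver hφ]
      rw [← hb', ← Finset.sum_neg_distrib]
      exact Finset.sum_congr rfl fun k _ => by ring
    have h5 : S.psi ![⁅F 3, ver F 1⁆, inn F a, ver F 0, ver F 2] =
        -S.psi ![⁅F 3, ver F 1⁆, inn F a, ver F 2, ver F 0] := by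
      rw [← S.psi.map_swap ![⁅F 3, ver F 1⁆, inn F a, ver F 2, ver F 0] (i := 2) (j := 3)
        (by decide)]
      congr 1
      ext i
      fin_cases i <;> rfl
    have h40 := h4 0
    have h41 := h4 1
    have h42 := h4 2
    simp only [hz, h1, form_four_zero_left, h5] at h3
    rw [Finset.sum_comm, Fin.sum_univ_three]
    simp only [Fin.isValue, show (0 : Fin 3) + 1 = 1 from rfl, show (0 : Fin 3) + 2 = 2 from rfl,
      show (1 : Fin 3) + 1 = 2 from rfl, show (1 : Fin 3) + 2 = 0 from rfl,
      show (2 : Fin 3) + 1 = 0 from rfl, show (2 : Fin 3) + 2 = 1 from rfl] at h40 h41 h42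
    linarith
  intro i j
  have h20 := h2 0
  have h21 := h2 1
  have h22 := h2 2
  simp [Fin.sum_univ_three, eps] at h20 h21 h22
  fin_cases i <;> fin_cases j <;> simp <;> linarith

namespace IsTiltedFrame

variable {F : Basis (Fin 7) ℝ L} {c r : ℝ} {P : Fin 3 → Fin 3 → ℝ}

theorem phi_inn (h : S.IsTiltedFrame F c r P) (i j k : Fin 3) :
    S.φ ![inn F i, inn F j, inn F k] = c * eps i j k := by
  rw [form_eps, h.phi, tiltedModel_inn, mul_comm]

theorem phi_ver (h : S.IsTiltedFrame F c r P) (i j k : Fin 3) :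
    S.φ ![ver F i, ver F j, ver F k] = r * eps i j k := by
  rw [form_eps, h.phi, tiltedModel_ver, mul_comm]

theorem phi_inn_inn_ver (h : S.IsTiltedFrame F c r P) (i j k : Fin 3) :
    S.φ ![inn F i, inn F j, ver F k] = -r * eps i j k := by
  rw [form_eps_left]
  simp only [h.phi, tiltedModel_inn_inn_ver]
  simp [mul_comm]

theorem phi_inn_ver_ver (h : S.IsTiltedFrame F c r P) (i j k : Fin 3) :
    S.φ ![inn F i, ver F j, ver F k] = -c * eps j k i := by
  rw [form_eps_right]
  simp only [h.phi, tiltedModel_inn_ver_ver]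
  simp [mul_comm]

theorem phi_three_inn_ver (h : S.IsTiltedFrame F c r P) (i j : Fin 3) :
    S.φ ![F 3, inn F i, ver F j] = if i = j then 1 else 0 := by
  rw [h.phi, tiltedModel_inn_ver]

theorem phi_three_ver_ver (h : S.IsTiltedFrame F c r P) (i j : Fin 3) :
    S.φ ![F 3, ver F i, ver F j] = 0 := by
  rw [h.phi, tiltedModel_ver_ver]

theorem phi_three_inn_inn (h : S.IsTiltedFrame F c r P) (i j : Fin 3) :
    S.φ ![F 3, inn F i, inn F j] = 0 := by
  rw [h.phi, tiltedModel_inn_inn]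

theorem lie_inn_right (h : S.IsTiltedFrame F c r P) (k : Fin 3) (v : L) : ⁅v, inn F k⁆ = 0 := by
  rw [← lie_skew, h.lie_inn, neg_zero]

theorem dphi_three_inn (h : S.IsTiltedFrame F c r P) (i j k : Fin 3) :
    ceDiff S.φ ![F 3, inn F i, inn F j, inn F k] = 0 := by
  rw [ceDiff_apply_four]
  simp only [h.lie_inn, h.lie_inn_right, form_zero_left]
  simp

theorem dphi_three_inn_inn_ver (h : S.IsTiltedFrame F c r P) (i j k : Fin 3) :
    ceDiff S.φ ![F 3, inn F i, inn F j, ver F k] = -c * ∑ l, eps i j l * P l k := by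
  rw [ceDiff_apply_four]
  simp only [h.lie_inn, h.lie_inn_right, form_zero_left, h.lie_three, form_sum_left, h.phi_inn]
  fin_cases i <;> fin_cases j <;> simp [Fin.sum_univ_three, eps] <;> ring

theorem dphi_three_inn_ver_ver (h : S.IsTiltedFrame F c r P) (i j k : Fin 3) :
    ceDiff S.φ ![F 3, inn F i, ver F j, ver F k] =
      r * ∑ l, (P l k * eps l i j - P l j * eps l i k) := by
  rw [ceDiff_apply_four]
  simp only [h.lie_inn, h.lie_inn_right, h.lie_ver, form_zero_left, h.lie_three, form_sum_left,
    h.phi_inn_inn_ver]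
  simp only [Fin.sum_univ_three]
  ring

theorem dphi_three_ver (h : S.IsTiltedFrame F c r P) :
    ceDiff S.φ ![F 3, ver F 0, ver F 1, ver F 2] = c * (P 0 0 + P 1 1 + P 2 2) := by
  rw [ceDiff_apply_four]
  simp only [h.lie_ver, form_zero_left, h.lie_three, form_sum_left, h.phi_inn_ver_ver]
  simp [Fin.sum_univ_three, eps]
  ring

theorem dphi_inn_inn_ver_ver (h : S.IsTiltedFrame F c r P) (i j k l : Fin 3) :
    ceDiff S.φ ![inn F i, inn F j, ver F k, ver F l] = 0 := by
  rw [ceDiff_apply_four]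
  simp only [h.lie_inn, h.lie_ver, form_zero_left]
  simp

theorem dphi_inn_ver (h : S.IsTiltedFrame F c r P) (i j k l : Fin 3) :
    ceDiff S.φ ![inn F i, ver F j, ver F k, ver F l] = 0 := by
  rw [ceDiff_apply_four]
  simp only [h.lie_inn, h.lie_ver, form_zero_left]
  simp

theorem dphi_inn_inn_inn (h : S.IsTiltedFrame F c r P) (i j k l : Fin 3) :
    ceDiff S.φ ![inn F i, inn F j, inn F k, ver F l] = 0 := by
  rw [ceDiff_apply_four]
  simp only [h.lie_inn, form_zero_left]
  simp

end IsTiltedFrame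

end G2Structure

/-! ### The torsion of a tilted frame -/

namespace G2Structure

variable {L : Type*} [LieRing L] [LieAlgebra ℝ L] {S : G2Structure L}

namespace IsTiltedFrame

variable {F : Basis (Fin 7) ℝ L} {c r : ℝ} {P : Fin 3 → Fin 3 → ℝ}

theorem dphi_wedge_phi (h : S.IsTiltedFrame F c r P) :
    wedge (ceDiff S.φ) S.φ (fun x : Fin (4 + 3) => F x) = 2 * (P 0 0 + P 1 1 + P 2 2) := by
  have hw : wedge (ceDiff S.φ) S.φ = wedge (ceDiff S.φ) (tiltedModel F c r) := by rw [← h.phi]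
  have h0 := h.dphi_three_ver
  have h1 := h.dphi_three_inn_ver_ver 2 1 0
  have h2 := h.dphi_three_inn_ver_ver 1 2 0
  have h3 := h.dphi_three_inn_ver_ver 0 2 1
  have h4 := h.dphi_three_inn_inn_ver 1 2 0
  have h5 := h.dphi_three_inn_inn_ver 0 2 1
  have h6 := h.dphi_three_inn_inn_ver 0 1 2
  have h7 := h.dphi_three_inn 0 2 1
  have h8 := h.dphi_inn_inn_ver_ver 1 2 1 2
  have h9 := h.dphi_inn_inn_ver_ver 0 2 0 2
  have h10 := h.dphi_inn_inn_ver_ver 0 1 0 1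
  simp only [inn, ver, Matrix.cons_val] at h0 h1 h2 h3 h4 h5 h6 h7 h8 h9 h10
  rw [hw, tiltedModel]
  simp only [wedge_add_right, wedge_sub_right, wedge_smul_right, AlternatingMap.add_apply,
    AlternatingMap.sub_apply, AlternatingMap.smul_apply]
  rw [wedge_coframe_top F _ 3 4 5 6 0 1 2 (by decide),
    wedge_coframe_top F _ 3 2 5 4 0 1 6 (by decide),
    wedge_coframe_top F _ 3 1 6 4 0 2 5 (by decide),
    wedge_coframe_top F _ 1 2 5 6 0 3 4 (by decide),
    wedge_coframe_top F _ 3 1 2 4 0 5 6 (by decide),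
    wedge_coframe_top F _ 3 0 6 5 1 2 4 (by decide),
    wedge_coframe_top F _ 0 2 4 6 1 3 5 (by decide),
    wedge_coframe_top F _ 3 0 2 5 1 4 6 (by decide),
    wedge_coframe_top F _ 0 1 4 5 2 3 6 (by decide),
    wedge_coframe_top F _ 3 0 1 6 2 4 5 (by decide),
    wedge_coframe_top F _ 3 0 2 1 4 5 6 (by decide), h0, h1, h2, h3, h4, h5, h6, h7, h8, h9, h10]
  simp [Fin.sum_univ_three, eps]
  linear_combination (2 * (P 0 0 + P 1 1 + P 2 2)) * h.norm

theorem torsion_apply (h : S.IsTiltedFrame F c r P) (a b d f i j k : Fin 7)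
    (hs : tupleSign ![a, b, d, f, i, j, k] = 1) :
    S.torsion ![F i, F j, F k] = (P 0 0 + P 1 1 + P 2 2) / 3 * S.φ ![F i, F j, F k]
      - ceDiff S.φ ![F a, F b, F d, F f] := by
  rw [h.oriented.torsion_apply a b d f i j k hs, h.dphi_wedge_phi]
  ring

theorem torsion_inn (h : S.IsTiltedFrame F c r P) (i j k : Fin 3) :
    S.torsion ![inn F i, inn F j, inn F k] =
      -2 / 3 * c * (P 0 0 + P 1 1 + P 2 2) * eps i j k := by
  have h1 := h.torsion_apply 3 4 5 6 0 1 2 (by decide)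
  have h2 := h.phi_inn 0 1 2
  have h3 := h.dphi_three_ver
  rw [form_eps]
  simp only [inn, ver, Matrix.cons_val] at h1 h2 h3 ⊢
  rw [h1, h2, h3]
  simp [eps]
  ring

theorem torsion_ver (h : S.IsTiltedFrame F c r P) (i j k : Fin 3) :
    S.torsion ![ver F i, ver F j, ver F k] = r * (P 0 0 + P 1 1 + P 2 2) / 3 * eps i j k := by
  have h1 := h.torsion_apply 3 0 2 1 4 5 6 (by decide)
  have h2 := h.phi_ver 0 1 2
  have h3 := h.dphi_three_inn 0 2 1
  rw [form_eps]
  simp only [inn, ver, Matrix.cons_val] at h1 h2 h3 ⊢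
  rw [h1, h2, h3]
  simp [eps]
  ring

theorem torsion_inn_inn_ver (h : S.IsTiltedFrame F c r P) (i j k : Fin 3) :
    S.torsion ![inn F i, inn F j, ver F k] =
      r * (2 / 3 * (P 0 0 + P 1 1 + P 2 2) * eps i j k - ∑ l, eps i j l * P l k) := by
  have key : ∀ l, S.torsion ![inn F (l + 1), inn F (l + 2), ver F k] =
      r * (2 / 3 * (P 0 0 + P 1 1 + P 2 2) * (if l = k then 1 else 0) - P l k) := by
    intro l
    have h1 := h.torsion_apply 3 (![0, 1, 2] l) (![4, 5, 6] (k + 2)) (![4, 5, 6] (k + 1))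
      (![0, 1, 2] (l + 1)) (![0, 1, 2] (l + 2)) (![4, 5, 6] k) (by revert l k; decide)
    have h2 := h.phi_inn_inn_ver (l + 1) (l + 2) k
    have h3 := h.dphi_three_inn_ver_ver l (k + 2) (k + 1)
    simp only [inn, ver] at h1 h2 h3 ⊢
    rw [h1, h2, h3]
    clear h1 h2 h3
    fin_cases l <;> fin_cases k <;> simp [Fin.sum_univ_three, eps, h.symm 0 1, h.symm 0 2, h.symm 1 2] <;>
      ring
  rw [form_eps_left]
  simp only [key]
  simp only [Fin.sum_univ_three]
  fin_cases k <;> simp <;> ring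

theorem torsion_inn_ver_ver (h : S.IsTiltedFrame F c r P) (i j k : Fin 3) :
    S.torsion ![inn F i, ver F j, ver F k] =
      c * (∑ l, eps j k l * P i l - (P 0 0 + P 1 1 + P 2 2) / 3 * eps j k i) := by
  have key : ∀ l, S.torsion ![inn F i, ver F (l + 1), ver F (l + 2)] =
      c * (P i l - (P 0 0 + P 1 1 + P 2 2) / 3 * (if l = i then 1 else 0)) := by
    intro l
    have h1 := h.torsion_apply 3 (![0, 1, 2] (i + 1)) (![0, 1, 2] (i + 2)) (![4, 5, 6] l)
      (![0, 1, 2] i) (![4, 5, 6] (l + 1)) (![4, 5, 6] (l + 2)) (by revert l i; decide)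
    have h2 := h.phi_inn_ver_ver i (l + 1) (l + 2)
    have h3 := h.dphi_three_inn_inn_ver (i + 1) (i + 2) l
    simp only [inn, ver] at h1 h2 h3 ⊢
    rw [h1, h2, h3]
    clear h1 h2 h3
    fin_cases l <;> fin_cases i <;> simp [Fin.sum_univ_three, eps] <;> ring
  rw [form_eps_right]
  simp only [key]
  simp only [Fin.sum_univ_three]
  fin_cases i <;> simp <;> ring

theorem torsion_three_inn_ver (h : S.IsTiltedFrame F c r P) (i j : Fin 3) :
    S.torsion ![F 3, inn F i, ver F j] =
      (P 0 0 + P 1 1 + P 2 2) / 3 * if i = j then 1 else 0 := by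
  have h1 := h.torsion_apply (![0, 1, 2] (i + 2)) (![0, 1, 2] (i + 1)) (![4, 5, 6] (j + 1))
    (![4, 5, 6] (j + 2)) 3 (![0, 1, 2] i) (![4, 5, 6] j) (by revert j i; decide)
  have h2 := h.phi_three_inn_ver i j
  have h3 := h.dphi_inn_inn_ver_ver (i + 2) (i + 1) (j + 1) (j + 2)
  simp only [inn, ver] at h1 h2 h3 ⊢
  rw [h1, h2, h3, sub_zero]

theorem torsion_three_inn_inn (h : S.IsTiltedFrame F c r P) (i j : Fin 3) :
    S.torsion ![F 3, inn F i, inn F j] = 0 := by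
  have key : ∀ l, S.torsion ![F 3, inn F (l + 1), inn F (l + 2)] = 0 := by
    intro l
    have h1 := h.torsion_apply (![0, 1, 2] l) (![4, 5, 6] 0) (![4, 5, 6] 1) (![4, 5, 6] 2) 3
      (![0, 1, 2] (l + 2)) (![0, 1, 2] (l + 1)) (by revert l; decide)
    have h2 := h.phi_three_inn_inn (l + 2) (l + 1)
    have h3 := h.dphi_inn_ver l 0 1 2
    rw [form_swap_right]
    simp only [inn, ver] at h1 h2 h3 ⊢
    rw [h1, h2, h3]
    simp
  rw [form_eps_right]
  simp [key]

theorem torsion_three_ver_ver (h : S.IsTiltedFrame F c r P) (i j : Fin 3) :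
    S.torsion ![F 3, ver F i, ver F j] = 0 := by
  have key : ∀ l, S.torsion ![F 3, ver F (l + 1), ver F (l + 2)] = 0 := by
    intro l
    have h1 := h.torsion_apply (![0, 1, 2] 0) (![0, 1, 2] 1) (![0, 1, 2] 2) (![4, 5, 6] l) 3
      (![4, 5, 6] (l + 2)) (![4, 5, 6] (l + 1)) (by revert l; decide)
    have h2 := h.phi_three_ver_ver (l + 2) (l + 1)
    have h3 := h.dphi_inn_inn_inn 0 1 2 l
    rw [form_swap_right]
    simp only [inn, ver] at h1 h2 h3 ⊢
    rw [h1, h2, h3]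
    simp
  rw [form_eps_right]
  simp [key]

end IsTiltedFrame

end G2Structure

/-! ### The connection of a tilted frame -/

namespace G2Structure

section Blocks

variable {V : Type*} [AddCommGroup V] [Module ℝ V] {S : G2Structure V}

theorem sum_inn_add_sum_ver (F : Basis (Fin 7) ℝ V) (f : V → ℝ) :
    ∑ m, f (F m) = ∑ a, f (inn F a) + f (F 3) + ∑ k, f (ver F k) := by
  simp only [Fin.sum_univ_seven, Fin.sum_univ_three, inn, ver, Matrix.cons_val]
  ring

theorem IsOrthonormal.g_inn_inn {F : Basis (Fin 7) ℝ V} (hF : S.IsOrthonormal F) (i j : Fin 3) :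
    S.g (inn F i) (inn F j) = if i = j then 1 else 0 := by
  rw [inn, inn, hF]
  fin_cases i <;> fin_cases j <;> simp

theorem IsOrthonormal.g_inn_ver {F : Basis (Fin 7) ℝ V} (hF : S.IsOrthonormal F) (i j : Fin 3) :
    S.g (inn F i) (ver F j) = 0 := by
  rw [inn, ver, hF]
  fin_cases i <;> fin_cases j <;> simp

theorem IsOrthonormal.g_inn_three {F : Basis (Fin 7) ℝ V} (hF : S.IsOrthonormal F) (i : Fin 3) :
    S.g (inn F i) (F 3) = 0 := by
  rw [inn, hF]
  fin_cases i <;> simp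

end Blocks

variable {L : Type*} [LieRing L] [LieAlgebra ℝ L] {S : G2Structure L}

namespace IsTiltedFrame

variable {F : Basis (Fin 7) ℝ L} {c r : ℝ} {P : Fin 3 → Fin 3 → ℝ}

theorem g_lie_inn (h : S.IsTiltedFrame F c r P) (i j : Fin 3) :
    S.g ⁅F 3, ver F j⁆ (inn F i) = P i j := by
  rw [h.lie_three]
  simp [h.oriented.1.g_inn_inn]

theorem g_lie_ver (h : S.IsTiltedFrame F c r P) (i j : Fin 3) :
    S.g ⁅F 3, ver F j⁆ (ver F i) = 0 := by
  rw [h.lie_three]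
  simp [h.oriented.1.g_inn_ver]

theorem g_lie_three (h : S.IsTiltedFrame F c r P) (j : Fin 3) :
    S.g ⁅F 3, ver F j⁆ (F 3) = 0 := by
  rw [h.lie_three]
  simp [h.oriented.1.g_inn_three]

theorem g_lie_inn' (h : S.IsTiltedFrame F c r P) (i j : Fin 3) :
    S.g ⁅ver F j, F 3⁆ (inn F i) = -P i j := by
  rw [← lie_skew, map_neg, LinearMap.neg_apply, h.g_lie_inn]

theorem g_lie_ver' (h : S.IsTiltedFrame F c r P) (i j : Fin 3) :
    S.g ⁅ver F j, F 3⁆ (ver F i) = 0 := by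
  rw [← lie_skew, map_neg, LinearMap.neg_apply, h.g_lie_ver, neg_zero]

theorem g_lie_three' (h : S.IsTiltedFrame F c r P) (j : Fin 3) :
    S.g ⁅ver F j, F 3⁆ (F 3) = 0 := by
  rw [← lie_skew, map_neg, LinearMap.neg_apply, h.g_lie_three, neg_zero]

variable (lam : ℝ)

theorem conn_three_inn_ver (h : S.IsTiltedFrame F c r P) (i j : Fin 3) :
    S.conn lam (F 3) (inn F i) (ver F j) =
      -P i j / 2 + lam / 6 * (P 0 0 + P 1 1 + P 2 2) * if i = j then 1 else 0 := by
  rw [conn_eq, h.torsion_three_inn_ver, h.lie_inn_right, h.lie_inn_right]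
  simp [h.g_lie_inn']
  ring_nf

theorem conn_inn_three_ver (h : S.IsTiltedFrame F c r P) (i j : Fin 3) :
    S.conn lam (inn F i) (F 3) (ver F j) =
      -P i j / 2 - lam / 6 * (P 0 0 + P 1 1 + P 2 2) * if i = j then 1 else 0 := by
  have ht : S.torsion ![inn F i, F 3, ver F j] = -S.torsion ![F 3, inn F i, ver F j] :=
    form_swap_left _ _ _ _
  rw [conn_eq, ht, h.torsion_three_inn_ver, h.lie_inn_right, h.lie_inn]
  simp [h.g_lie_inn']
  ring_nf

theorem conn_ver_three_inn (h : S.IsTiltedFrame F c r P) (i j : Fin 3) :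
    S.conn lam (ver F j) (F 3) (inn F i) =
      -P i j / 2 + lam / 6 * (P 0 0 + P 1 1 + P 2 2) * if i = j then 1 else 0 := by
  have ht : S.torsion ![ver F j, F 3, inn F i] = S.torsion ![F 3, inn F i, ver F j] := by
    rw [form_swap_left, form_swap_right, neg_neg]
  rw [conn_eq, ht, h.torsion_three_inn_ver, h.lie_inn, h.lie_inn]
  simp [h.g_lie_inn']
  ring_nf

theorem conn_three_inn_inn (h : S.IsTiltedFrame F c r P) (i j : Fin 3) :
    S.conn lam (F 3) (inn F i) (inn F j) = 0 := by
  rw [conn_eq, h.torsion_three_inn_inn, h.lie_inn, h.lie_inn, h.lie_inn_right]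
  simp

theorem conn_three_ver_ver (h : S.IsTiltedFrame F c r P) (i j : Fin 3) :
    S.conn lam (F 3) (ver F i) (ver F j) = 0 := by
  rw [conn_eq, h.torsion_three_ver_ver, h.lie_ver]
  simp [h.g_lie_ver, h.g_lie_ver']

theorem conn_three_three_inn (h : S.IsTiltedFrame F c r P) (i : Fin 3) :
    S.conn lam (F 3) (F 3) (inn F i) = 0 := by
  have ht : S.torsion ![F 3, F 3, inn F i] = 0 :=
    S.torsion.map_eq_zero_of_eq _ (i := 0) (j := 1) rfl (by decide)
  rw [conn_eq, ht, h.lie_inn, lie_self]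
  simp

theorem conn_three_three_ver (h : S.IsTiltedFrame F c r P) (i : Fin 3) :
    S.conn lam (F 3) (F 3) (ver F i) = 0 := by
  have ht : S.torsion ![F 3, F 3, ver F i] = 0 :=
    S.torsion.map_eq_zero_of_eq _ (i := 0) (j := 1) rfl (by decide)
  rw [conn_eq, ht, lie_self]
  simp [h.g_lie_three']

theorem conn_inn_three_inn (h : S.IsTiltedFrame F c r P) (i j : Fin 3) :
    S.conn lam (inn F i) (F 3) (inn F j) = 0 := by
  have ht : S.torsion ![inn F i, F 3, inn F j] = -S.torsion ![F 3, inn F i, inn F j] :=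
    form_swap_left _ _ _ _
  rw [conn_eq, ht, h.torsion_three_inn_inn, h.lie_inn, h.lie_inn, h.lie_inn]
  simp

theorem conn_ver_three_ver (h : S.IsTiltedFrame F c r P) (i j : Fin 3) :
    S.conn lam (ver F i) (F 3) (ver F j) = 0 := by
  have ht : S.torsion ![ver F i, F 3, ver F j] = -S.torsion ![F 3, ver F i, ver F j] :=
    form_swap_left _ _ _ _
  rw [conn_eq, ht, h.torsion_three_ver_ver, h.lie_ver]
  simp [h.g_lie_ver']

theorem conn_inn_inn_inn (h : S.IsTiltedFrame F c r P) (i j k : Fin 3) :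
    S.conn lam (inn F i) (inn F j) (inn F k) =
      -lam / 3 * c * (P 0 0 + P 1 1 + P 2 2) * eps i j k := by
  rw [conn_eq, h.torsion_inn, h.lie_inn, h.lie_inn, h.lie_inn]
  simp
  ring

theorem conn_inn_inn_ver (h : S.IsTiltedFrame F c r P) (i j k : Fin 3) :
    S.conn lam (inn F i) (inn F j) (ver F k) = lam / 2 *
      (r * (2 / 3 * (P 0 0 + P 1 1 + P 2 2) * eps i j k - ∑ l, eps i j l * P l k)) := by
  rw [conn_eq, h.torsion_inn_inn_ver, h.lie_inn, h.lie_inn_right, h.lie_inn_right]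
  simp

theorem conn_inn_ver_inn (h : S.IsTiltedFrame F c r P) (i j k : Fin 3) :
    S.conn lam (inn F i) (ver F k) (inn F j) = -(lam / 2 *
      (r * (2 / 3 * (P 0 0 + P 1 1 + P 2 2) * eps i j k - ∑ l, eps i j l * P l k))) := by
  rw [conn_skew, h.conn_inn_inn_ver]

theorem conn_ver_inn_inn (h : S.IsTiltedFrame F c r P) (i j k : Fin 3) :
    S.conn lam (ver F k) (inn F i) (inn F j) = lam / 2 *
      (r * (2 / 3 * (P 0 0 + P 1 1 + P 2 2) * eps i j k - ∑ l, eps i j l * P l k)) := by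
  have ht : S.torsion ![ver F k, inn F i, inn F j] = S.torsion ![inn F i, inn F j, ver F k] := by
    rw [form_swap_left, form_swap_right, neg_neg]
  rw [conn_eq, ht, h.torsion_inn_inn_ver, h.lie_inn, h.lie_inn, h.lie_inn_right]
  simp

theorem conn_inn_ver_ver (h : S.IsTiltedFrame F c r P) (i j k : Fin 3) :
    S.conn lam (inn F i) (ver F j) (ver F k) = lam / 2 *
      (c * (∑ l, eps j k l * P i l - (P 0 0 + P 1 1 + P 2 2) / 3 * eps j k i)) := by
  rw [conn_eq, h.torsion_inn_ver_ver, h.lie_inn, h.lie_ver, h.lie_inn_right]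
  simp

theorem conn_ver_inn_ver (h : S.IsTiltedFrame F c r P) (i j k : Fin 3) :
    S.conn lam (ver F j) (inn F i) (ver F k) = -(lam / 2 *
      (c * (∑ l, eps j k l * P i l - (P 0 0 + P 1 1 + P 2 2) / 3 * eps j k i))) := by
  have ht : S.torsion ![ver F j, inn F i, ver F k] = -S.torsion ![inn F i, ver F j, ver F k] :=
    form_swap_left _ _ _ _
  rw [conn_eq, ht, h.torsion_inn_ver_ver, h.lie_inn_right, h.lie_ver, h.lie_inn_right]
  simp

theorem conn_ver_ver_inn (h : S.IsTiltedFrame F c r P) (i j k : Fin 3) :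
    S.conn lam (ver F j) (ver F k) (inn F i) = lam / 2 *
      (c * (∑ l, eps j k l * P i l - (P 0 0 + P 1 1 + P 2 2) / 3 * eps j k i)) := by
  rw [conn_skew, h.conn_ver_inn_ver, neg_neg]

theorem conn_ver_ver_ver (h : S.IsTiltedFrame F c r P) (i j k : Fin 3) :
    S.conn lam (ver F i) (ver F j) (ver F k) =
      lam / 6 * r * (P 0 0 + P 1 1 + P 2 2) * eps i j k := by
  rw [conn_eq, h.torsion_ver, h.lie_ver, h.lie_ver, h.lie_ver]
  simp
  ring

theorem conn_three_ver_inn (h : S.IsTiltedFrame F c r P) (i j : Fin 3) :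
    S.conn lam (F 3) (ver F j) (inn F i) = -(
      -P i j / 2 + lam / 6 * (P 0 0 + P 1 1 + P 2 2) * if i = j then 1 else 0) := by
  rw [conn_skew, h.conn_three_inn_ver]

theorem conn_inn_ver_three (h : S.IsTiltedFrame F c r P) (i j : Fin 3) :
    S.conn lam (inn F i) (ver F j) (F 3) = -(
      -P i j / 2 - lam / 6 * (P 0 0 + P 1 1 + P 2 2) * if i = j then 1 else 0) := by
  rw [conn_skew, h.conn_inn_three_ver]

theorem conn_ver_inn_three (h : S.IsTiltedFrame F c r P) (i j : Fin 3) :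
    S.conn lam (ver F j) (inn F i) (F 3) = -(
      -P i j / 2 + lam / 6 * (P 0 0 + P 1 1 + P 2 2) * if i = j then 1 else 0) := by
  rw [conn_skew, h.conn_ver_three_inn]

theorem conn_inn_inn_three (h : S.IsTiltedFrame F c r P) (i j : Fin 3) :
    S.conn lam (inn F i) (inn F j) (F 3) = 0 := by
  rw [conn_skew, h.conn_inn_three_inn, neg_zero]

theorem conn_ver_ver_three (h : S.IsTiltedFrame F c r P) (i j : Fin 3) :
    S.conn lam (ver F i) (ver F j) (F 3) = 0 := by
  rw [conn_skew, h.conn_ver_three_ver, neg_zero]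

theorem conn_self (S : G2Structure L) (x w : L) : S.conn lam x w w = 0 := by
  linarith [S.conn_skew lam x w w]

theorem conn_lie_three (h : S.IsTiltedFrame F c r P) (j : Fin 3) (w z : L) :
    S.conn lam ⁅F 3, ver F j⁆ w z = ∑ k, P k j * S.conn lam (inn F k) w z := by
  rw [h.lie_three, conn_sum_left]

theorem curvature_apply (h : S.IsTiltedFrame F c r P) (x y w z : L) :
    S.curvatureForm lam w z ![x, y] =
      ∑ d, (S.conn lam x w (inn F d) * S.conn lam y z (inn F d)
        - S.conn lam y w (inn F d) * S.conn lam x z (inn F d))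
      + (S.conn lam x w (F 3) * S.conn lam y z (F 3) - S.conn lam y w (F 3) * S.conn lam x z (F 3))
      + ∑ d, (S.conn lam x w (ver F d) * S.conn lam y z (ver F d)
        - S.conn lam y w (ver F d) * S.conn lam x z (ver F d)) - S.conn lam ⁅x, y⁆ w z := by
  rw [h.oriented.1.curvatureForm_apply, sum_inn_add_sum_ver F (fun m =>
    S.conn lam x w m * S.conn lam y z m - S.conn lam y w m * S.conn lam x z m)]

end IsTiltedFrame

end G2Structure

/-! ### The instanton equations of a tilted frame -/

namespace G2Structure

variable {L : Type*} [LieRing L] [LieAlgebra ℝ L] {S : G2Structure L}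

/-- The contraction with `φ`, with the double sum over the basis split according to the blocks
`F_1, F_2, F_3`, then `F_4`, then `F_5, F_6, F_7`. -/
theorem phiContract_eq_blocks (F : Basis (Fin 7) ℝ L) (v : L) (α : Form L 2) :
    S.phiContract F v α =
      ∑ a, ∑ b, S.φ ![v, inn F a, inn F b] * α ![inn F a, inn F b]
      + 2 * ∑ a, S.φ ![v, F 3, inn F a] * α ![F 3, inn F a]
      + 2 * ∑ a, ∑ b, S.φ ![v, inn F a, ver F b] * α ![inn F a, ver F b]
      + 2 * ∑ b, S.φ ![v, F 3, ver F b] * α ![F 3, ver F b]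
      + ∑ a, ∑ b, S.φ ![v, ver F a, ver F b] * α ![ver F a, ver F b] := by
  obtain ⟨f, hf⟩ : ∃ f : L → L → ℝ, ∀ x y, S.φ ![v, x, y] * α ![x, y] = f x y :=
    ⟨_, fun x y => rfl⟩
  have hsymm : ∀ x y, f y x = f x y := fun x y => by
    rw [← hf, ← hf, form_swap_right, form_two_swap]
    ring
  have hself : f (F 3) (F 3) = 0 := by
    rw [← hf, phi_self_right, zero_mul]
  rw [phiContract_eq_sum]
  simp only [hf]
  rw [sum_inn_add_sum_ver F (fun x => ∑ j, f x (F j))]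
  simp only [fun x => sum_inn_add_sum_ver F (fun y => f x y), Finset.sum_add_distrib, hself,
    fun a => hsymm (F 3) (inn F a), fun a => hsymm (F 3) (ver F a)]
  rw [Finset.sum_comm (s := Finset.univ) (t := Finset.univ) (f := fun a b => f (ver F a) (inn F b))]
  simp only [fun a b => hsymm (inn F a) (ver F b)]
  ring

namespace IsTiltedFrame

variable {F : Basis (Fin 7) ℝ L} {c r : ℝ} {P : Fin 3 → Fin 3 → ℝ}

theorem phiContract_three (h : S.IsTiltedFrame F c r P) (α : Form L 2) :
    S.phiContract F (F 3) α = 2 * ∑ a, α ![inn F a, ver F a] := by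
  rw [phiContract_eq_blocks]
  simp only [h.phi_three_inn_ver, h.phi_three_inn_inn, h.phi_three_ver_ver, phi_self_left]
  simp

theorem phiContract_inn (h : S.IsTiltedFrame F c r P) (k : Fin 3) (α : Form L 2) :
    S.phiContract F (inn F k) α = c * ∑ a, ∑ b, eps k a b * α ![inn F a, inn F b]
      - 2 * r * ∑ a, ∑ b, eps k a b * α ![inn F a, ver F b]
      - 2 * α ![F 3, ver F k] - c * ∑ a, ∑ b, eps a b k * α ![ver F a, ver F b] := by
  rw [phiContract_eq_blocks]
  simp only [form_swap_left _ (F 3) (inn F k), h.phi_inn, h.phi_inn_inn_ver, h.phi_inn_ver_ver,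
    h.phi_three_inn_ver, h.phi_three_inn_inn]
  simp only [mul_assoc, ← Finset.mul_sum]
  simp
  ring

theorem phiContract_ver (h : S.IsTiltedFrame F c r P) (k : Fin 3) (α : Form L 2) :
    S.phiContract F (ver F k) α = -r * ∑ a, ∑ b, eps a b k * α ![inn F a, inn F b]
      + 2 * c * ∑ a, ∑ b, eps k b a * α ![inn F a, ver F b]
      + 2 * α ![F 3, inn F k] + r * ∑ a, ∑ b, eps k a b * α ![ver F a, ver F b] := by
  have h1 : ∀ x y : L, S.φ ![ver F k, x, y] = S.φ ![x, y, ver F k] := fun x y => by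
    rw [form_swap_left, form_swap_right, neg_neg]
  have h2 : ∀ a b, S.φ ![ver F k, inn F a, ver F b] = -S.φ ![inn F a, ver F k, ver F b] :=
    fun a b => form_swap_left _ _ _ _
  rw [phiContract_eq_blocks]
  simp only [h2, h.phi_inn_ver_ver, h.phi_ver]
  simp only [h1, h.phi_inn_inn_ver, h.phi_three_inn_ver, h.phi_three_ver_ver]
  simp only [mul_assoc, ← Finset.mul_sum, neg_mul, neg_neg, Finset.sum_neg_distrib]
  simp
  ring

/-- The squared norm of `P`. -/
def normSq (P : Fin 3 → Fin 3 → ℝ) : ℝ :=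
  P 0 0 ^ 2 + P 1 1 ^ 2 + P 2 2 ^ 2 + 2 * (P 0 1 ^ 2 + P 0 2 ^ 2 + P 1 2 ^ 2)

/-- The second elementary symmetric function of the eigenvalues of `P`. -/
def minorSum (P : Fin 3 → Fin 3 → ℝ) : ℝ :=
  P 0 0 * P 1 1 + P 0 0 * P 2 2 + P 1 1 * P 2 2 - (P 0 1 ^ 2 + P 0 2 ^ 2 + P 1 2 ^ 2)

variable {lam : ℝ}

/-- The contraction with `φ` at `F_4` of the components `g(R F_k, F_{k+4})`, summed over `k`. -/
theorem instanton_three (h : S.IsTiltedFrame F c r P) (hi : S.IsInstanton lam) :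
    (lam ^ 2 - 1) * normSq P = 0 := by
  have h1 : ∑ k, ∑ a, S.curvatureForm lam (inn F k) (ver F k) ![inn F a, ver F a] = 0 := by
    refine Finset.sum_eq_zero fun k _ => ?_
    have := hi.phiContract h.oriented.1 (F 3) (inn F k) (ver F k)
    rw [h.phiContract_three] at this
    linarith
  simp only [h.curvature_apply, h.lie_inn, conn_zero_left, h.conn_inn_inn_inn, h.conn_ver_ver_inn,
    h.conn_ver_inn_inn, h.conn_inn_ver_inn, h.conn_inn_inn_three, h.conn_ver_ver_three,
    h.conn_ver_inn_three, h.conn_inn_ver_three, h.conn_inn_inn_ver, h.conn_ver_ver_ver,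
    h.conn_ver_inn_ver, h.conn_inn_ver_ver] at h1
  simp [Fin.sum_univ_three, eps, h.symm 0 1, h.symm 0 2, h.symm 1 2] at h1
  rw [normSq]
  linear_combination 4 * h1 + lam ^ 2 * (2 / 3 * (P 0 0 * P 1 1 + P 0 0 * P 2 2 + P 1 1 * P 2 2
    - P 0 0 ^ 2 - P 1 1 ^ 2 - P 2 2 ^ 2) - 2 * (P 0 1 ^ 2 + P 0 2 ^ 2 + P 1 2 ^ 2)) * h.norm

/-- The contractions with `φ` at `F_k` of the components `g(R F_4, F_{k+4})`, summed over `k`. -/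
theorem instanton_inn (h : S.IsTiltedFrame F c r P) (hi : S.IsInstanton lam) :
    -c ^ 2 * lam * minorSum P + lam / 2 * (minorSum P + normSq P) - lam ^ 2 / 12 * normSq P
      - lam ^ 2 / 6 * minorSum P - 3 / 4 * normSq P = 0 := by
  have h1 : ∀ k, S.phiContract F (inn F k) (S.curvatureForm lam (F 3) (ver F k)) = 0 := fun k =>
    hi.phiContract h.oriented.1 _ _ _
  simp only [h.phiContract_inn, h.curvature_apply, h.lie_inn, h.lie_ver, h.conn_lie_three,
    conn_zero_left, h.conn_inn_three_inn, h.conn_inn_three_ver, h.conn_ver_three_inn,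
    h.conn_ver_three_ver, h.conn_three_three_inn, h.conn_three_three_ver, conn_self,
    h.conn_ver_ver_inn, h.conn_ver_ver_ver, h.conn_inn_ver_inn, h.conn_inn_ver_ver,
    h.conn_three_ver_inn, h.conn_three_ver_ver] at h1
  have h10 := h1 0
  have h11 := h1 1
  have h12 := h1 2
  simp [Fin.sum_univ_three, eps, h.symm 0 1, h.symm 0 2, h.symm 1 2] at h10 h11 h12
  rw [normSq, minorSum]
  linear_combination (1 / 2) * (h10 + h11 + h12) - lam / 2 * (P 0 0 * P 1 1 + P 0 0 * P 2 2
    + P 1 1 * P 2 2 + P 0 0 ^ 2 + P 1 1 ^ 2 + P 2 2 ^ 2 + P 0 1 ^ 2 + P 0 2 ^ 2 + P 1 2 ^ 2)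
    * h.norm

/-- The contractions with `φ` at `F_{k+4}` of the components `g(R F_4, F_k)`, summed over `k`. -/
theorem instanton_ver (h : S.IsTiltedFrame F c r P) (hi : S.IsInstanton lam) :
    c ^ 2 * lam * minorSum P - lam / 2 * minorSum P + lam / 2 * normSq P
      - 5 / 6 * lam ^ 2 * minorSum P - 5 / 12 * lam ^ 2 * normSq P + 1 / 4 * normSq P = 0 := by
  have h1 : ∀ k, S.phiContract F (ver F k) (S.curvatureForm lam (F 3) (inn F k)) = 0 := fun k =>
    hi.phiContract h.oriented.1 _ _ _
  simp only [h.phiContract_ver, h.curvature_apply, h.lie_inn, h.lie_inn_right, h.lie_ver,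
    conn_zero_left, h.conn_inn_three_inn, h.conn_inn_three_ver, h.conn_ver_three_inn,
    h.conn_ver_three_ver, h.conn_three_three_inn, h.conn_three_three_ver, conn_self,
    h.conn_ver_inn_inn, h.conn_ver_inn_ver, h.conn_inn_inn_inn, h.conn_inn_inn_ver,
    h.conn_three_inn_inn, h.conn_three_inn_ver] at h1
  have h10 := h1 0
  have h11 := h1 1
  have h12 := h1 2
  simp [Fin.sum_univ_three, eps, h.symm 0 1, h.symm 0 2, h.symm 1 2] at h10 h11 h12
  rw [normSq, minorSum]
  linear_combination -(1 / 2) * (h10 + h11 + h12)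
    + (lam / 2 * (P 0 0 * P 1 1 + P 0 0 * P 2 2 + P 1 1 * P 2 2 - P 0 0 ^ 2 - P 1 1 ^ 2
      - P 2 2 ^ 2 - 3 * (P 0 1 ^ 2 + P 0 2 ^ 2 + P 1 2 ^ 2))
      + lam ^ 2 / 3 * (P 0 0 + P 1 1 + P 2 2) ^ 2) * h.norm

/-- For an instanton all brackets of a tilted frame vanish. The first of the three scalar equations
leaves `λ = ±1`, and the other two exclude these values unless `P = 0`. -/
theorem eq_zero_of_isInstanton (h : S.IsTiltedFrame F c r P) (hi : S.IsInstanton lam)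
    (i j : Fin 3) : P i j = 0 := by
  have h1 := h.instanton_three hi
  have h2 := h.instanton_inn hi
  have h3 := h.instanton_ver hi
  have h4 : normSq P = 0 := by
    rcases mul_eq_zero.1 h1 with h5 | h5
    · have h6 : (lam - 1) * (lam + 1) = 0 := by linear_combination h5
      rcases mul_eq_zero.1 h6 with h7 | h7
      · obtain rfl : lam = 1 := by linarith
        -- The sum of the two equations eliminates `c` and gives `minorSum P = 0`.
        have h8 : minorSum P = 0 := by linear_combination -(h2 + h3)
        rw [h8] at h2
        linarith
      · obtain rfl : lam = -1 := by linarith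
        have h8 : minorSum P = -2 * normSq P := by linear_combination -(h2 + h3)
        -- The square of the trace is `normSq P + 2 * minorSum P`.
        have h9 : (P 0 0 + P 1 1 + P 2 2) ^ 2 = normSq P + 2 * minorSum P := by
          rw [normSq, minorSum]
          ring
        have h10 : 0 ≤ normSq P := by
          rw [normSq]
          positivity
        nlinarith [sq_nonneg (P 0 0 + P 1 1 + P 2 2)]
    · exact h5
  rw [normSq] at h4
  have h00 := sq_nonneg (P 0 0)
  have h11 := sq_nonneg (P 1 1)
  have h22 := sq_nonneg (P 2 2)
  have h01 := sq_nonneg (P 0 1)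
  have h02 := sq_nonneg (P 0 2)
  have h12 := sq_nonneg (P 1 2)
  have hz : ∀ x : ℝ, x ^ 2 ≤ 0 → x = 0 := fun x hx =>
    (pow_eq_zero_iff two_ne_zero).1 (le_antisymm hx (sq_nonneg x))
  have z00 := hz (P 0 0) (by linarith)
  have z11 := hz (P 1 1) (by linarith)
  have z22 := hz (P 2 2) (by linarith)
  have z01 := hz (P 0 1) (by linarith)
  have z02 := hz (P 0 2) (by linarith)
  have z12 := hz (P 1 2) (by linarith)
  fin_cases i <;> fin_cases j <;>
    simp [z00, z11, z22, z01, z02, z12, h.symm 0 1, h.symm 0 2, h.symm 1 2]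

end IsTiltedFrame

end G2Structure

/-! ### Consequences of coclosedness, and the dimension of the commutator -/

namespace G2Structure

variable {L : Type*} [LieRing L] [LieAlgebra ℝ L] {S : G2Structure L}

theorem form_four_swap_ends (ω : Form L 4) (a b c d : L) : ω ![d, b, c, a] = -ω ![a, b, c, d] := by
  rw [← ω.map_swap ![a, b, c, d] (i := 0) (j := 3) (by decide)]
  congr 1
  ext i
  fin_cases i <;> rfl

theorem form_four_self_ends (ω : Form L 4) (a b c : L) : ω ![a, b, c, a] = 0 :=
  ω.map_eq_zero_of_eq _ (i := 0) (j := 3) rfl (by decide)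

theorem form_four_self_mid (ω : Form L 4) (a b c : L) : ω ![a, b, b, c] = 0 :=
  ω.map_eq_zero_of_eq _ (i := 1) (j := 2) rfl (by decide)

/-- The part of `ψ` of mixed type pairs the last three basis vectors with the forms `σ_l⁺`. -/
theorem IsAdapted.psi_ver_hor_hor_ver {e : Basis (Fin 7) ℝ L} (he : S.IsAdapted e) (i k : Fin 3)
    (p q : Fin 4) : S.psi ![ver e i, hor e p, hor e q, ver e k] =
      ∑ l, eps i k l * sigmaMat l p q := by
  have key : ∀ p q u v : Fin 4, (∀ l : Fin 3, tupleSign ![(![4, 5, 6] : Fin 3 → Fin 7) l,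
      (![0, 1, 2, 3] : Fin 4 → Fin 7) u, (![0, 1, 2, 3] : Fin 4 → Fin 7) v,
      (![4, 5, 6] : Fin 3 → Fin 7) (l + 1), (![0, 1, 2, 3] : Fin 4 → Fin 7) p,
      (![0, 1, 2, 3] : Fin 4 → Fin 7) q, (![4, 5, 6] : Fin 3 → Fin 7) (l + 2)] = 1) →
      ∀ l, S.psi ![ver e (l + 1), hor e p, hor e q, ver e (l + 2)] = sigmaMat l u v := by
    intro p q u v h l
    have h2 := he.isOriented.psi_apply _ _ _ _ _ _ _ (h l)
    rw [← he.phi_ver_hor_hor]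
    simp only [hor, ver]
    rw [h2]
  have h1 : ∀ l, S.psi ![ver e (l + 1), hor e p, hor e q, ver e (l + 2)] = sigmaMat l p q := by
    intro l
    fin_cases p <;> fin_cases q <;> simp only [Fin.zero_eta, Fin.mk_one, Fin.reduceFinMk]
    · rw [form_four_self_mid]; fin_cases l <;> simp [sigmaMat]
    · rw [key 0 1 2 3 (by decide) l]; fin_cases l <;> simp [sigmaMat]
    · rw [key 0 2 3 1 (by decide) l]; fin_cases l <;> simp [sigmaMat]
    · rw [key 0 3 1 2 (by decide) l]; fin_cases l <;> simp [sigmaMat]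
    · rw [key 1 0 3 2 (by decide) l]; fin_cases l <;> simp [sigmaMat]
    · rw [form_four_self_mid]; fin_cases l <;> simp [sigmaMat]
    · rw [key 1 2 0 3 (by decide) l]; fin_cases l <;> simp [sigmaMat]
    · rw [key 1 3 2 0 (by decide) l]; fin_cases l <;> simp [sigmaMat]
    · rw [key 2 0 1 3 (by decide) l]; fin_cases l <;> simp [sigmaMat]
    · rw [key 2 1 3 0 (by decide) l]; fin_cases l <;> simp [sigmaMat]
    · rw [form_four_self_mid]; fin_cases l <;> simp [sigmaMat]
    · rw [key 2 3 0 1 (by decide) l]; fin_cases l <;> simp [sigmaMat]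
    · rw [key 3 0 2 1 (by decide) l]; fin_cases l <;> simp [sigmaMat]
    · rw [key 3 1 0 2 (by decide) l]; fin_cases l <;> simp [sigmaMat]
    · rw [key 3 2 1 0 (by decide) l]; fin_cases l <;> simp [sigmaMat]
    · rw [form_four_self_mid]; fin_cases l <;> simp [sigmaMat]
  have h10 := h1 0
  have h11 := h1 1
  have h12 := h1 2
  simp only [Fin.isValue, show (0 : Fin 3) + 1 = 1 from rfl, show (0 : Fin 3) + 2 = 2 from rfl,
    show (1 : Fin 3) + 1 = 2 from rfl, show (1 : Fin 3) + 2 = 0 from rfl,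
    show (2 : Fin 3) + 1 = 0 from rfl, show (2 : Fin 3) + 2 = 1 from rfl] at h10 h11 h12
  fin_cases i <;> fin_cases k <;>
    simp [Fin.sum_univ_three, eps, form_four_self_ends, ← h10, ← h11, ← h12,
      form_four_swap_ends _ (ver e 0) _ _ (ver e 1), form_four_swap_ends _ (ver e 1) _ _ (ver e 2),
      form_four_swap_ends _ (ver e 2) _ _ (ver e 0)]

/-- Coclosedness makes the matrix of self-dual coefficients symmetric: the value of `dψ` on
`e_1, …, e_4, e_{k+4}` is a multiple of the `k`-th skew entry of `s`. -/
theorem IsCentralFrame.symm_of_isCoclosed {e : Basis (Fin 7) ℝ L} {s a : Fin 3 → Fin 3 → ℝ}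
    (h : S.IsCentralFrame e s a) (hS : S.IsCoclosed) (i j : Fin 3) : s i j = s j i := by
  have hd : ∀ k, ∑ l, ∑ m, eps l k m * s l m = 0 := by
    intro k
    have h1 : ceDiff S.psi ![hor e 0, hor e 1, hor e 2, hor e 3, ver e k] = 0 := by
      rw [hS]
      rfl
    have h2 : ∀ p q r t, S.psi ![⁅hor e p, hor e q⁆, hor e r, hor e t, ver e k] =
        ∑ l, (-pairMat (s l) (a l) p q) * ∑ m, eps l k m * sigmaMat m r t := fun p q r t => by
      rw [h.lie_hor, form_four_sum_left]
      simp only [h.adapted.psi_ver_hor_hor_ver]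
    rw [ceDiff_apply_five] at h1
    simp only [h2, h.lie_ver_right, form_four_zero_left] at h1
    simp [pairMat, sigmaMat, tauMat, Fin.sum_univ_three] at h1 ⊢
    linarith
  have h0 := hd 0
  have h1 := hd 1
  have h2 := hd 2
  simp [Fin.sum_univ_three, eps] at h0 h1 h2
  fin_cases i <;> fin_cases j <;> simp <;> linarith

/-- If the brackets lie in the span of `e_5` and `e_6`, coclosedness makes `e_7` central: the
one-forms `x ↦ g([e_7, x], e_5)` and `x ↦ g([e_7, x], e_6)` have zero wedge product with the
symplectic form `σ₃⁺` on the first four directions. -/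
theorem IsAdapted.lie_ver_of_mem_span {e : Basis (Fin 7) ℝ L} (he : S.IsAdapted e)
    (hS : S.IsCoclosed) (hz : ∀ v : L, ⁅ver e 0, v⁆ = 0 ∧ ⁅ver e 1, v⁆ = 0)
    (hb : ∀ x y : L, ⁅x, y⁆ ∈ Submodule.span ℝ (Set.range fun k : Fin 2 => e (![4, 5] k)))
    (v : L) : ⁅ver e 2, v⁆ = 0 := by
  have hb' : ∀ x y : L, ⁅x, y⁆ = ∑ k, S.g ⁅x, y⁆ (e (![4, 5] k)) • e (![4, 5] k) := fun x y =>
    he.1.eq_sum_of_mem_span (I := ![4, 5]) (by decide) (hb x y)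
  have h0 : ∀ v : L, ⁅v, ver e 0⁆ = 0 := fun v => by rw [← lie_skew, (hz v).1, neg_zero]
  have h1 : ∀ v : L, ⁅v, ver e 1⁆ = 0 := fun v => by rw [← lie_skew, (hz v).2, neg_zero]
  have hψ : ∀ x y u v t, S.psi ![⁅x, y⁆, u, v, t] = S.g ⁅x, y⁆ (ver e 0) * S.psi ![ver e 0, u, v, t]
      + S.g ⁅x, y⁆ (ver e 1) * S.psi ![ver e 1, u, v, t] := fun x y u v t => by
    rw [hb', form_four_sum_left, ← hb', Fin.sum_univ_two]
    simp only [ver, Matrix.cons_val]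
  have h2 : ∀ x y p q k, S.psi ![⁅x, y⁆, hor e p, hor e q, ver e k] =
      S.g ⁅x, y⁆ (ver e 0) * ∑ m, eps 0 k m * sigmaMat m p q
        + S.g ⁅x, y⁆ (ver e 1) * ∑ m, eps 1 k m * sigmaMat m p q := fun x y p q k => by
    rw [hψ, he.psi_ver_hor_hor_ver, he.psi_ver_hor_hor_ver]
  have h30 : ∀ p, S.psi ![ver e 0, ver e 2, hor e p, ver e 1] = 0 := by
    have key : ∀ p u v w : Fin 4, tupleSign ![(![0, 1, 2, 3] : Fin 4 → Fin 7) u,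
      (![0, 1, 2, 3] : Fin 4 → Fin 7) v, (![0, 1, 2, 3] : Fin 4 → Fin 7) w, 4, 6,
      (![0, 1, 2, 3] : Fin 4 → Fin 7) p, 5] = 1 →
      S.psi ![ver e 0, ver e 2, hor e p, ver e 1] = 0 := by
      intro p u v w h
      have h2 := he.isOriented.psi_apply _ _ _ _ _ _ _ h
      rw [← he.phi_hor_hor_hor u v w]
      simp only [hor, ver, Matrix.cons_val]
      rw [h2]
    intro p
    fin_cases p <;> simp only [Fin.zero_eta, Fin.mk_one, Fin.reduceFinMk]
    · rw [key 0 3 1 2 (by decide)]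
    · rw [key 1 0 3 2 (by decide)]
    · rw [key 2 0 1 3 (by decide)]
    · rw [key 3 1 0 2 (by decide)]
  have h31 : ∀ p, S.psi ![ver e 1, ver e 2, hor e p, ver e 0] = 0 := fun p => by
    rw [form_four_swap_ends, h30, neg_zero]
  have h4 : ∀ x y p, S.psi ![⁅x, y⁆, ver e 2, hor e p, ver e 0] = 0 ∧
      S.psi ![⁅x, y⁆, ver e 2, hor e p, ver e 1] = 0 := fun x y p => by
    rw [hψ, hψ, h30, h31, form_four_self_ends, form_four_self_ends]
    simp
  have hd : ∀ p q r k, ceDiff S.psi ![ver e 2, hor e p, hor e q, hor e r, ver e k] = 0 := by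
    intro p q r k
    rw [hS]
    rfl
  have h5 : ∀ p, S.g ⁅ver e 2, hor e p⁆ (ver e 0) = 0 ∧ S.g ⁅ver e 2, hor e p⁆ (ver e 1) = 0 := by
    have hA : ∀ p q r, _ ∧ _ := fun p q r => ⟨hd p q r 0, hd p q r 1⟩
    simp only [ceDiff_apply_five, h2, h4, h0, h1, form_four_zero_left] at hA
    have h01 := hA 0 2 3
    have h12 := hA 1 2 3
    have h20 := hA 2 0 1
    have h30 := hA 3 0 1
    simp [Fin.sum_univ_three, eps, sigmaMat] at h01 h12 h20 h30
    intro p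
    fin_cases p <;> simp [h01, h12, h20, h30]
  have h6 : ∀ i, ⁅ver e 2, e i⁆ = 0 := by
    intro i
    refine basis_induction e (p := fun x => ⁅ver e 2, x⁆ = 0) (fun p => ?_) (fun k => ?_) i
    · have h7 := h5 p
      simp only [ver, Matrix.cons_val] at h7 ⊢
      rw [hb', Fin.sum_univ_two]
      simp only [Matrix.cons_val, h7, zero_smul, add_zero]
    · fin_cases k
      · exact h0 _
      · exact h1 _
      · exact lie_self _
  rw [← e.sum_repr v]
  simp only [lie_sum, lie_smul, h6, smul_zero, Finset.sum_const_zero]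

/-- A subspace of dimension greater than `k` contains a unit vector orthogonal to `k` given
vectors. -/
theorem exists_unit_orthogonal (S : G2Structure L) {W : Submodule ℝ L} {k : ℕ} (u : Fin k → L)
    (hk : k < finrank ℝ W) : ∃ w ∈ W, S.g w w = 1 ∧ ∀ i, S.g w (u i) = 0 := by
  have := S.finiteDimensional
  obtain ⟨x, hx, hx0⟩ := Submodule.exists_mem_ne_zero_of_ne_bot
    (LinearMap.ker_ne_bot_of_finrank_lt (f := LinearMap.pi fun i => S.g (u i) ∘ₗ W.subtype)
      (by simpa using hk))
  have hx1 : ∀ i, S.g (u i) x = 0 := fun i => congrFun (LinearMap.mem_ker.1 hx) i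
  have hpos : 0 < S.g x x := by
    refine lt_of_le_of_ne ?_ fun h => hx0 (Subtype.ext (S.g_self_eq_zero h.symm))
    rw [S.g_eq_sum]
    exact Finset.sum_nonneg fun i _ => mul_self_nonneg _
  refine ⟨(√(S.g x x))⁻¹ • (x : L), W.smul_mem _ x.2, ?_, fun i => ?_⟩
  · have h1 := Real.mul_self_sqrt hpos.le
    have h2 := (Real.sqrt_pos.2 hpos).ne'
    simp only [map_smul, LinearMap.smul_apply, smul_eq_mul]
    field_simp
    linarith
  · rw [S.g_symm]
    simp [hx1]

/-- A subspace of dimension `n` that contains `n` vectors of a basis is spanned by them. -/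
theorem eq_span_of_mem (e : Basis (Fin 7) ℝ L) {n : ℕ} {I : Fin n → Fin 7}
    (hI : Function.Injective I) {W : Submodule ℝ L} (hW : finrank ℝ W = n)
    (h : ∀ k, e (I k) ∈ W) : W = Submodule.span ℝ (Set.range fun k => e (I k)) := by
  have := e.finiteDimensional_of_finite
  have h1 : LinearIndependent ℝ fun k => e (I k) := e.linearIndependent.comp I hI
  refine (Submodule.eq_of_le_of_finrank_le ?_ ?_).symm
  · rw [Submodule.span_le]
    rintro _ ⟨k, rfl⟩
    exact h k
  · rw [hW, finrank_span_eq_card h1, Fintype.card_fin]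

/-- In dimension seven, a central commutator has dimension at most three: otherwise its complement
has dimension at most three, and the commutator is spanned by three brackets. -/
theorem finrank_commutatorIdeal_le (S : G2Structure L)
    (hc : ∀ z ∈ (commutatorIdeal L).toSubmodule, ∀ v : L, ⁅z, v⁆ = 0) :
    finrank ℝ (commutatorIdeal L).toSubmodule ≤ 3 := by
  have := S.finiteDimensional
  by_contra! hlt
  set W := (commutatorIdeal L).toSubmodule with hW
  obtain ⟨C, hC⟩ := W.exists_isCompl
  have hf := Submodule.finrank_add_eq_of_isCompl hC
  rw [finrank_eq_card_basis S.frame, Fintype.card_fin] at hf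
  -- A spanning family of the complement, padded with zeros to length three.
  obtain ⟨f, hf⟩ : ∃ f : Fin 3 → L, C ≤ Submodule.span ℝ (Set.range f) := by
    let b := finBasis ℝ C
    refine ⟨fun i => if h : i.1 < finrank ℝ C then b ⟨i, h⟩ else 0, fun x hx => ?_⟩
    have h1 := b.sum_repr ⟨x, hx⟩
    have h2 := congrArg (Subtype.val) h1
    simp only [Submodule.coe_sum, Submodule.coe_smul] at h2
    rw [← h2]
    refine Submodule.sum_mem _ fun i _ => Submodule.smul_mem _ _ (Submodule.subset_span ?_)
    exact ⟨⟨i, by omega⟩, by simp⟩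
  have h1 : ∀ x : L, ∃ z ∈ W, ∃ a : Fin 3 → ℝ, x = z + ∑ i, a i • f i := by
    intro x
    obtain ⟨z, hz, y, hy, rfl⟩ := Submodule.mem_sup.1 (hC.sup_eq_top ▸ Submodule.mem_top (x := x))
    obtain ⟨a, rfl⟩ := (Submodule.mem_span_range_iff_exists_fun ℝ).1 (hf hy)
    exact ⟨z, hz, a, rfl⟩
  have h2 : W ≤ Submodule.span ℝ (Set.range fun k : Fin 3 => ⁅f (k + 1), f (k + 2)⁆) := by
    refine commutatorIdeal_le fun x y => ?_
    obtain ⟨z, hz, a, rfl⟩ := h1 x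
    obtain ⟨z', hz', b, rfl⟩ := h1 y
    have h3 : ∀ v : L, ⁅v, z'⁆ = 0 := fun v => by rw [← lie_skew, hc z' hz', neg_zero]
    have h4 : ∀ i j, ⁅f i, f j⁆ ∈
        Submodule.span ℝ (Set.range fun k : Fin 3 => ⁅f (k + 1), f (k + 2)⁆) := by
      have h5 := fun k : Fin 3 => Submodule.subset_span (R := ℝ)
        (Set.mem_range_self (f := fun k : Fin 3 => ⁅f (k + 1), f (k + 2)⁆) k)
      intro i j
      fin_cases i <;> fin_cases j
      · simp
      · exact h5 2
      · rw [← lie_skew]; exact Submodule.neg_mem _ (h5 1)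
      · rw [← lie_skew]; exact Submodule.neg_mem _ (h5 2)
      · simp
      · exact h5 0
      · exact h5 1
      · rw [← lie_skew]; exact Submodule.neg_mem _ (h5 0)
      · simp
    rw [lie_add, h3, zero_add, add_lie, hc z hz, zero_add]
    simp only [sum_lie, lie_sum, smul_lie, lie_smul]
    exact Submodule.sum_mem _ fun i _ => Submodule.smul_mem _ _ (Submodule.sum_mem _ fun j _ =>
      Submodule.smul_mem _ _ (h4 _ _))
  have h3 := Submodule.finrank_mono h2
  have h4 := finrank_range_le_card (R := ℝ) (fun k : Fin 3 => ⁅f (k + 1), f (k + 2)⁆)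
  rw [Fintype.card_fin] at h4
  rw [Set.finrank] at h4
  omega

end G2Structure

/-! ### Existence of a central frame, and the characterisation of instantons -/

namespace G2Structure

variable {L : Type*} [LieRing L] [LieAlgebra ℝ L] {S : G2Structure L}

/-- If the commutator is central of dimension at least two, a coclosed `G₂`-structure for which some
`∇^λ` is an instanton has a central frame. -/
theorem exists_isCentralFrame_of_isInstanton
    (hc : ∀ z ∈ (commutatorIdeal L).toSubmodule, ∀ v : L, ⁅z, v⁆ = 0)
    (hdim : 2 ≤ finrank ℝ (commutatorIdeal L).toSubmodule) (hS : S.IsCoclosed) {lam : ℝ}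
    (hi : S.IsInstanton lam) : ∃ e s a, S.IsCentralFrame e s a := by
  have hle := S.finrank_commutatorIdeal_le hc
  have hmem := fun x y : L => lie_mem_commutatorIdeal x y
  set W := (commutatorIdeal L).toSubmodule with hW
  have htop : finrank ℝ (⊤ : Submodule ℝ L) = 7 := by
    rw [finrank_top, finrank_eq_card_basis S.frame, Fintype.card_fin]
  obtain ⟨u, hu, huu, -⟩ := S.exists_unit_orthogonal (W := W) (![] : Fin 0 → L) (by omega)
  obtain ⟨v, hv, hvv, hvu⟩ := S.exists_unit_orthogonal (W := W) ![u] (by omega)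
  replace hvu : S.g v u = 0 := hvu 0
  have huv : S.g u v = 0 := by rw [S.g_symm, hvu]
  obtain ⟨w, -, hww, hw⟩ := S.exists_unit_orthogonal (W := ⊤) ![u, v, S.cross u v] (by omega)
  have hwu : S.g u w = 0 := by rw [S.g_symm]; exact hw 0
  have hwv : S.g v w = 0 := by rw [S.g_symm]; exact hw 1
  have hwp : S.g (S.cross u v) w = 0 := by rw [S.g_symm]; exact hw 2
  rcases hdim.lt_or_eq with hlt | heq
  · obtain ⟨z, hz, hzz, hzuv⟩ := S.exists_unit_orthogonal (W := W) ![u, v] (by omega)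
    have hzu : S.g u z = 0 := by rw [S.g_symm]; exact hzuv 0
    have hzv : S.g v z = 0 := by rw [S.g_symm]; exact hzuv 1
    have h3 : finrank ℝ W = 3 := by omega
    set p := S.cross u v with hp
    have hpp : S.g p p = 1 := by
      rw [hp, g_cross_cross, huu, hvv, huv]
      norm_num
    have hpu : S.g u p = 0 := by rw [S.g_symm, hp, g_cross_left]
    have hpv : S.g v p = 0 := by rw [S.g_symm, hp, g_cross_right]
    set c := S.g p z with hcdef
    have hzp : S.g z p = c := S.g_symm _ _
    by_cases hy : z - c • p = 0
    · -- The commutator contains `u × v`, which is a multiple of `z`.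
      have hzc : z = c • p := sub_eq_zero.1 hy
      have hc0 : c ≠ 0 := by
        rintro h
        rw [hzc, h] at hzz
        simp at hzz
      obtain ⟨e, he, h4, h5, h6, -⟩ := S.exists_isAdapted huu hvv hww huv hwu hwv hwp
      have hver : ∀ k, ver e k ∈ W := by
        intro k
        fin_cases k
        · exact (by rw [h4]; exact hu : e 4 ∈ W)
        · exact (by rw [h5]; exact hv : e 5 ∈ W)
        · have h7 : p ∈ W := by
            rw [hzc] at hz
            exact (W.smul_mem_iff hc0).1 hz
          exact (by rw [h6]; exact h7 : e 6 ∈ W)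
      have hWe : W = Submodule.span ℝ (Set.range (ver e)) :=
        eq_span_of_mem e (I := ![4, 5, 6]) (by decide) h3 hver
      obtain ⟨s, a, h⟩ := he.exists_isCentralFrame (fun k => hc _ (hver k))
        (fun x y => hWe ▸ hmem _ _)
      exact ⟨e, s, a, h⟩
    · -- The commutator is not closed under the cross product, and all brackets vanish. The unit
      -- vector `w = (z - c (u × v)) / r` serves as `e_1`, so that `z = c e_7 + r e_1`.
      exfalso
      set r := √(S.g (z - c • p) (z - c • p)) with hr
      have hyy : S.g (z - c • p) (z - c • p) = 1 - c ^ 2 := by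
        simp only [map_sub, map_smul, LinearMap.sub_apply, LinearMap.smul_apply, smul_eq_mul, hzz,
          hzp, hpp, ← hcdef]
        ring
      have hpos : 0 < S.g (z - c • p) (z - c • p) := by
        refine lt_of_le_of_ne ?_ fun h => hy (S.g_self_eq_zero h.symm)
        rw [S.g_eq_sum]
        exact Finset.sum_nonneg fun i _ => mul_self_nonneg _
      have hr0 : r ≠ 0 := (Real.sqrt_pos.2 hpos).ne'
      have hrr : r * r = 1 - c ^ 2 := by rw [hr, Real.mul_self_sqrt hpos.le, hyy]
      obtain ⟨e, he, h4, h5, h6, h0⟩ := S.exists_isAdapted (w := r⁻¹ • (z - c • p)) huu hvv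
        (by
          simp only [map_smul, LinearMap.smul_apply, smul_eq_mul, hyy, ← hrr]
          field_simp) huv
        (by simp [hzu, hpu]) (by simp [hzv, hpv])
        (by
          rw [← hp, map_smul, map_sub, map_smul, ← hcdef, hpp]
          simp)
      obtain ⟨F, hF, hφ, hF0, hF1, hF2⟩ := he.exists_tilted (c := c) (r := r)
        (by linear_combination hrr)
      have hF2' : F 2 = z := by
        rw [hF2, h6, h0, smul_smul, mul_inv_cancel₀ hr0, one_smul]
        abel
      have hinn : ∀ k, inn F k ∈ W := by
        intro k
        fin_cases k
        · exact (by rw [hF0, h4]; exact hu : F 0 ∈ W)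
        · exact (by rw [hF1, h5]; exact hv : F 1 ∈ W)
        · exact (by rw [hF2']; exact hz : F 2 ∈ W)
      have hWF : W = Submodule.span ℝ (Set.range (inn F)) :=
        eq_span_of_mem F (I := ![0, 1, 2]) (by decide) h3 hinn
      obtain ⟨P, hP⟩ := hF.exists_isTiltedFrame hφ (by linear_combination hrr) hr0 hS
        (fun k => hc _ (hinn k)) (fun x y => hWF ▸ hmem x y)
      have hbot : W ≤ ⊥ := by
        refine commutatorIdeal_le_of_basis F fun i j => ?_
        have hPz : ∀ j, ⁅F 3, ver F j⁆ = 0 := fun j => by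
          rw [hP.lie_three]
          simp [hP.eq_zero_of_isInstanton hi]
        have hall : ∀ (q : L → Prop), (∀ k, q (inn F k)) → q (F 3) → (∀ k, q (ver F k)) →
            ∀ i, q (F i) := by
          intro q hq hq3 hqv i
          fin_cases i
          exacts [hq 0, hq 1, hq 2, hq3, hqv 0, hqv 1, hqv 2]
        rw [Submodule.mem_bot]
        refine hall (fun x => ⁅x, F j⁆ = 0) (fun k => hP.lie_inn k _) ?_ (fun k => ?_) i
        · exact hall (fun x => ⁅F 3, x⁆ = 0) (fun k => hP.lie_inn_right k _) (lie_self _) hPz j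
        · refine hall (fun x => ⁅ver F k, x⁆ = 0) (fun k => hP.lie_inn_right k _) ?_
            (fun l => hP.lie_ver k l) j
          rw [← lie_skew, hPz, neg_zero]
      rw [le_bot_iff.1 hbot, finrank_bot] at h3
      omega
  · -- A commutator of dimension two is spanned by `u` and `v`.
    obtain ⟨e, he, h4, h5, -, -⟩ := S.exists_isAdapted huu hvv hww huv hwu hwv hwp
    have hmem2 : ∀ k : Fin 2, e (![4, 5] k) ∈ W := by
      intro k
      fin_cases k
      · exact h4 ▸ hu
      · exact h5 ▸ hv
    have hWe := eq_span_of_mem e (I := ![4, 5]) (by decide) heq.symm hmem2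
    have hlie := fun x y : L => hWe ▸ hmem x y
    have h6 := he.lie_ver_of_mem_span hS (fun v => ⟨hc _ (hmem2 0) v, hc _ (hmem2 1) v⟩) hlie
    obtain ⟨s, a, h⟩ := he.exists_isCentralFrame
      (fun k => by
        fin_cases k
        · exact hc _ (hmem2 0)
        · exact hc _ (hmem2 1)
        · exact h6)
      (fun x y => by
        refine Submodule.span_mono ?_ (hlie (hor e x) (hor e y))
        rintro _ ⟨k, rfl⟩
        fin_cases k
        · exact ⟨0, rfl⟩
        · exact ⟨1, rfl⟩)
    exact ⟨e, s, a, h⟩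

end G2Structure

theorem mainTheorem3 {𝔤 : Type*} [LieRing 𝔤] [LieAlgebra ℝ 𝔤]
    (h2 : IsTwoStepNilpotent 𝔤)
    (hdim : 2 ≤ Module.finrank ℝ (commutatorIdeal 𝔤).toSubmodule)
    (S : G2Structure 𝔤) (hS : S.IsCoclosed) (lam : ℝ) :
    S.IsInstanton lam ↔
      Module.finrank ℝ (commutatorIdeal 𝔤).toSubmodule = 3 ∧
      lam = 1 ∧
      ∃ (e : Module.Basis (Fin 7) ℝ 𝔤) (μ : ℝ),
        μ ≠ 0 ∧
        S.IsOrthonormal e ∧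
        (commutatorIdeal 𝔤).toSubmodule = Submodule.span ℝ {e 4, e 5, e 6} ∧
        S.φ = phiModel e ∧
        (∀ i : Fin 3, selfDualPart e (ceDiff (Ext.coframe e ![Fin.natAdd 4 i]))
          = (μ / 3) • sigmaPlus e i) ∧
        ∀ z z' : (commutatorIdeal 𝔤).toSubmodule,
          S.j z * S.j z' - S.j z' * S.j z
            = (2 / 3 * μ) • S.j (S.tau (commutatorIdeal 𝔤).toSubmodule z z') := by
  have hc : ∀ z ∈ (commutatorIdeal 𝔤).toSubmodule, ∀ v : 𝔤, ⁅z, v⁆ = 0 := fun z hz v => by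
    rw [← lie_skew, (LieModule.mem_maxTrivSubmodule ℝ 𝔤 𝔤 z).1 (h2.2 hz) v, neg_zero]
  -- In a central frame, the condition on the self-dual part of `de^{i+4}` is one on the row `s i`.
  have hsd : ∀ {e : Basis (Fin 7) ℝ 𝔤} {s a : Fin 3 → Fin 3 → ℝ}, S.IsCentralFrame e s a →
      ∀ (c : ℝ) (i : Fin 3), selfDualPart e (ceDiff (Ext.coframe e ![Fin.natAdd 4 i])) =
        c • sigmaPlus e i ↔ ∀ j, s i j = if i = j then c else 0 := by
    intro e s a h c i
    refine G2Structure.selfDualPart_eq_iff (u := s i) (b := a i) (fun p q => ?_) (fun x k => ?_) i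
    · rw [h.adapted.1.ceDiff_coframe, h.g_lie_ver, neg_neg]
    · rw [h.adapted.1.ceDiff_coframe, h.lie_ver_right]
      simp
  constructor
  · intro hi
    obtain ⟨e, s, a, h⟩ := G2Structure.exists_isCentralFrame_of_isInstanton hc hdim hS hi
    obtain ⟨rfl, c, hc0, hs⟩ := h.eq_one_of_isInstanton
      (fun i j => h.symm_of_isCoclosed hS j i) hi hdim
    have hW := h.commutatorIdeal_eq hs hc0
    refine ⟨by rw [hW, G2Structure.finrank_span_ver], rfl, e, 3 * c, by simpa using hc0,
      h.adapted.1, by rw [hW, G2Structure.range_ver], h.adapted.2, fun i => ?_, ?_⟩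
    · rw [mul_div_cancel_left₀ c (by norm_num)]
      exact (hsd h c i).2 (hs i)
    · rw [show (2 / 3 : ℝ) * (3 * c) = 2 * c by ring]
      exact (h.commutator_j_iff hs hW).2 (h.cofactor_eq hs hi)
  · rintro ⟨-, rfl, e, μ, hμ, he, hW, hφ, hσ, hj⟩
    rw [← G2Structure.range_ver] at hW
    obtain ⟨s, a, h⟩ := G2Structure.IsAdapted.exists_isCentralFrame (S := S) ⟨he, hφ⟩
      (fun k => hc _ (hW ▸ G2Structure.ver_mem_span e k))
      (fun p q => hW ▸ lie_mem_commutatorIdeal _ _)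
    have hs : ∀ i j, s i j = if i = j then μ / 3 else 0 := fun i => (hsd h _ i).1 (hσ i)
    refine h.isInstanton_one hs ((h.commutator_j_iff hs hW).1 ?_)
    rw [show 2 * (μ / 3) = 2 / 3 * μ by ring]
    exact hj
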